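/- Let $X=V(az_1^2+2bz_1z_2+cz_2^2+2dz_1+2ez_2+f)\subseteq\mathbb{C}^2$ be an affine conic, with complex symmetric matrix $$A=\begin{bmatrix}a&b&d\\ b&c&e\\ d&e&f\end{bmatrix},\qquad A_1=\begin{bmatrix}a&b\\ b&c\end{bmatrix}\neq 0 .$$ Definitions. Let $Y\subseteq\mathbb{C}^n$ be an irreducible variety of codimension $c$ with prime ideal $I=\langle f_1,\dots,f_s\rangle\subseteq\mathbb{C}[\mathbf z]$, and let $I_{\mathrm{sing}}=I+\langle c\text{-minors of }J(f)\rangle$, where $J(f)$ is the Jacobian matrix. On $\mathbb{C}[\mathbf z,\mathbf w,\mathbf u,\mathbf v]$ let $*$ be the conjugate-linear ring involution that exchanges $z_k\leftrightarrow w_k$, $u_k\leftrightarrow v_k$ and conjugates coefficients, and let $I'$ be the ideal generated by the $(c+1)$-minors of the matrix with first row $\mathbf v-\mathbf w$ followed by the rows of $J_{\mathbf z}(f)$. The Hermitian critical ideal of $Y$ is the saturation $(I+I^*+I'+(I')^*):(I_{\mathrm{sing}}\cdot I_{\mathrm{sing}}^*)^\infty$, and its solutions at $(\mathbf u,\mathbf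 v)$ are the $(\mathbf z,\mathbf w)$ such that $(\mathbf z,\mathbf w,\mathbf u,\mathbf v)$ lies in its zero locus. The critical points of $q_{\mathbf u}(\mathbf z)=\sum_k|u_k-z_k|^2$ on $Y$ are the regular points of $Y$ at which the real differential of $q_{\mathbf u}$ vanishes on the tangent space of $Y$. For a reducible variety $X$, solutions and critical points are those of its irreducible components. The virtual Hermitian distance degree $\mathrm{vHD}(X)$ is the number of solutions for generic $(\mathbf u,\mathbf v)\in\mathbb{C}^n\times\mathbb{C}^n$ (outside a proper Zariski closed subset). The Hermitian distance degree $\mathrm{HD}(X)\subseteq\mathbb{N}$ is the set of all $k$ for which there is a nonempty open set of points $\mathbf u\in\mathbb{C}^n$ (Euclidean topology) such that $q_{\mathbf u}$ has exactly $k$ critical points on $X$ for every $\mathbf u$ in it. If $A$ is singular, then 1. $\mathrm{vHD}(X)=1$ and $\mathrm{HD}(X)=\{1\}$ if $\operatorname{rk}(A)=1$; 2. $\mathrm{vHD}(X)=2$ and $\mathrm{HD}(X)=\{2\}$ if $\operatorname{rk}(A)=2$. If $A$ is non-singular, then 1. $\mathrm{vHD}(X)=5$ and $\mathrm{HD}(X)=\{1,3\}$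 if $A_1$ is singular; 2. $\mathrm{vHD}(X)=6$ and $\mathrm{HD}(X)=\{2,4\}$ if $A_1$ is non-singular and its two singular values are equal; 3. $\mathrm{vHD}(X)=8$ and $\{2,4\}\subseteq\mathrm{HD}(X)\subseteq\{2,4,6\}$ if $A_1$ is non-singular and its two singular values are different. -/

import Mathlib

open MvPolynomial

noncomputable section

namespace HermitianDistance

/-- The ideal generated by the `k × k` minors of a matrix (with possibly infinitely many rows).
Repeated rows or columns only contribute the minor `0`. -/
def minorsIdeal {R : Type*} [CommRing R] {ι κ : Type*} (k : ℕ) (M : Matrix ι κ R) : Ideal R :=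
  Ideal.span {d | ∃ (r : Fin k → ι) (e : Fin k → κ), d = (M.submatrix r e).det}

/-- The saturation `I : J^∞`, the increasing union of the colon ideals `I : J^k`. -/
def saturation {R : Type*} [CommRing R] (I J : Ideal R) : Ideal R :=
  ⨆ k : ℕ, Submodule.colon I ((J ^ k : Ideal R) : Set R)

/-! ### Irreducible varieties, given by their prime ideal `P ⊆ ℂ[z₁, …, zₙ]` -/

/-- The Jacobian matrix `J(f)`. Its rows are the gradients of all elements `f` of `P`; modulo `P`
they are linear combinations of the gradients of any set of generators of `P`. -/
def jacobian {n : ℕ} (P : Ideal (MvPolynomial (Fin n) ℂ)) :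
    Matrix P (Fin n) (MvPolynomial (Fin n) ℂ) :=
  Matrix.of fun f j => pderiv j (f : MvPolynomial (Fin n) ℂ)

/-- The codimension of the irreducible variety `V(P)`. -/
def codim {n : ℕ} (P : Ideal (MvPolynomial (Fin n) ℂ)) : ℕ := P.height.toNat

/-- The ideal of the singular locus: `P` together with the `c`-minors of the Jacobian. -/
def singularIdeal {n : ℕ} (P : Ideal (MvPolynomial (Fin n) ℂ)) :
    Ideal (MvPolynomial (Fin n) ℂ) :=
  P ⊔ minorsIdeal (codim P) (jacobian P)

/-- The names of the four groups of variables of the ring `ℂ[z, w, u, v]`. -/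
inductive Block
  | z | w | u | v

/-- The involution `z ↔ w`, `u ↔ v`. -/
def Block.swap : Block → Block
  | z => w
  | w => z
  | u => v
  | v => u

/-- The polynomial ring `ℂ[z, w, u, v]`, where each of `z, w, u, v` stands for `n` variables. -/
abbrev BigRing (n : ℕ) : Type := MvPolynomial (Block × Fin n) ℂ

/-- The conjugate linear involution `g ↦ g^*` of `ℂ[z, w, u, v]`: it conjugates the coefficients
and exchanges `z` with `w` and `u` with `v`. -/
def starMap (n : ℕ) : BigRing n →+* BigRing n :=
  (rename (R := ℂ) (Prod.map Block.swap (id : Fin n → Fin n))).toRingHom.comp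
    (MvPolynomial.map (starRingEnd ℂ))

/-- The inclusion `ℂ[z] ⊆ ℂ[z, w, u, v]`. -/
def inclZ (n : ℕ) : MvPolynomial (Fin n) ℂ →+* BigRing n :=
  (rename (R := ℂ) fun j : Fin n => (Block.z, j)).toRingHom

/-- The matrix whose first row is `v - w` and whose other rows are those of `J_z(f)`. -/
def augmentedJacobian {n : ℕ} (P : Ideal (MvPolynomial (Fin n) ℂ)) :
    Matrix (Option P) (Fin n) (BigRing n) :=
  Matrix.of fun r j => match r with
    | none => X (Block.v, j) - X (Block.w, j)
    | some f => inclZ n (jacobian P f j)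

/-- The Hermitian critical ideal
`(I + I^* + I' + I'^*) : (I_sing · I_sing^*)^∞ ⊆ ℂ[z, w, u, v]` of an irreducible variety with
ideal `I = P`, where `I'` is generated by the `(c+1)`-minors of the augmented Jacobian. -/
def hermitianCriticalIdeal {n : ℕ} (P : Ideal (MvPolynomial (Fin n) ℂ)) : Ideal (BigRing n) :=
  let I : Ideal (BigRing n) := P.map (inclZ n)
  let I' : Ideal (BigRing n) := minorsIdeal (codim P + 1) (augmentedJacobian P)
  let S : Ideal (BigRing n) := (singularIdeal P).map (inclZ n)
  saturation (I ⊔ I.map (starMap n) ⊔ I' ⊔ I'.map (starMap n)) (S * S.map (starMap n))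

/-- The point `(z, w, u, v)` of the affine space with coordinate ring `ℂ[z, w, u, v]`. -/
def bigPoint {n : ℕ} (z w u v : Fin n → ℂ) : Block × Fin n → ℂ
  | (Block.z, j) => z j
  | (Block.w, j) => w j
  | (Block.u, j) => u j
  | (Block.v, j) => v j

/-- The regular points of the irreducible variety `V(P)`. -/
def regularLocus {n : ℕ} (P : Ideal (MvPolynomial (Fin n) ℂ)) : Set (Fin n → ℂ) :=
  zeroLocus ℂ P \ zeroLocus ℂ (singularIdeal P)

/-- The tangent space `T_z V(P)` (at a regular point `z`), as a subset of `ℂⁿ`. -/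
def tangentSpace {n : ℕ} (P : Ideal (MvPolynomial (Fin n) ℂ)) (z : Fin n → ℂ) :
    Set (Fin n → ℂ) :=
  {t | ∀ f ∈ P, ∑ j, eval z (pderiv j f) * t j = 0}

/-- The squared Hermitian distance `q_u(z) = q(u - z, u - z)`, where `q` is the standard
Hermitian inner product of `ℂⁿ`. -/
def sqDist {n : ℕ} (u z : Fin n → ℂ) : ℝ := ∑ j, ‖u j - z j‖ ^ 2

/-- The critical points of the restriction of `q_u` to the regular part of `V(P)`: the regular
points at which the real differential of `q_u` vanishes on the tangent space. -/
def criticalPointsIrred {n : ℕ} (P : Ideal (MvPolynomial (Fin n) ℂ)) (u : Fin n → ℂ) :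
    Set (Fin n → ℂ) :=
  {z | z ∈ regularLocus P ∧ ∀ t ∈ tangentSpace P z, fderiv ℝ (sqDist u) z t = 0}

/-! ### Arbitrary varieties, component by component -/

/-- The prime ideals of the irreducible components of an algebraic variety `X ⊆ ℂⁿ`. -/
def components {n : ℕ} (X : Set (Fin n → ℂ)) : Set (Ideal (MvPolynomial (Fin n) ℂ)) :=
  (vanishingIdeal ℂ X).minimalPrimes

/-- The solutions `(z, w)` of the Hermitian critical ideals, at the point `(u, v)`, of the
irreducible components of `X`. -/
def virtualCriticalPoints {n : ℕ} (X : Set (Fin n → ℂ)) (u v : Fin n → ℂ) :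
    Set ((Fin n → ℂ) × (Fin n → ℂ)) :=
  {p | ∃ P ∈ components X, bigPoint p.1 p.2 u v ∈ zeroLocus ℂ (hermitianCriticalIdeal P)}

/-- The critical points of `q_u` on the regular parts of the irreducible components of `X`. -/
def criticalPoints {n : ℕ} (X : Set (Fin n → ℂ)) (u : Fin n → ℂ) : Set (Fin n → ℂ) :=
  {z | ∃ P ∈ components X, z ∈ criticalPointsIrred P u}

/-- `IsVHD X d` says that the virtual Hermitian Distance degree of `X` is `d`: for generic
`(u, v)`, that is, outside a proper Zariski closed subset of `ℂⁿ × ℂⁿ`, the Hermitian critical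
ideal has exactly `d` solutions. -/
def IsVHD {n : ℕ} (X : Set (Fin n → ℂ)) (d : ℕ) : Prop :=
  ∃ g : MvPolynomial (Fin n ⊕ Fin n) ℂ, g ≠ 0 ∧
    ∀ u v : Fin n → ℂ, eval (Sum.elim u v) g ≠ 0 →
      (virtualCriticalPoints X u v).encard = (d : ℕ∞)

/-- The virtual Hermitian Distance degree is unique. -/
theorem IsVHD.unique {n : ℕ} {X : Set (Fin n → ℂ)} {d e : ℕ} (hd : IsVHD X d)
    (he : IsVHD X e) : d = e := by
  obtain ⟨g, hg, Hg⟩ := hd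
  obtain ⟨h, hh, Hh⟩ := he
  have hne : g * h ≠ 0 := mul_ne_zero hg hh
  obtain ⟨x, hx⟩ : ∃ x, eval x (g * h) ≠ 0 := by
    by_contra H
    push Not at H
    exact hne (MvPolynomial.funext fun x => by rw [H x, map_zero])
  rw [map_mul, ← Sum.elim_comp_inl_inr x] at hx
  have h1 := Hg _ _ (left_ne_zero_of_mul hx)
  have h2 := Hh _ _ (right_ne_zero_of_mul hx)
  exact_mod_cast h1.symm.trans h2

/-- The Hermitian Distance degree of `X`: the set of all numbers of critical points of `q_u` that
stay constant when `u` varies in some nonempty open set. (The product topology on `ℂⁿ` is the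
topology induced by `q`.) -/
def HD {n : ℕ} (X : Set (Fin n → ℂ)) : Set ℕ :=
  {k | ∃ U : Set (Fin n → ℂ), IsOpen U ∧ U.Nonempty ∧
    ∀ u ∈ U, (criticalPoints X u).encard = (k : ℕ∞)}

/-! ### Affine conics -/

/-- The affine conic
`V(a z₁² + 2 b z₁ z₂ + c z₂² + 2 d z₁ + 2 e z₂ + f) ⊆ ℂ²` of the symmetric matrix
`A = !![a, b, d; b, c, e; d, e, f]`. -/
def affineConic (A : Matrix (Fin 3) (Fin 3) ℂ) : Set (Fin 2 → ℂ) :=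
  {z | ![z 0, z 1, 1] ⬝ᵥ A.mulVec ![z 0, z 1, 1] = 0}

/-- The `2 × 2` leading principal submatrix. -/
def leadingBlock (A : Matrix (Fin 3) (Fin 3) ℂ) : Matrix (Fin 2) (Fin 2) ℂ :=
  A.submatrix Fin.castSucc Fin.castSucc

/-- The two singular values `i = 0, 1` of a `2 × 2` complex matrix (in decreasing order, with
multiplicity), those of the linear map it defines on the Hermitian space `ℂ²`. -/
def singularValue (B : Matrix (Fin 2) (Fin 2) ℂ) (i : Fin 2) : ℝ :=
  (Matrix.toEuclideanLin B).singularValues i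

end HermitianDistance

end

open MvPolynomial
noncomputable section
namespace HermitianDistance

/-! ### Smooth plane curves -/

/-! On a smooth plane curve the singular ideal is the unit ideal, so the saturation does nothing.
The solutions at (u, v) are then the pairs (z, w) with z on the curve and v - w proportional to the
gradient at z, together with the conjugate condition on w (`mem_hermitianCriticalIdeal_iff`). For v
= ū the map (z, w) ↦ (w̄, z̄) is an involution of this set, and its fixed points are the critical
points. Hence each number in HD is at most vHD and has the same parity (`GenericCount.mod_two`).

A singular conic is one line or two distinct lines, and each line contributes one solution, given by
orthogonal projection.

For a nonsingular conic the counts are invariant under Hermitian similarities. Takagi factorization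
makes A₁ diagonal with entries σ, τ ≥ 0, and completing squares and rescaling leaves three normal
forms (`sameCounts_cases`): the parabola z₁² = 2z₂, the circle z₁z₂ = 1 in isotropic coordinates,
and the ellipses z₁² + k z₂² = 1 with k > 1.

The virtual degree comes from elimination (`RootCount`). One function of the solution (1 + z₁w₁/2,
then z₁w₁, then the product of the two Lagrange multipliers) satisfies an equation of degree 5, 6 or
8 over ℂ[u, v], and Cramer's rule recovers the solution from it. One separable specialization makes
the generic member separable (`generic_separable`), so the number of solutions is the degree.

For the upper bounds on HD, 0 is excluded by a nearest point on the curve. If the largest value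
occurred, every root of the polynomial would come from a critical point and so be positive. For the
quintic the roots would be at least 1 with sum 1. For the sextic the signs of the coefficients
disagree. For the octic, a sign analysis of two real functions leaves room for only five critical
points (`DualData.card_le`).

The values claimed to occur are realized at explicit u whose critical points are all nondegenerate.
The inverse function theorem and an a priori bound make the count locally constant there
(`mem_openCounts`). -/

theorem mem_zeroLocus_iff_le_ker {σ : Type*} {I : Ideal (MvPolynomial σ ℂ)} {x : σ → ℂ} :
    x ∈ zeroLocus ℂ I ↔ I ≤ RingHom.ker (eval x) := by
  simp only [mem_zeroLocus_iff, SetLike.le_def, RingHom.mem_ker]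
  simp [aeval_eq_eval]

theorem saturation_top {R : Type*} [CommRing R] (I : Ideal R) : saturation I ⊤ = I := by
  have h : ∀ k : ℕ, Submodule.colon I (((⊤ : Ideal R) ^ k : Ideal R) : Set R) = I := by
    intro k
    rw [Ideal.top_pow]
    ext x
    rw [Submodule.mem_colon]
    constructor
    · intro h
      simpa using h 1 (by simp)
    · intro h p _
      exact I.mul_mem_right p h
  simp only [saturation, h, ciSup_const]

theorem codim_span_singleton {F : MvPolynomial (Fin 2) ℂ} (hF : Prime F) :
    codim (Ideal.span {F}) = 1 := by
  rw [codim, Ideal.height_span_singleton_eq_one_of_mem_nonZeroDivisors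
    (mem_nonZeroDivisors_of_ne_zero hF.ne_zero) hF.not_isUnit]
  rfl

theorem eval_pderiv_mul {F : MvPolynomial (Fin 2) ℂ} {z : Fin 2 → ℂ} (hz : eval z F = 0)
    (h : MvPolynomial (Fin 2) ℂ) (j : Fin 2) :
    eval z (pderiv j (F * h)) = eval z h * eval z (pderiv j F) := by
  simp [Derivation.leibniz, hz]

/-- A polynomial defines a smooth curve when its gradient has no zero on the curve. -/
def IsSmoothCurve (F : MvPolynomial (Fin 2) ℂ) : Prop :=
  ∀ z, eval z F = 0 → eval z (pderiv 0 F) ≠ 0 ∨ eval z (pderiv 1 F) ≠ 0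

/-- In codimension one the minors include the two partial derivatives of F, so smoothness leaves no
common zero, and the Nullstellensatz applies. -/
theorem singularIdeal_eq_top {F : MvPolynomial (Fin 2) ℂ} (hF : Prime F)
    (hs : IsSmoothCurve F) : singularIdeal (Ideal.span {F}) = ⊤ := by
  have h0 : zeroLocus ℂ (singularIdeal (Ideal.span {F})) = ∅ := by
    refine Set.eq_empty_of_forall_notMem fun z hz => ?_
    rw [mem_zeroLocus_iff_le_ker, singularIdeal, sup_le_iff, codim_span_singleton hF] at hz
    have hz0 : eval z F = 0 := hz.1 (Ideal.mem_span_singleton_self F)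
    have hd : ∀ j, eval z (pderiv j F) = 0 := fun j => by
      refine hz.2 (Ideal.subset_span ⟨fun _ => ⟨F, Ideal.mem_span_singleton_self F⟩,
        fun _ => j, ?_⟩)
      simp [jacobian]
    rcases hs z hz0 with h | h
    · exact h (hd 0)
    · exact h (hd 1)
  have h1 := vanishingIdeal_zeroLocus_eq_radical (K := ℂ) (singularIdeal (Ideal.span {F}))
  rw [h0, vanishingIdeal_empty] at h1
  exact Ideal.radical_eq_top.mp h1.symm

theorem eval_inclZ (x : Block × Fin 2 → ℂ) (f : MvPolynomial (Fin 2) ℂ) :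
    eval x (inclZ 2 f) = eval (fun j => x (Block.z, j)) f := by
  simp [inclZ, eval_rename, Function.comp_def]

theorem eval_starMap (z w u v : Fin 2 → ℂ) (g : BigRing 2) :
    eval (bigPoint z w u v) (starMap 2 g) =
      star (eval (bigPoint (star w) (star z) (star v) (star u)) g) := by
  have h1 : (bigPoint z w u v ∘ Prod.map Block.swap (id : Fin 2 → Fin 2)) =
      fun i => starRingEnd ℂ (bigPoint (star w) (star z) (star v) (star u) i) := by
    funext ⟨b, j⟩
    cases b <;> simp [bigPoint, Block.swap]
  simp only [starMap, AlgHom.toRingHom_eq_coe, RingHom.coe_comp, RingHom.coe_coe,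
    Function.comp_apply, eval_rename, h1]
  rw [eval_map]
  exact (MvPolynomial.eval₂_comp_left (starRingEnd ℂ) (RingHom.id ℂ) _ g).symm

/-- `z` lies on the curve and `a` is proportional to the gradient at `z`. -/
def IsNormalAt (F : MvPolynomial (Fin 2) ℂ) (z a : Fin 2 → ℂ) : Prop :=
  eval z F = 0 ∧ eval z (pderiv 0 F) * a 1 = eval z (pderiv 1 F) * a 0

/-- The Jacobian has a row for every element gF of the ideal, but on the curve the gradient of gF is
g(z) times that of F. Every 2-minor is therefore zero or a multiple of the one formed by v - w and
the gradient of F. -/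
theorem isNormalAt_iff (F : MvPolynomial (Fin 2) ℂ) (z w u v : Fin 2 → ℂ) :
    ((Ideal.span {F}).map (inclZ 2) ≤ RingHom.ker (eval (bigPoint z w u v)) ∧
      minorsIdeal 2 (augmentedJacobian (Ideal.span {F})) ≤
        RingHom.ker (eval (bigPoint z w u v))) ↔ IsNormalAt F z (v - w) := by
  rw [Ideal.map_le_iff_le_comap, Ideal.span_singleton_le_iff_mem, Ideal.mem_comap,
    RingHom.mem_ker, eval_inclZ]
  change eval z F = 0 ∧ _ ↔ _
  refine and_congr_right fun hz => ?_
  rw [minorsIdeal, Ideal.span_le]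
  constructor
  · intro h
    have := h (show _ from ⟨![none, some ⟨F, Ideal.mem_span_singleton_self F⟩], ![0, 1], rfl⟩)
    simp only [SetLike.mem_coe, RingHom.mem_ker, Matrix.det_fin_two, Matrix.submatrix_apply,
      augmentedJacobian, Matrix.of_apply, jacobian, map_sub, map_mul, eval_inclZ, eval_X,
      Matrix.cons_val_zero, Matrix.cons_val_one] at this
    simp only [bigPoint] at this
    simp only [Pi.sub_apply]
    linear_combination -this
  · rintro h d ⟨r, e, rfl⟩
    have key : ∀ f : Ideal.span {F}, ∃ c : ℂ, ∀ j, eval (bigPoint z w u v)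
        (inclZ 2 (pderiv j (f : MvPolynomial (Fin 2) ℂ))) = c * eval z (pderiv j F) := by
      rintro ⟨f, hf⟩
      obtain ⟨g, rfl⟩ := Ideal.mem_span_singleton'.mp hf
      refine ⟨eval z g, fun j => ?_⟩
      rw [eval_inclZ, ← eval_pderiv_mul hz g j, mul_comm F g]
      rfl
    have hcross : ∀ i j, eval z (pderiv i F) * (v - w) j = eval z (pderiv j F) * (v - w) i := by
      intro i j
      fin_cases i <;> fin_cases j <;> simp <;> simp at h
      · exact h
      · exact h.symm
    simp only [SetLike.mem_coe, RingHom.mem_ker, Matrix.det_fin_two, Matrix.submatrix_apply,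
      map_sub, map_mul]
    simp only [Pi.sub_apply] at hcross
    rcases h0 : r 0 with _ | f <;> rcases h1 : r 1 with _ | f'
    · simp [augmentedJacobian, mul_comm]
    · obtain ⟨c, hc⟩ := key f'
      simp only [augmentedJacobian, Matrix.of_apply, jacobian, hc, map_sub, eval_X, bigPoint]
      linear_combination c * hcross (e 1) (e 0)
    · obtain ⟨c, hc⟩ := key f
      simp only [augmentedJacobian, Matrix.of_apply, jacobian, hc, map_sub, eval_X, bigPoint]
      linear_combination c * hcross (e 0) (e 1)
    · obtain ⟨c, hc⟩ := key f
      obtain ⟨c', hc'⟩ := key f'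
      simp only [augmentedJacobian, Matrix.of_apply, jacobian, hc, hc']
      ring

theorem mem_hermitianCriticalIdeal_iff {F : MvPolynomial (Fin 2) ℂ} (hF : Prime F)
    (hs : IsSmoothCurve F) (z w u v : Fin 2 → ℂ) :
    bigPoint z w u v ∈ zeroLocus ℂ (hermitianCriticalIdeal (Ideal.span {F})) ↔
      IsNormalAt F z (v - w) ∧ IsNormalAt F (star w) (star (u - z)) := by
  have hstar : ∀ I : Ideal (BigRing 2), I.map (starMap 2) ≤
      RingHom.ker (eval (bigPoint z w u v)) ↔
      I ≤ RingHom.ker (eval (bigPoint (star w) (star z) (star v) (star u))) := by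
    intro I
    rw [Ideal.map_le_iff_le_comap]
    simp only [SetLike.le_def, Ideal.mem_comap, RingHom.mem_ker, eval_starMap, star_eq_zero]
  rw [mem_zeroLocus_iff_le_ker]
  simp only [hermitianCriticalIdeal, singularIdeal_eq_top hF hs, Ideal.map_top, Ideal.top_mul,
    saturation_top, codim_span_singleton hF, sup_le_iff, hstar]
  rw [star_sub, ← isNormalAt_iff F z w u v, ← isNormalAt_iff F (star w) (star z) (star v) (star u)]
  tauto

theorem fderiv_sqDist (u z t : Fin 2 → ℂ) :
    fderiv ℝ (sqDist u) z t = -2 * (∑ j, star (u j - z j) * t j).re := by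
  have h : HasFDerivAt (sqDist u) (∑ j, (2 • (innerSL ℝ (u j - z j)).comp
      (-(ContinuousLinearMap.proj (R := ℝ) (φ := fun _ : Fin 2 => ℂ) j)))) z := by
    unfold sqDist
    refine HasFDerivAt.fun_sum fun j _ => ?_
    exact (((ContinuousLinearMap.proj (R := ℝ) (φ := fun _ : Fin 2 => ℂ) j).hasFDerivAt).const_sub
      (u j)).norm_sq
  rw [h.fderiv]
  simp [Complex.inner]
  ring

/-- The real differential is, up to a factor, the real part of a complex linear functional, and the
tangent space is a complex line. The real part vanishes on that line only if the functional does. -/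
theorem mem_criticalPointsIrred_iff {F : MvPolynomial (Fin 2) ℂ} (hF : Prime F)
    (hs : IsSmoothCurve F) (z u : Fin 2 → ℂ) :
    z ∈ criticalPointsIrred (Ideal.span {F}) u ↔ IsNormalAt F z (star (u - z)) := by
  rw [criticalPointsIrred, Set.mem_ofPred_eq, regularLocus, singularIdeal_eq_top hF hs,
    zeroLocus_top]
  have h1 : z ∈ zeroLocus ℂ (Ideal.span {F}) ↔ eval z F = 0 := by
    rw [mem_zeroLocus_iff_le_ker, Ideal.span_singleton_le_iff_mem, RingHom.mem_ker]
  simp only [Set.bot_eq_empty, Set.sdiff_empty, h1]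
  refine and_congr_right fun hz => ?_
  have ht : ∀ t, t ∈ tangentSpace (Ideal.span {F}) z ↔
      eval z (pderiv 0 F) * t 0 + eval z (pderiv 1 F) * t 1 = 0 := by
    intro t
    constructor
    · intro h
      simpa using h F (Ideal.mem_span_singleton_self F)
    · rintro h f hf
      obtain ⟨g, rfl⟩ := Ideal.mem_span_singleton'.mp hf
      rw [mul_comm]
      simp only [eval_pderiv_mul hz, Fin.sum_univ_two]
      linear_combination eval z g * h
  simp only [ht, fderiv_sqDist, Fin.sum_univ_two, Pi.star_apply, Pi.sub_apply]
  set a := eval z (pderiv 0 F)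
  set b := eval z (pderiv 1 F)
  constructor
  · intro h
    set E := a * star (u 1 - z 1) - b * star (u 0 - z 0) with hE
    -- The tangent vector (-b, a) is scaled by the conjugate of `E`, so that the functional takes
    -- the value |E|² on it.
    have := h ![-(star E * b), star E * a] (by simp; ring)
    have h2 : star (u 0 - z 0) * (![-(star E * b), star E * a] : Fin 2 → ℂ) 0 +
        star (u 1 - z 1) * (![-(star E * b), star E * a] : Fin 2 → ℂ) 1 = star E * E := by
      simp [hE]; ring
    rw [h2, ← starRingEnd_apply, ← Complex.normSq_eq_conj_mul_self, Complex.ofReal_re] at this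
    have h3 : E = 0 := Complex.normSq_eq_zero.mp (by linarith)
    linear_combination h3
  · intro h t ht
    have : star (u 0 - z 0) * t 0 + star (u 1 - z 1) * t 1 = 0 := by
      rcases hs z hz with h0 | h0
      · have : a * (star (u 0 - z 0) * t 0 + star (u 1 - z 1) * t 1) = 0 := by
          linear_combination t 1 * h + star (u 0 - z 0) * ht
        exact (mul_eq_zero.mp this).resolve_left h0
      · have : b * (star (u 0 - z 0) * t 0 + star (u 1 - z 1) * t 1) = 0 := by
          linear_combination -t 0 * h + star (u 1 - z 1) * ht
        exact (mul_eq_zero.mp this).resolve_left h0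
    rw [this]
    simp

theorem components_zeroSet {F : MvPolynomial (Fin 2) ℂ} (hF : Prime F) :
    components {z | eval z F = 0} = {Ideal.span {F}} := by
  have hp : (Ideal.span {F}).IsPrime := (Ideal.span_singleton_prime hF.ne_zero).mpr hF
  have h1 : {z | eval z F = 0} = zeroLocus ℂ (Ideal.span {F}) := by
    ext z
    rw [mem_zeroLocus_iff_le_ker, Ideal.span_singleton_le_iff_mem, RingHom.mem_ker]
    rfl
  rw [components, h1, MvPolynomial.IsPrime.vanishingIdeal_zeroLocus, Ideal.minimalPrimes_eq_subsingleton_self]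

end HermitianDistance
end

open MvPolynomial
noncomputable section
namespace HermitianDistance

/-! ### Curves with two components. -/

theorem components_zeroSet_mul {F G : MvPolynomial (Fin 2) ℂ} (hF : Prime F) (hG : Prime G)
    (hFG : ¬ F ∣ G) (hGF : ¬ G ∣ F) :
    components {z | eval z F = 0 ∨ eval z G = 0} = {Ideal.span {F}, Ideal.span {G}} := by
  have hpF : (Ideal.span {F}).IsPrime := (Ideal.span_singleton_prime hF.ne_zero).mpr hF
  have hpG : (Ideal.span {G}).IsPrime := (Ideal.span_singleton_prime hG.ne_zero).mpr hG
  have h1 : {z | eval z F = 0 ∨ eval z G = 0} = zeroLocus ℂ (Ideal.span {F * G}) := by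
    ext z
    rw [mem_zeroLocus_iff_le_ker, Ideal.span_singleton_le_iff_mem, RingHom.mem_ker, map_mul,
      mul_eq_zero]
    rfl
  rw [components, h1, vanishingIdeal_zeroLocus_eq_radical, Ideal.radical_minimalPrimes]
  have hle : ∀ P : Ideal (MvPolynomial (Fin 2) ℂ), P.IsPrime → Ideal.span {F * G} ≤ P →
      Ideal.span {F} ≤ P ∨ Ideal.span {G} ≤ P := by
    intro P hP h
    rw [Ideal.span_singleton_le_iff_mem] at h
    simpa only [Ideal.span_singleton_le_iff_mem] using hP.mem_or_mem h
  have hleF : Ideal.span {F * G} ≤ Ideal.span {F} :=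
    Ideal.span_singleton_le_span_singleton.mpr (dvd_mul_right _ _)
  have hleG : Ideal.span {F * G} ≤ Ideal.span {G} :=
    Ideal.span_singleton_le_span_singleton.mpr (dvd_mul_left _ _)
  ext P
  simp only [Set.mem_insert_iff, Set.mem_singleton_iff]
  constructor
  · rintro ⟨⟨hP, hP1⟩, hP2⟩
    rcases hle P hP hP1 with h | h
    · exact Or.inl (le_antisymm (hP2 ⟨hpF, hleF⟩ h) h)
    · exact Or.inr (le_antisymm (hP2 ⟨hpG, hleG⟩ h) h)
  · rintro (rfl | rfl)
    · refine ⟨⟨hpF, hleF⟩, ?_⟩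
      rintro Q ⟨hQ, hQ1⟩ hQ2
      rcases hle Q hQ hQ1 with h | h
      · exact h
      · exact absurd (Ideal.span_singleton_le_span_singleton.mp (h.trans hQ2)) hFG
    · refine ⟨⟨hpG, hleG⟩, ?_⟩
      rintro Q ⟨hQ, hQ1⟩ hQ2
      rcases hle Q hQ hQ1 with h | h
      · exact absurd (Ideal.span_singleton_le_span_singleton.mp (h.trans hQ2)) hGF
      · exact h

/-! ### Affine linear forms -/

/-- The affine linear form `l₀ z₁ + l₁ z₂ + l₂`. -/
def linePoly (l : Fin 3 → ℂ) : MvPolynomial (Fin 2) ℂ :=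
  C (l 0) * X 0 + C (l 1) * X 1 + C (l 2)

@[simp] theorem eval_linePoly (l : Fin 3 → ℂ) (z : Fin 2 → ℂ) :
    eval z (linePoly l) = l 0 * z 0 + l 1 * z 1 + l 2 := by
  simp [linePoly]

@[simp] theorem pderiv_zero_linePoly (l : Fin 3 → ℂ) : pderiv 0 (linePoly l) = C (l 0) := by
  simp [linePoly, pderiv_X]

@[simp] theorem pderiv_one_linePoly (l : Fin 3 → ℂ) : pderiv 1 (linePoly l) = C (l 1) := by
  simp [linePoly, pderiv_X]

theorem eq_linePoly_of_totalDegree_le_one {G : MvPolynomial (Fin 2) ℂ} (h : G.totalDegree ≤ 1) :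
    ∃ l : Fin 3 → ℂ, G = linePoly l := by
  refine ⟨![coeff (Finsupp.single 0 1) G, coeff (Finsupp.single 1 1) G, coeff 0 G], ?_⟩
  ext d
  have hX : ∀ i : Fin 2, coeff d (X i : MvPolynomial (Fin 2) ℂ) =
      if Finsupp.single i 1 = d then 1 else 0 := fun i => coeff_X i d
  simp only [linePoly, coeff_add, coeff_C_mul, coeff_C, hX, Matrix.cons_val_zero,
    Matrix.cons_val_one, Matrix.cons_val]
  have h01 : (Finsupp.single (0 : Fin 2) 1 : Fin 2 →₀ ℕ) ≠ Finsupp.single 1 1 := by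
    intro h
    have := DFunLike.congr_fun h 0
    simp at this
  have h0 : ∀ i : Fin 2, (0 : Fin 2 →₀ ℕ) ≠ Finsupp.single i 1 := by
    intro i h
    have := DFunLike.congr_fun h i
    simp at this
  by_cases e0 : Finsupp.single 0 1 = d
  · subst e0
    simp [h01.symm, h0]
  by_cases e1 : Finsupp.single 1 1 = d
  · subst e1
    simp [h01, h0]
  by_cases e2 : 0 = d
  · subst e2
    simp
  simp only [e0, e1, e2, if_false, mul_zero, add_zero]
  by_contra hne
  have hd := (le_totalDegree (mem_support_iff.mpr hne)).trans h
  rw [Finsupp.sum_fintype _ _ (by simp), Fin.sum_univ_two] at hd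
  have hcases : (d 0 = 0 ∧ d 1 = 0) ∨ (d 0 = 1 ∧ d 1 = 0) ∨ (d 0 = 0 ∧ d 1 = 1) := by omega
  rcases hcases with ⟨a, b⟩ | ⟨a, b⟩ | ⟨a, b⟩
  · exact e2 (by ext i; fin_cases i <;> simp [a, b])
  · exact e0 (by ext i; fin_cases i <;> simp [a, b])
  · exact e1 (by ext i; fin_cases i <;> simp [a, b])

theorem totalDegree_linePoly_le (l : Fin 3 → ℂ) : (linePoly l).totalDegree ≤ 1 := by
  unfold linePoly
  refine (totalDegree_add _ _).trans (max_le ((totalDegree_add _ _).trans (max_le ?_ ?_)) ?_)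
  · exact (totalDegree_mul _ _).trans (by simp)
  · exact (totalDegree_mul _ _).trans (by simp)
  · simp

theorem prime_linePoly {l : Fin 3 → ℂ} (hl : l 0 ≠ 0 ∨ l 1 ≠ 0) : Prime (linePoly l) := by
  have hconst : ∀ r, linePoly l ≠ C r := by
    intro r h
    have h0 := congrArg (pderiv 0) h
    have h1 := congrArg (pderiv 1) h
    simp at h0 h1
    tauto
  have h0 : linePoly l ≠ 0 := by simpa using hconst 0
  refine Irreducible.prime ⟨fun h => ?_, fun a b hab => ?_⟩
  · obtain ⟨r, -, h⟩ := isUnit_iff_eq_C_of_isReduced.mp h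
    exact hconst r h
  · have ha : a ≠ 0 := by rintro rfl; simp at hab; exact h0 hab
    have hb : b ≠ 0 := by rintro rfl; simp at hab; exact h0 hab
    have hd := totalDegree_linePoly_le l
    rw [hab, totalDegree_mul_of_isDomain ha hb] at hd
    rcases Nat.eq_zero_or_pos a.totalDegree with h | h
    · left
      rw [totalDegree_eq_zero_iff_eq_C.mp h] at ha ⊢
      exact (IsUnit.mk0 _ (by simpa using ha)).map C
    · right
      have h : b.totalDegree = 0 := by omega
      rw [totalDegree_eq_zero_iff_eq_C.mp h] at hb ⊢
      exact (IsUnit.mk0 _ (by simpa using hb)).map C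

theorem isSmoothCurve_linePoly {l : Fin 3 → ℂ} (hl : l 0 ≠ 0 ∨ l 1 ≠ 0) :
    IsSmoothCurve (linePoly l) := by
  intro z _
  simpa using hl

/-! ### Smooth conics -/

/-- The value at `z` of the quadratic polynomial of `A`. -/
def conicVal (A : Matrix (Fin 3) (Fin 3) ℂ) (z : Fin 2 → ℂ) : ℂ :=
  ![z 0, z 1, 1] ⬝ᵥ A.mulVec ![z 0, z 1, 1]

/-- Half the `i`-th partial derivative of the quadratic polynomial of a symmetric `A`
(`i = 0, 1`). -/
def conicGrad (A : Matrix (Fin 3) (Fin 3) ℂ) (z : Fin 2 → ℂ) (i : Fin 3) : ℂ :=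
  A i 0 * z 0 + A i 1 * z 1 + A i 2

/-- The quadratic polynomial of `A`. -/
def conicPoly (A : Matrix (Fin 3) (Fin 3) ℂ) : MvPolynomial (Fin 2) ℂ :=
  X 0 * linePoly (A 0) + X 1 * linePoly (A 1) + linePoly (A 2)

theorem conicVal_eq (A : Matrix (Fin 3) (Fin 3) ℂ) (z : Fin 2 → ℂ) :
    conicVal A z = z 0 * conicGrad A z 0 + z 1 * conicGrad A z 1 + conicGrad A z 2 := by
  simp [conicVal, conicGrad, Matrix.mulVec, dotProduct, Fin.sum_univ_three]

theorem eval_conicPoly (A : Matrix (Fin 3) (Fin 3) ℂ) (z : Fin 2 → ℂ) :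
    eval z (conicPoly A) = conicVal A z := by
  simp [conicPoly, conicVal_eq, conicGrad]

theorem affineConic_eq (A : Matrix (Fin 3) (Fin 3) ℂ) :
    affineConic A = {z | eval z (conicPoly A) = 0} := by
  ext z
  simp only [eval_conicPoly]
  rfl

theorem eval_pderiv_conicPoly {A : Matrix (Fin 3) (Fin 3) ℂ} (hA : A.IsSymm) (z : Fin 2 → ℂ) :
    eval z (pderiv 0 (conicPoly A)) = 2 * conicGrad A z 0 ∧
      eval z (pderiv 1 (conicPoly A)) = 2 * conicGrad A z 1 := by
  have h10 := hA.apply 0 1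
  have h20 := hA.apply 0 2
  have h21 := hA.apply 1 2
  constructor <;>
  · simp [conicPoly, conicGrad, pderiv_X, h10, h20, h21]
    ring

/-- `z` lies on the conic and `a` is proportional to the gradient at `z`. -/
def ConicNormal (A : Matrix (Fin 3) (Fin 3) ℂ) (z a : Fin 2 → ℂ) : Prop :=
  conicVal A z = 0 ∧ conicGrad A z 0 * a 1 = conicGrad A z 1 * a 0

theorem isNormalAt_conicPoly {A : Matrix (Fin 3) (Fin 3) ℂ} (hA : A.IsSymm) (z a : Fin 2 → ℂ) :
    IsNormalAt (conicPoly A) z a ↔ ConicNormal A z a := by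
  rw [IsNormalAt, ConicNormal, eval_conicPoly, (eval_pderiv_conicPoly hA z).1,
    (eval_pderiv_conicPoly hA z).2, mul_assoc, mul_assoc, mul_right_inj' two_ne_zero]

theorem conicGrad_ne_zero {A : Matrix (Fin 3) (Fin 3) ℂ} (hd : A.det ≠ 0)
    {z : Fin 2 → ℂ} (hz : conicVal A z = 0) : conicGrad A z 0 ≠ 0 ∨ conicGrad A z 1 ≠ 0 := by
  by_contra! h
  obtain ⟨h0, h1⟩ := h
  rw [conicVal_eq, h0, h1] at hz
  apply hd
  rw [Matrix.det_fin_three]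
  simp only [conicGrad] at h0 h1 hz
  linear_combination (A 1 0 * A 2 1 - A 1 1 * A 2 0) * h0 -
    (A 0 0 * A 2 1 - A 0 1 * A 2 0) * h1 + (A 0 0 * A 1 1 - A 0 1 * A 1 0) * hz

theorem isSmoothCurve_conicPoly {A : Matrix (Fin 3) (Fin 3) ℂ} (hA : A.IsSymm) (hd : A.det ≠ 0) :
    IsSmoothCurve (conicPoly A) := by
  intro z hz
  rw [eval_conicPoly] at hz
  rw [(eval_pderiv_conicPoly hA z).1, (eval_pderiv_conicPoly hA z).2]
  simpa using conicGrad_ne_zero hd hz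

theorem totalDegree_conicPoly_le (A : Matrix (Fin 3) (Fin 3) ℂ) :
    (conicPoly A).totalDegree ≤ 2 := by
  have h : ∀ (i : Fin 2) l, (X i * linePoly l : MvPolynomial (Fin 2) ℂ).totalDegree ≤ 2 := by
    intro i l
    refine (totalDegree_mul _ _).trans ?_
    have := totalDegree_linePoly_le l
    simp only [totalDegree_X]
    omega
  unfold conicPoly
  exact (totalDegree_add _ _).trans (max_le ((totalDegree_add _ _).trans (max_le (h _ _) (h _ _)))
    ((totalDegree_linePoly_le _).trans one_le_two))

/-- The entries of a symmetric matrix whose quadratic polynomial splits. -/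
theorem entries_of_conicVal_eq_mul {A : Matrix (Fin 3) (Fin 3) ℂ} (hA : A.IsSymm)
    {l m : Fin 3 → ℂ} (h : ∀ z : Fin 2 → ℂ, conicVal A z =
      (l 0 * z 0 + l 1 * z 1 + l 2) * (m 0 * z 0 + m 1 * z 1 + m 2)) (i j : Fin 3) :
    2 * A i j = l i * m j + l j * m i := by
  have h10 := hA.apply 0 1
  have h20 := hA.apply 0 2
  have h21 := hA.apply 1 2
  have e0 := h ![0, 0]
  have e1 := h ![1, 0]
  have e2 := h ![-1, 0]
  have e3 := h ![0, 1]
  have e4 := h ![0, -1]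
  have e5 := h ![1, 1]
  simp [conicVal_eq, conicGrad, h10, h20, h21] at e0 e1 e2 e3 e4 e5
  fin_cases i <;> fin_cases j <;> simp [h10, h20, h21]
  · linear_combination e1 + e2 - 2 * e0
  · linear_combination e5 - e1 - e3 + e0
  · linear_combination (e1 - e2) / 2
  · linear_combination e5 - e1 - e3 + e0
  · linear_combination e3 + e4 - 2 * e0
  · linear_combination (e3 - e4) / 2
  · linear_combination (e1 - e2) / 2
  · linear_combination (e3 - e4) / 2
  · linear_combination 2 * e0

theorem leadingBlock_ne_zero_iff {A : Matrix (Fin 3) (Fin 3) ℂ} :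
    leadingBlock A ≠ 0 ↔ A 0 0 ≠ 0 ∨ A 0 1 ≠ 0 ∨ A 1 0 ≠ 0 ∨ A 1 1 ≠ 0 := by
  rw [← not_iff_not]
  push Not
  constructor
  · intro h
    exact ⟨congrFun (congrFun h 0) 0, congrFun (congrFun h 0) 1, congrFun (congrFun h 1) 0,
      congrFun (congrFun h 1) 1⟩
  · rintro ⟨h0, h1, h2, h3⟩
    ext i j
    fin_cases i <;> fin_cases j <;> simpa [leadingBlock]

/-- By degree, two nonconstant factors would be affine linear forms l and m. Then 2A = l mᵀ + m lᵀ,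
a matrix whose determinant vanishes. The condition on the leading block only keeps the polynomial
from being constant. -/
theorem prime_conicPoly {A : Matrix (Fin 3) (Fin 3) ℂ} (hA : A.IsSymm) (hd : A.det ≠ 0)
    (hA1 : leadingBlock A ≠ 0) : Prime (conicPoly A) := by
  have hconst : ∀ r, conicPoly A ≠ C r := by
    intro r h
    have hz : ∀ z : Fin 2 → ℂ, conicVal A z = (0 * z 0 + 0 * z 1 + r) * (0 * z 0 + 0 * z 1 + 1) := by
      intro z
      rw [← eval_conicPoly, h]
      simp
    have := entries_of_conicVal_eq_mul hA (l := ![0, 0, r]) (m := ![0, 0, 1]) (by simpa using hz)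
    have h00 := this 0 0
    have h01 := this 0 1
    have h10 := this 1 0
    have h11 := this 1 1
    simp at h00 h01 h10 h11
    rw [leadingBlock_ne_zero_iff] at hA1
    tauto
  have h0 : conicPoly A ≠ 0 := by simpa using hconst 0
  refine Irreducible.prime ⟨fun h => ?_, fun a b hab => ?_⟩
  · obtain ⟨r, -, h⟩ := isUnit_iff_eq_C_of_isReduced.mp h
    exact hconst r h
  · have ha : a ≠ 0 := by rintro rfl; simp at hab; exact h0 hab
    have hb : b ≠ 0 := by rintro rfl; simp at hab; exact h0 hab
    have hdeg := totalDegree_conicPoly_le A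
    rw [hab, totalDegree_mul_of_isDomain ha hb] at hdeg
    rcases Nat.eq_zero_or_pos a.totalDegree with h | h
    · left
      rw [totalDegree_eq_zero_iff_eq_C.mp h] at ha ⊢
      exact (IsUnit.mk0 _ (by simpa using ha)).map C
    rcases Nat.eq_zero_or_pos b.totalDegree with h' | h'
    · right
      rw [totalDegree_eq_zero_iff_eq_C.mp h'] at hb ⊢
      exact (IsUnit.mk0 _ (by simpa using hb)).map C
    exfalso
    obtain ⟨l, rfl⟩ := eq_linePoly_of_totalDegree_le_one (G := a) (by omega)
    obtain ⟨m, rfl⟩ := eq_linePoly_of_totalDegree_le_one (G := b) (by omega)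
    have := entries_of_conicVal_eq_mul hA (l := l) (m := m) (fun z => by
      rw [← eval_conicPoly, hab]; simp)
    apply hd
    have h8 : 8 * A.det = 0 := by
      rw [Matrix.det_fin_three]
      have e : 8 * (A 0 0 * A 1 1 * A 2 2 - A 0 0 * A 1 2 * A 2 1 - A 0 1 * A 1 0 * A 2 2 +
          A 0 1 * A 1 2 * A 2 0 + A 0 2 * A 1 0 * A 2 1 - A 0 2 * A 1 1 * A 2 0) =
          (2 * A 0 0) * (2 * A 1 1) * (2 * A 2 2) - (2 * A 0 0) * (2 * A 1 2) * (2 * A 2 1) -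
          (2 * A 0 1) * (2 * A 1 0) * (2 * A 2 2) +
          (2 * A 0 1) * (2 * A 1 2) * (2 * A 2 0) + (2 * A 0 2) * (2 * A 1 0) * (2 * A 2 1) -
          (2 * A 0 2) * (2 * A 1 1) * (2 * A 2 0) := by ring
      rw [e]
      simp only [this]
      ring
    simpa using h8

/-- The pairs `(z, w)` solving the Hermitian critical equations of a smooth conic at `(u, v)`. -/
def virtSet (A : Matrix (Fin 3) (Fin 3) ℂ) (u v : Fin 2 → ℂ) :
    Set ((Fin 2 → ℂ) × (Fin 2 → ℂ)) :=
  {p | ConicNormal A p.1 (v - p.2) ∧ ConicNormal A (star p.2) (star (u - p.1))}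

/-- The critical points of the Hermitian distance from `u` to a smooth conic. -/
def critSet (A : Matrix (Fin 3) (Fin 3) ℂ) (u : Fin 2 → ℂ) : Set (Fin 2 → ℂ) :=
  {z | ConicNormal A z (star (u - z))}

theorem virtualCriticalPoints_affineConic {A : Matrix (Fin 3) (Fin 3) ℂ} (hA : A.IsSymm)
    (hd : A.det ≠ 0) (hA1 : leadingBlock A ≠ 0) (u v : Fin 2 → ℂ) :
    virtualCriticalPoints (affineConic A) u v = virtSet A u v := by
  have hp := prime_conicPoly hA hd hA1
  ext p
  rw [virtualCriticalPoints, affineConic_eq, components_zeroSet hp]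
  simp only [Set.mem_singleton_iff, exists_eq_left, Set.mem_ofPred_eq,
    mem_hermitianCriticalIdeal_iff hp (isSmoothCurve_conicPoly hA hd), isNormalAt_conicPoly hA,
    virtSet]

theorem criticalPoints_affineConic {A : Matrix (Fin 3) (Fin 3) ℂ} (hA : A.IsSymm)
    (hd : A.det ≠ 0) (hA1 : leadingBlock A ≠ 0) (u : Fin 2 → ℂ) :
    criticalPoints (affineConic A) u = critSet A u := by
  have hp := prime_conicPoly hA hd hA1
  ext z
  rw [criticalPoints, affineConic_eq, components_zeroSet hp]
  simp only [Set.mem_singleton_iff, exists_eq_left, Set.mem_ofPred_eq,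
    mem_criticalPointsIrred_iff hp (isSmoothCurve_conicPoly hA hd), isNormalAt_conicPoly hA,
    critSet]

end HermitianDistance
end

open MvPolynomial
noncomputable section
namespace HermitianDistance

/-! ### Genericity -/

/-- A property that holds outside a proper Zariski closed subset of `ℂ² × ℂ²`. -/
def Generic (S : (Fin 2 → ℂ) → (Fin 2 → ℂ) → Prop) : Prop :=
  ∃ g : MvPolynomial (Fin 2 ⊕ Fin 2) ℂ, g ≠ 0 ∧ ∀ u v, eval (Sum.elim u v) g ≠ 0 → S u v

theorem Generic.mono {S T : (Fin 2 → ℂ) → (Fin 2 → ℂ) → Prop} (h : Generic S)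
    (hST : ∀ u v, S u v → T u v) : Generic T := by
  obtain ⟨g, hg, h⟩ := h
  exact ⟨g, hg, fun u v huv => hST u v (h u v huv)⟩

theorem Generic.and {S T : (Fin 2 → ℂ) → (Fin 2 → ℂ) → Prop} (hS : Generic S) (hT : Generic T) :
    Generic fun u v => S u v ∧ T u v := by
  obtain ⟨g, hg, hS⟩ := hS
  obtain ⟨h, hh, hT⟩ := hT
  refine ⟨g * h, mul_ne_zero hg hh, fun u v huv => ?_⟩
  rw [map_mul] at huv
  exact ⟨hS u v (left_ne_zero_of_mul huv), hT u v (right_ne_zero_of_mul huv)⟩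

theorem Generic.of_eval {S : (Fin 2 → ℂ) → (Fin 2 → ℂ) → Prop}
    (g : MvPolynomial (Fin 2 ⊕ Fin 2) ℂ) (u₀ v₀ : Fin 2 → ℂ) (h₀ : eval (Sum.elim u₀ v₀) g ≠ 0)
    (h : ∀ u v, eval (Sum.elim u v) g ≠ 0 → S u v) : Generic S :=
  ⟨g, by rintro rfl; simp at h₀, h⟩

/-- Precomposition with polynomial maps of `u` and `v` that are surjective. -/
theorem Generic.comp {S : (Fin 2 → ℂ) → (Fin 2 → ℂ) → Prop} (h : Generic S)
    (p q : Fin 2 → MvPolynomial (Fin 2 ⊕ Fin 2) ℂ)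
    (hpq : ∀ u v, ∃ u' v', (fun j => eval (Sum.elim u' v') (p j)) = u ∧
      (fun j => eval (Sum.elim u' v') (q j)) = v) :
    Generic fun u v => S (fun j => eval (Sum.elim u v) (p j))
      (fun j => eval (Sum.elim u v) (q j)) := by
  obtain ⟨g, hg, h⟩ := h
  have key : ∀ x, eval x (bind₁ (Sum.elim p q) g) =
      eval (Sum.elim (fun j => eval x (p j)) (fun j => eval x (q j))) g := by
    intro x
    rw [eval, eval₂Hom_bind₁]
    congr 2
    funext i
    cases i <;> rfl
  obtain ⟨x, hx⟩ : ∃ x, eval x g ≠ 0 := by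
    by_contra H
    push Not at H
    exact hg (MvPolynomial.funext fun x => by rw [H x, map_zero])
  rw [← Sum.elim_comp_inl_inr x] at hx
  obtain ⟨u', v', hu, hv⟩ := hpq (x ∘ Sum.inl) (x ∘ Sum.inr)
  refine Generic.of_eval (bind₁ (Sum.elim p q) g) u' v' ?_ fun u v huv => ?_
  · rwa [key, hu, hv]
  · rw [key] at huv
    exact h _ _ huv

theorem continuous_eval_elim_star (g : MvPolynomial (Fin 2 ⊕ Fin 2) ℂ) :
    Continuous fun u : Fin 2 → ℂ => eval (Sum.elim u (star u)) g := by
  refine (MvPolynomial.continuous_eval g).comp ?_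
  refine continuous_pi fun i => ?_
  cases i with
  | inl j => exact continuous_apply j
  | inr j => exact continuous_star.comp (continuous_apply j)

/-- A nonzero polynomial in `u` and `ū` does not vanish on a nonempty open set. -/
theorem exists_eval_star_ne_zero {g : MvPolynomial (Fin 2 ⊕ Fin 2) ℂ} (hg : g ≠ 0)
    {U : Set (Fin 2 → ℂ)} (hU : IsOpen U) (hne : U.Nonempty) :
    ∃ u ∈ U, eval (Sum.elim u (star u)) g ≠ 0 := by
  by_contra! H
  obtain ⟨u₀, hu₀⟩ := hne
  let φ : (Fin 2 ⊕ Fin 2 → ℝ) → Fin 2 → ℂ := fun x j => x (.inl j) + Complex.I * x (.inr j)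
  have hφ : Continuous φ := by fun_prop
  let x₀ : Fin 2 ⊕ Fin 2 → ℝ := Sum.elim (fun j => (u₀ j).re) (fun j => (u₀ j).im)
  have hx₀ : φ x₀ = u₀ := by
    funext j
    simp only [φ, x₀, Sum.elim_inl, Sum.elim_inr]
    rw [mul_comm, Complex.re_add_im]
  obtain ⟨ε, hε, hball⟩ := Metric.isOpen_iff.mp (hU.preimage hφ) x₀
    (by rw [Set.mem_preimage, hx₀]; exact hu₀)
  -- With u = x + iy and ū = x - iy, `g` becomes a polynomial in x and y that vanishes on a real
  -- box, hence is zero. The substitution is invertible over ℂ, so `g` is zero as well.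
  let h : MvPolynomial (Fin 2 ⊕ Fin 2) ℂ := bind₁ (Sum.elim
    (fun j => X (.inl j) + C Complex.I * X (.inr j))
    (fun j => X (.inl j) - C Complex.I * X (.inr j))) g
  have key : ∀ x, eval x h = eval (Sum.elim (fun j => x (.inl j) + Complex.I * x (.inr j))
      (fun j => x (.inl j) - Complex.I * x (.inr j))) g := by
    intro x
    simp only [h]
    rw [eval, eval₂Hom_bind₁]
    congr 2
    funext i
    cases i <;> simp
  have h0 : h = 0 := by
    refine funext_set (fun i => Complex.ofReal '' Set.Ioo (x₀ i - ε) (x₀ i + ε)) (fun i => ?_) ?_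
    · exact (Set.Ioo_infinite (by linarith)).image Complex.ofReal_injective.injOn
    · intro x hx
      choose y hy hyx using fun i => hx i (Set.mem_univ i)
      obtain rfl : x = fun i => (y i : ℂ) := funext fun i => (hyx i).symm
      have hyU : φ y ∈ U := by
        refine hball ?_
        rw [Metric.mem_ball, dist_pi_lt_iff hε]
        intro i
        rw [Real.dist_eq, abs_lt]
        exact ⟨by linarith [(hy i).1], by linarith [(hy i).2]⟩
      rw [key, map_zero, ← H _ hyU]
      congr 2
      funext i
      cases i <;> simp [φ, sub_eq_add_neg]
  refine hg (MvPolynomial.funext fun x => ?_)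
  have := key (Sum.elim (fun j => (x (.inl j) + x (.inr j)) / 2)
    (fun j => (x (.inl j) - x (.inr j)) / (2 * Complex.I)))
  rw [h0, map_zero] at this
  rw [map_zero, this]
  congr 2
  funext i
  have hI := Complex.I_ne_zero
  cases i <;> simp <;> field_simp <;> ring

theorem Generic.exists_mem {S : (Fin 2 → ℂ) → (Fin 2 → ℂ) → Prop} (h : Generic S)
    {U : Set (Fin 2 → ℂ)} (hU : IsOpen U) (hne : U.Nonempty) : ∃ u ∈ U, S u (star u) := by
  obtain ⟨g, hg, h⟩ := h
  obtain ⟨u, hu, h'⟩ := exists_eval_star_ne_zero hg hU hne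
  exact ⟨u, hu, h _ _ h'⟩

theorem Generic.exists_isOpen {S : (Fin 2 → ℂ) → (Fin 2 → ℂ) → Prop} (h : Generic S) :
    ∃ U : Set (Fin 2 → ℂ), IsOpen U ∧ U.Nonempty ∧ ∀ u ∈ U, S u (star u) := by
  obtain ⟨g, hg, h⟩ := h
  obtain ⟨u, -, hu⟩ := exists_eval_star_ne_zero hg isOpen_univ Set.univ_nonempty
  exact ⟨{u | eval (Sum.elim u (star u)) g ≠ 0},
    isOpen_ne_fun (continuous_eval_elim_star g) continuous_const, ⟨u, hu⟩, fun u hu => h _ _ hu⟩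

/-! ### Resultants in families -/

/-- The witness is the resultant with F taken in formal degree n, which commutes with every φ. Where
it is nonzero, its Bézout identity gives coprimality. In the converse direction the degree of K may
drop under φ. This only contributes a power of the coefficient of F in degree n, hence the extra
condition on that coefficient. -/
theorem exists_isCoprime_map_iff {R : Type*} [CommRing R] (F K : Polynomial R) {n : ℕ}
    (hn : n ≠ 0) (hF : F.natDegree ≤ n) : ∃ g : R,
      (∀ φ : R →+* ℂ, φ g ≠ 0 → IsCoprime (F.map φ) (K.map φ)) ∧
      ∀ φ : R →+* ℂ, φ (F.coeff n) ≠ 0 → IsCoprime (F.map φ) (K.map φ) → φ g ≠ 0 := by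
  refine ⟨F.resultant K n K.natDegree, fun φ h => ?_, fun φ hc h => ?_⟩
  · rw [← Polynomial.resultant_map_map] at h
    obtain ⟨p, q, -, -, hpq⟩ := Polynomial.exists_mul_add_mul_eq_C_resultant (F.map φ) (K.map φ)
      (Polynomial.natDegree_map_le.trans hF) Polynomial.natDegree_map_le (Or.inl hn)
    set r := (F.map φ).resultant (K.map φ) n K.natDegree
    refine ⟨Polynomial.C r⁻¹ * p, Polynomial.C r⁻¹ * q, ?_⟩
    have : Polynomial.C r⁻¹ * Polynomial.C r = 1 := by
      rw [← Polynomial.C_mul, inv_mul_cancel₀ h, Polynomial.C_1]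
    linear_combination Polynomial.C r⁻¹ * hpq + this
  · rw [← Polynomial.resultant_map_map]
    have hdeg : (F.map φ).natDegree = n := by
      refine Polynomial.natDegree_eq_of_le_of_coeff_ne_zero
        (Polynomial.natDegree_map_le.trans hF) ?_
      rwa [Polynomial.coeff_map]
    obtain ⟨k, hk⟩ := Nat.exists_eq_add_of_le
      (Polynomial.natDegree_map_le (p := K) (f := φ))
    rw [hk, Polynomial.resultant_add_right_deg _ _ _ _ k le_rfl, Polynomial.coeff_map, ← hdeg]
    exact mul_ne_zero (pow_ne_zero _ (by rwa [hdeg])) (Polynomial.resultant_ne_zero _ _ h)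

theorem encard_roots_of_separable {f : Polynomial ℂ} (hf : f.Separable) :
    {p | f.eval p = 0}.encard = f.natDegree := by
  have h : {p | f.eval p = 0} = (f.roots.toFinset : Set ℂ) := by
    ext p
    simp [hf.ne_zero]
  rw [h, Set.encard_coe_eq_coe_finsetCard,
    Multiset.toFinset_card_of_nodup (Polynomial.nodup_roots hf),
    ← (IsAlgClosed.splits f).natDegree_eq_card_roots]

/-- A family of polynomials of formal degree `n`, one of whose members is separable of degree `n`,
is generically separable. -/
theorem generic_separable {F : Polynomial (MvPolynomial (Fin 2 ⊕ Fin 2) ℂ)} {n : ℕ} (hn : n ≠ 0)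
    (hF : F.natDegree ≤ n) (u₀ v₀ : Fin 2 → ℂ) (hFc : eval (Sum.elim u₀ v₀) (F.coeff n) ≠ 0)
    (h₀ : (F.map (eval (Sum.elim u₀ v₀))).Separable) :
    Generic fun u v => (F.map (eval (Sum.elim u v))).Separable ∧
      (F.map (eval (Sum.elim u v))).natDegree = n := by
  obtain ⟨g, hg, hg'⟩ := exists_isCoprime_map_iff F (Polynomial.derivative F) hn hF
  refine Generic.of_eval (g * F.coeff n) u₀ v₀ ?_ fun u v huv => ?_
  · rw [map_mul]
    refine mul_ne_zero (hg' _ hFc ?_) hFc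
    rw [← Polynomial.derivative_map]
    exact h₀
  · rw [map_mul] at huv
    have := hg _ (left_ne_zero_of_mul huv)
    rw [← Polynomial.derivative_map] at this
    refine ⟨this, Polynomial.natDegree_eq_of_le_of_coeff_ne_zero
      (Polynomial.natDegree_map_le.trans hF) ?_⟩
    rw [Polynomial.coeff_map]
    exact right_ne_zero_of_mul huv

/-- If `G` and `H` are coprime and `G / H` is not constant, almost all members of the pencil
`G + c H` are separable. -/
theorem finite_not_separable_pencil {G H : Polynomial ℂ} (hGH : IsCoprime G H)
    (hW : Polynomial.derivative G * H - G * Polynomial.derivative H ≠ 0) :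
    {c : ℂ | ¬ (G + Polynomial.C c * H).Separable}.Finite := by
  -- If p is a double root of G + cH, then H(p) ≠ 0 by coprimality, so c = -G(p)/H(p), and the
  -- Wronskian vanishes at p. Only finitely many p qualify.
  refine (((Polynomial.derivative G * H - G * Polynomial.derivative H).roots.toFinset.finite_toSet.image
    fun p => - G.eval p / H.eval p)).subset fun c hc => ?_
  have hc : ¬ IsCoprime _ _ := hc
  rw [Polynomial.isCoprime_iff_aeval_ne_zero_of_isAlgClosed ℂ ℂ] at hc
  push Not at hc
  obtain ⟨p, hp1, hp2⟩ := hc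
  simp only [Polynomial.coe_aeval_eq_eval, Polynomial.derivative_add, Polynomial.derivative_mul,
    Polynomial.derivative_C, zero_mul, zero_add, Polynomial.eval_add, Polynomial.eval_mul,
    Polynomial.eval_C] at hp1 hp2
  have hH : H.eval p ≠ 0 := by
    intro h
    obtain ⟨a, b, hab⟩ := hGH
    have := congrArg (Polynomial.eval p) hab
    simp [h] at this hp1
    simp [hp1] at this
  refine ⟨p, ?_, ?_⟩
  · simp only [Finset.mem_coe, Multiset.mem_toFinset, Polynomial.mem_roots hW, Polynomial.IsRoot.def,
      Polynomial.eval_sub, Polynomial.eval_mul]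
    linear_combination H.eval p * hp2 - (Polynomial.derivative H).eval p * hp1
  · rw [div_eq_iff hH]
    linear_combination -hp1

/-! ### Fixed points of an involution -/

/-- The points that are not fixed fall into pairs. -/
theorem encard_fixed_mod_two {α : Type*} {S : Set α} {d : ℕ} (hS : S.encard = d) (f : α → α)
    (hfS : ∀ x ∈ S, f x ∈ S) (hff : ∀ x ∈ S, f (f x) = x) :
    ∃ k : ℕ, {x ∈ S | f x = x}.encard = k ∧ k ≤ d ∧ k % 2 = d % 2 := by
  classical
  have hfin : S.Finite := Set.finite_of_encard_eq_coe hS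
  lift S to Finset α using hfin
  rw [Set.encard_coe_eq_coe_finsetCard, Nat.cast_inj] at hS
  subst hS
  refine ⟨(S.filter fun x => f x = x).card, ?_, Finset.card_filter_le _ _, ?_⟩
  · rw [← Set.encard_coe_eq_coe_finsetCard]
    congr 1
    ext x
    simp
  · have h0 : ((S.filter fun x => ¬ f x = x).card : ZMod 2) = 0 := by
      rw [Finset.card_eq_sum_ones, Nat.cast_sum]
      refine Finset.sum_involution (fun x _ => f x) (fun _ _ => by decide) ?_ ?_ ?_
      · intro x hx _
        exact (Finset.mem_filter.mp hx).2
      · intro x hx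
        obtain ⟨hx1, hx2⟩ := Finset.mem_filter.mp hx
        refine Finset.mem_filter.mpr ⟨hfS x hx1, ?_⟩
        rw [hff x hx1]
        exact fun h => hx2 h.symm
      · intro x hx
        exact hff x (Finset.mem_filter.mp hx).1
    have h1 := Finset.card_filter_add_card_filter_not (s := S) (fun x => f x = x)
    rw [ZMod.natCast_eq_zero_iff] at h0
    omega

end HermitianDistance
end

open MvPolynomial
noncomputable section
namespace HermitianDistance

/-! ### Lines -/

/-- The squared norm of the linear part of an affine form. -/
def lineNorm (l : Fin 3 → ℂ) : ℂ := star (l 0) * l 0 + star (l 1) * l 1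

theorem lineNorm_ne_zero {l : Fin 3 → ℂ} (hl : l 0 ≠ 0 ∨ l 1 ≠ 0) : lineNorm l ≠ 0 := by
  have h : lineNorm l = ((Complex.normSq (l 0) + Complex.normSq (l 1) : ℝ) : ℂ) := by
    simp [lineNorm, Complex.normSq_eq_conj_mul_self]
  rw [h, Complex.ofReal_ne_zero]
  rcases hl with h | h
  · have := Complex.normSq_pos.mpr h
    have := Complex.normSq_nonneg (l 1)
    positivity
  · have := Complex.normSq_pos.mpr h
    have := Complex.normSq_nonneg (l 0)
    positivity

/-- The orthogonal projection of `u` to the line `l₀ z₁ + l₁ z₂ + l₂ = 0`. -/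
def foot (l : Fin 3 → ℂ) (u : Fin 2 → ℂ) : Fin 2 → ℂ :=
  ![u 0 - star (l 0) * (l 0 * u 0 + l 1 * u 1 + l 2) / lineNorm l,
    u 1 - star (l 1) * (l 0 * u 0 + l 1 * u 1 + l 2) / lineNorm l]

theorem isNormalAt_linePoly_iff {l : Fin 3 → ℂ} (hl : l 0 ≠ 0 ∨ l 1 ≠ 0) (z u : Fin 2 → ℂ) :
    IsNormalAt (linePoly l) z (star (u - z)) ↔ z = foot l u := by
  have hN := lineNorm_ne_zero hl
  simp only [IsNormalAt, eval_linePoly, pderiv_zero_linePoly, pderiv_one_linePoly, eval_C,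
    Pi.star_apply, Pi.sub_apply]
  constructor
  · rintro ⟨h1, h2⟩
    have h3 : star (l 0) * (u 1 - z 1) = star (l 1) * (u 0 - z 0) := by
      have := congrArg star h2
      simpa [mul_comm] using this
    funext j
    fin_cases j
    · simp only [foot, Fin.zero_eta, Matrix.cons_val_zero]
      field_simp
      unfold lineNorm
      linear_combination star (l 0) * h1 + l 1 * h3
    · simp only [foot, Fin.mk_one, Matrix.cons_val_one, Matrix.cons_val_zero]
      field_simp
      unfold lineNorm
      linear_combination star (l 1) * h1 - l 0 * h3
  · rintro rfl
    constructor
    · simp only [foot, Matrix.cons_val_zero, Matrix.cons_val_one]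
      field_simp
      unfold lineNorm
      ring
    · have h0 : u 0 - foot l u 0 = star (l 0) * ((l 0 * u 0 + l 1 * u 1 + l 2) / lineNorm l) := by
        simp only [foot, Matrix.cons_val_zero]; ring
      have h1 : u 1 - foot l u 1 = star (l 1) * ((l 0 * u 0 + l 1 * u 1 + l 2) / lineNorm l) := by
        simp only [foot, Matrix.cons_val_one, Matrix.cons_val_zero]; ring
      rw [h0, h1]
      simp only [star_mul', star_star]
      ring

theorem isNormalAt_linePoly_pair_iff {l : Fin 3 → ℂ} (hl : l 0 ≠ 0 ∨ l 1 ≠ 0)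
    (z w u v : Fin 2 → ℂ) :
    (IsNormalAt (linePoly l) z (v - w) ∧ IsNormalAt (linePoly l) (star w) (star (u - z))) ↔
      (z, w) = (foot l u, star (foot l (star v))) := by
  rw [Prod.mk.injEq, ← star_inj (x := w), star_star, ← isNormalAt_linePoly_iff hl,
    ← isNormalAt_linePoly_iff hl]
  simp only [IsNormalAt, eval_linePoly, pderiv_zero_linePoly, pderiv_one_linePoly, eval_C,
    ← star_sub, star_star]
  tauto

theorem mem_virtual_linePoly {l : Fin 3 → ℂ} (hl : l 0 ≠ 0 ∨ l 1 ≠ 0)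
    (p : (Fin 2 → ℂ) × (Fin 2 → ℂ)) (u v : Fin 2 → ℂ) :
    bigPoint p.1 p.2 u v ∈ zeroLocus ℂ (hermitianCriticalIdeal (Ideal.span {linePoly l})) ↔
      p = (foot l u, star (foot l (star v))) := by
  rw [mem_hermitianCriticalIdeal_iff (prime_linePoly hl) (isSmoothCurve_linePoly hl),
    isNormalAt_linePoly_pair_iff hl]

theorem mem_critical_linePoly {l : Fin 3 → ℂ} (hl : l 0 ≠ 0 ∨ l 1 ≠ 0) (z u : Fin 2 → ℂ) :
    z ∈ criticalPointsIrred (Ideal.span {linePoly l}) u ↔ z = foot l u := by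
  rw [mem_criticalPointsIrred_iff (prime_linePoly hl) (isSmoothCurve_linePoly hl),
    isNormalAt_linePoly_iff hl]

/-- A generic condition restricted to v = ū holds on some nonempty open set and meets every other
one. -/
theorem HD_eq_singleton {X : Set (Fin 2 → ℂ)} {n : ℕ}
    (h : Generic fun u v => v = star u → (criticalPoints X u).encard = n) : HD X = {n} := by
  ext k
  constructor
  · rintro ⟨U, hU, hne, hk⟩
    obtain ⟨u, hu, h⟩ := h.exists_mem hU hne
    have := (hk u hu).symm.trans (h rfl)
    exact_mod_cast this
  · rintro rfl
    obtain ⟨U, hU, hne, h⟩ := h.exists_isOpen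
    exact ⟨U, hU, hne, fun u hu => h u hu rfl⟩

/-! ### Singular conics -/

/-- Completing the square at a nonzero diagonal entry of A₁ leaves a quadratic form in the two other
homogeneous coordinates. Its discriminant is a multiple of det A = 0, so it is a perfect square (up
to the pivot), and a difference of two squares factors. If both diagonal entries vanish, the mixed
coefficient is nonzero and the factors can be read off. -/
theorem exists_conicVal_eq_mul {A : Matrix (Fin 3) (Fin 3) ℂ} (hA : A.IsSymm) (hd : A.det = 0)
    (hA1 : leadingBlock A ≠ 0) : ∃ l m : Fin 3 → ℂ, ∀ z : Fin 2 → ℂ, conicVal A z =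
      (l 0 * z 0 + l 1 * z 1 + l 2) * (m 0 * z 0 + m 1 * z 1 + m 2) := by
  have h10 := hA.apply 0 1
  have h20 := hA.apply 0 2
  have h21 := hA.apply 1 2
  rw [Matrix.det_fin_three, h10, h20, h21] at hd
  have hsq : ∀ x y t : ℂ, x * y = t ^ 2 → ∃ α β : ℂ, α ^ 2 = x ∧ β ^ 2 = y ∧ α * β = t := by
    intro x y t h
    obtain ⟨α, hα⟩ := IsAlgClosed.exists_pow_nat_eq x (n := 2) two_pos
    obtain ⟨β, hβ⟩ := IsAlgClosed.exists_pow_nat_eq y (n := 2) two_pos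
    have : (α * β - t) * (α * β + t) = 0 := by
      linear_combination h + y * hα + α ^ 2 * hβ
    rcases mul_eq_zero.mp this with h | h
    · exact ⟨α, β, hα, hβ, by linear_combination h⟩
    · exact ⟨α, -β, hα, by rw [neg_sq, hβ], by linear_combination -h⟩
  simp only [conicVal_eq, conicGrad, h10, h20, h21]
  by_cases h0 : A 0 0 = 0
  · by_cases h1 : A 1 1 = 0
    · have hb : A 0 1 ≠ 0 := by
        rw [leadingBlock_ne_zero_iff, h10] at hA1
        tauto
      refine ⟨![2 * A 0 1, 0, 2 * A 1 2], ![0, 1, A 0 2 / A 0 1], fun z => ?_⟩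
      have hf : A 0 1 * A 2 2 = 2 * A 0 2 * A 1 2 := by
        have : A 0 1 * (A 0 1 * A 2 2 - 2 * A 0 2 * A 1 2) = 0 := by
          rw [h0, h1] at hd
          linear_combination -hd
        linear_combination (mul_eq_zero.mp this).resolve_left hb
      simp [h0, h1]
      field_simp
      linear_combination hf
    · obtain ⟨α, β, hα, hβ, hαβ⟩ := hsq (A 0 1 ^ 2 - A 1 1 * A 0 0)
        (A 1 2 ^ 2 - A 1 1 * A 2 2) (A 0 1 * A 1 2 - A 1 1 * A 0 2)
        (by linear_combination A 1 1 * hd)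
      refine ⟨![(A 0 1 - α) / A 1 1, 1, (A 1 2 - β) / A 1 1], ![A 0 1 + α, A 1 1, A 1 2 + β],
        fun z => ?_⟩
      simp
      field_simp
      linear_combination z 0 ^ 2 * hα + hβ + 2 * z 0 * hαβ
  · obtain ⟨α, β, hα, hβ, hαβ⟩ := hsq (A 0 1 ^ 2 - A 0 0 * A 1 1)
      (A 0 2 ^ 2 - A 0 0 * A 2 2) (A 0 1 * A 0 2 - A 0 0 * A 1 2)
      (by linear_combination A 0 0 * hd)
    refine ⟨![1, (A 0 1 - α) / A 0 0, (A 0 2 - β) / A 0 0], ![A 0 0, A 0 1 + α, A 0 2 + β],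
      fun z => ?_⟩
    simp
    field_simp
    linear_combination z 1 ^ 2 * hα + hβ + 2 * z 1 * hαβ

theorem linear_parts_ne_zero {A : Matrix (Fin 3) (Fin 3) ℂ} (hA1 : leadingBlock A ≠ 0)
    {l m : Fin 3 → ℂ} (h : ∀ i j, 2 * A i j = l i * m j + l j * m i) :
    (l 0 ≠ 0 ∨ l 1 ≠ 0) ∧ (m 0 ≠ 0 ∨ m 1 ≠ 0) := by
  constructor <;>
  · by_contra! h0
    have h00 := h 0 0
    have h01 := h 0 1
    have h10 := h 1 0
    have h11 := h 1 1
    simp [h0] at h00 h01 h10 h11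
    rw [leadingBlock_ne_zero_iff] at hA1
    tauto

/-- The principal minor on i, j equals -(l i * m j - l j * m i)² / 4, and rank one makes it vanish.
-/
theorem parallel_of_rank_eq_one {A : Matrix (Fin 3) (Fin 3) ℂ} (hr : A.rank = 1)
    {l m : Fin 3 → ℂ} (h : ∀ i j, 2 * A i j = l i * m j + l j * m i) (i j : Fin 3) :
    l i * m j = l j * m i := by
  by_contra hne
  have h1 : (A.submatrix ![i, j] ![i, j]).det ≠ 0 := by
    rw [Matrix.det_fin_two]
    simp only [Matrix.submatrix_apply, Matrix.cons_val_zero, Matrix.cons_val_one]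
    intro h0
    have : (l i * m j - l j * m i) ^ 2 = 0 := by
      have e : (2 * A i i) * (2 * A j j) - (2 * A i j) * (2 * A j i) = 0 := by
        linear_combination 4 * h0
      rw [h, h, h, h] at e
      linear_combination -e
    exact hne (sub_eq_zero.mp (pow_eq_zero_iff two_ne_zero |>.mp this))
  have h2 : (A.submatrix ![i, j] ![i, j]).rank = 2 := by
    rw [Matrix.rank_of_isUnit _ ((Matrix.isUnit_iff_isUnit_det _).mpr (IsUnit.mk0 _ h1))]
    simp
  have h3 : (A.submatrix ![i, j] ![i, j]).rank ≤ A.rank := Matrix.rank_submatrix_le _ _ _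
  omega

theorem not_parallel_of_rank_eq_two {A : Matrix (Fin 3) (Fin 3) ℂ} (hr : A.rank = 2)
    {l m : Fin 3 → ℂ} (h : ∀ i j, 2 * A i j = l i * m j + l j * m i) (c : ℂ) : m ≠ c • l := by
  rintro rfl
  have : A = Matrix.vecMulVec (c • l) l := by
    ext i j
    have := h i j
    simp only [Pi.smul_apply, smul_eq_mul, Matrix.vecMulVec_apply] at this ⊢
    linear_combination this / 2
  have h1 := Matrix.rank_vecMulVec_le (c • l) l
  rw [← this] at h1
  omega

theorem affineConic_eq_of_conicVal {A : Matrix (Fin 3) (Fin 3) ℂ} {l m : Fin 3 → ℂ}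
    (h : ∀ z : Fin 2 → ℂ, conicVal A z =
      (l 0 * z 0 + l 1 * z 1 + l 2) * (m 0 * z 0 + m 1 * z 1 + m 2)) :
    affineConic A = {z | eval z (linePoly l) = 0 ∨ eval z (linePoly m) = 0} := by
  ext z
  change conicVal A z = 0 ↔ _
  rw [h, mul_eq_zero]
  simp

theorem conic_rank_one {A : Matrix (Fin 3) (Fin 3) ℂ} (hA : A.IsSymm)
    (hA1 : leadingBlock A ≠ 0) (hd : A.det = 0) (hr : A.rank = 1) :
    IsVHD (affineConic A) 1 ∧ HD (affineConic A) = {1} := by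
  obtain ⟨l, m, h⟩ := exists_conicVal_eq_mul hA hd hA1
  have he := entries_of_conicVal_eq_mul hA h
  obtain ⟨hl, hm⟩ := linear_parts_ne_zero hA1 he
  have hpar := parallel_of_rank_eq_one hr he
  have hX : affineConic A = {z | eval z (linePoly l) = 0} := by
    rw [affineConic_eq_of_conicVal h]
    ext z
    simp only [eval_linePoly, Set.mem_ofPred_eq, or_iff_left_iff_imp]
    intro hz
    have key : ∀ i, m i * (l 0 * z 0 + l 1 * z 1 + l 2) = 0 := by
      intro i
      linear_combination l i * hz + z 0 * hpar 0 i + z 1 * hpar 1 i + hpar 2 i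
    rcases hm with h | h
    · exact (mul_eq_zero.mp (key 0)).resolve_left h
    · exact (mul_eq_zero.mp (key 1)).resolve_left h
  have hcomp := components_zeroSet (prime_linePoly hl)
  rw [← hX] at hcomp
  have hv : ∀ u v, virtualCriticalPoints (affineConic A) u v =
      {(foot l u, star (foot l (star v)))} := by
    intro u v
    ext p
    rw [virtualCriticalPoints, hcomp]
    simp only [Set.mem_ofPred_eq, Set.mem_singleton_iff, exists_eq_left,
      mem_virtual_linePoly hl]
  have hc : ∀ u, criticalPoints (affineConic A) u = {foot l u} := by
    intro u
    ext z
    simp [criticalPoints, hcomp, mem_critical_linePoly hl]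
  refine ⟨⟨1, one_ne_zero, fun u v _ => ?_⟩, HD_eq_singleton ⟨1, one_ne_zero, fun u v _ _ => ?_⟩⟩
  · rw [hv, Set.encard_singleton]
    rfl
  · rw [hc, Set.encard_singleton]
    rfl

/-- Divisibility would make m vanish on the line of l. Two points suffice to see that m is then a
multiple of l: the projection of the origin and its translate by (-l 1, l 0). -/
theorem not_dvd_linePoly {l m : Fin 3 → ℂ} (hl : l 0 ≠ 0 ∨ l 1 ≠ 0) (h : ∀ c : ℂ, m ≠ c • l) :
    ¬ linePoly l ∣ linePoly m := by
  rintro ⟨f, hf⟩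
  have hN := lineNorm_ne_zero hl
  have hz : ∀ z : Fin 2 → ℂ, l 0 * z 0 + l 1 * z 1 + l 2 = 0 →
      m 0 * z 0 + m 1 * z 1 + m 2 = 0 := by
    intro z hz
    rw [← eval_linePoly, hf, map_mul, eval_linePoly, hz, zero_mul]
  have h0 := hz ![-l 2 * star (l 0) / lineNorm l, -l 2 * star (l 1) / lineNorm l] (by
    simp only [Matrix.cons_val_zero, Matrix.cons_val_one]
    field_simp
    unfold lineNorm
    ring)
  have h1 := hz ![-l 2 * star (l 0) / lineNorm l - l 1, -l 2 * star (l 1) / lineNorm l + l 0] (by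
    simp only [Matrix.cons_val_zero, Matrix.cons_val_one]
    field_simp
    unfold lineNorm
    ring)
  simp only [Matrix.cons_val_zero, Matrix.cons_val_one] at h0 h1
  have h2 : m 1 * l 0 = m 0 * l 1 := by linear_combination h1 - h0
  refine h ((m 0 * star (l 0) + m 1 * star (l 1)) / lineNorm l) (funext fun i => ?_)
  rw [Pi.smul_apply, smul_eq_mul]
  field_simp at h0 ⊢
  unfold lineNorm at *
  fin_cases i <;> simp only [Fin.zero_eta, Fin.mk_one, Fin.reduceFinMk]
  · linear_combination -star (l 1) * h2
  · linear_combination star (l 0) * h2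
  · linear_combination h0

/-- In a coordinate j with m j ≠ 0, equality of the two projections is one affine equation in u. If
it held identically, m would be a multiple of l. -/
theorem generic_foot_ne {l m : Fin 3 → ℂ} (hl : l 0 ≠ 0 ∨ l 1 ≠ 0) (hm : m 0 ≠ 0 ∨ m 1 ≠ 0)
    (h : ∀ c : ℂ, m ≠ c • l) : Generic fun u _ => foot l u ≠ foot m u := by
  have hNl := lineNorm_ne_zero hl
  have hNm := lineNorm_ne_zero hm
  obtain ⟨j, hj⟩ : ∃ j : Fin 2, m (j.castSucc) ≠ 0 := by
    rcases hm with h | h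
    · exact ⟨0, h⟩
    · exact ⟨1, h⟩
  let L : (Fin 3 → ℂ) → MvPolynomial (Fin 2 ⊕ Fin 2) ℂ := fun l =>
    C (l 0) * X (.inl 0) + C (l 1) * X (.inl 1) + C (l 2)
  let g : MvPolynomial (Fin 2 ⊕ Fin 2) ℂ :=
    C (star (m j.castSucc) * lineNorm l) * L m - C (star (l j.castSucc) * lineNorm m) * L l
  have hg : ∀ u v, eval (Sum.elim u v) g =
      star (m j.castSucc) * lineNorm l * (m 0 * u 0 + m 1 * u 1 + m 2) -
      star (l j.castSucc) * lineNorm m * (l 0 * u 0 + l 1 * u 1 + l 2) := by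
    intro u v
    simp [g, L]
  obtain ⟨u₀, hu₀⟩ : ∃ u₀, eval (Sum.elim u₀ 0) g ≠ 0 := by
    by_contra! H
    have e0 := H ![0, 0]
    have e1 := H ![1, 0]
    have e2 := H ![0, 1]
    rw [hg] at e0 e1 e2
    simp only [Matrix.cons_val_zero, Matrix.cons_val_one] at e0 e1 e2
    have hj' : star (m j.castSucc) ≠ 0 := star_ne_zero.mpr hj
    refine h (star (l j.castSucc) * lineNorm m / (star (m j.castSucc) * lineNorm l))
      (funext fun i => ?_)
    rw [Pi.smul_apply, smul_eq_mul]
    field_simp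
    fin_cases i <;> simp only [Fin.zero_eta, Fin.mk_one, Fin.reduceFinMk]
    · linear_combination e1 - e0
    · linear_combination e2 - e0
    · linear_combination e0
  refine Generic.of_eval g u₀ 0 hu₀ fun u v huv heq => huv ?_
  rw [hg]
  have := congrFun heq j
  fin_cases j <;>
  · simp [foot] at this
    field_simp at this
    simp
    linear_combination -this

theorem conic_rank_two {A : Matrix (Fin 3) (Fin 3) ℂ} (hA : A.IsSymm)
    (hA1 : leadingBlock A ≠ 0) (hd : A.det = 0) (hr : A.rank = 2) :
    IsVHD (affineConic A) 2 ∧ HD (affineConic A) = {2} := by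
  obtain ⟨l, m, h⟩ := exists_conicVal_eq_mul hA hd hA1
  have he := entries_of_conicVal_eq_mul hA h
  obtain ⟨hl, hm⟩ := linear_parts_ne_zero hA1 he
  have hlm := not_parallel_of_rank_eq_two hr he
  have hml := not_parallel_of_rank_eq_two hr (l := m) (m := l)
    fun i j => by rw [he i j]; ring
  have hX := affineConic_eq_of_conicVal h
  have hcomp := components_zeroSet_mul (prime_linePoly hl) (prime_linePoly hm)
    (not_dvd_linePoly hl hlm) (not_dvd_linePoly hm hml)
  rw [← hX] at hcomp
  have hv : ∀ u v, virtualCriticalPoints (affineConic A) u v =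
      {(foot l u, star (foot l (star v))), (foot m u, star (foot m (star v)))} := by
    intro u v
    ext p
    rw [virtualCriticalPoints, hcomp]
    simp only [Set.mem_ofPred_eq, Set.mem_insert_iff, Set.mem_singleton_iff, exists_eq_or_imp,
      exists_eq_left, mem_virtual_linePoly hl, mem_virtual_linePoly hm]
  have hc : ∀ u, criticalPoints (affineConic A) u = {foot l u, foot m u} := by
    intro u
    ext z
    simp [criticalPoints, hcomp, mem_critical_linePoly hl, mem_critical_linePoly hm]
  have hgen := generic_foot_ne hl hm hlm
  refine ⟨hgen.mono fun u v huv => ?_, HD_eq_singleton (hgen.mono fun u v huv _ => ?_)⟩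
  · rw [hv, Set.encard_pair fun hh => huv (congrArg Prod.fst hh)]
    rfl
  · rw [hc, Set.encard_pair huv]
    rfl

end HermitianDistance
end

open MvPolynomial
noncomputable section
namespace HermitianDistance

/-! ### Similarities of the Hermitian plane -/

/-- The similarity `z ↦ N z + t` of `ℂ²`, where `N = !![p, q; r, s]` satisfies `N^* N = ρ`. -/
structure Similarity where
  (p q r s t₀ t₁ ρ : ℂ)
  ne_zero : ρ ≠ 0
  norm_left : star p * p + star r * r = ρ
  norm_right : star q * q + star s * s = ρ
  orthogonal : star p * q + star r * s = 0

namespace Similarity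

variable (S : Similarity)

theorem star_rho : star S.ρ = S.ρ := by
  rw [← S.norm_left]
  simp [mul_comm]

theorem orthogonal' : star S.q * S.p + star S.s * S.r = 0 := by
  have := congrArg star S.orthogonal
  simpa [mul_comm] using this

theorem det_mul_star : (S.p * S.s - S.q * S.r) * star (S.p * S.s - S.q * S.r) = S.ρ ^ 2 := by
  have h1 := S.norm_left
  have h2 := S.norm_right
  have h3 := S.orthogonal
  have h4 := S.orthogonal'
  simp only [star_sub, star_mul'] at *
  linear_combination h1 * (star S.q * S.q + star S.s * S.s) + S.ρ * h2 -
    h3 * (star S.q * S.p + star S.s * S.r)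

theorem det_ne_zero : S.p * S.s - S.q * S.r ≠ 0 := by
  intro h
  have := S.det_mul_star
  rw [h, zero_mul] at this
  exact S.ne_zero (pow_eq_zero_iff two_ne_zero |>.mp this.symm)

/-- Since N is invertible, N*N = ρ implies NN* = ρ. The entries of the second identity follow from
the first after multiplication by det N. -/
theorem row_left : star S.p * S.p + star S.q * S.q = S.ρ := by
  have h := S.det_ne_zero
  have : (S.p * S.s - S.q * S.r) * (star S.p * S.p + star S.q * S.q - S.ρ) = 0 := by
    linear_combination S.p * S.s * S.norm_left - S.p * S.r * S.orthogonal -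
      S.q * S.r * S.norm_right +
      S.q * S.s * S.orthogonal'
  linear_combination (mul_eq_zero.mp this).resolve_left h

theorem row_right : star S.r * S.r + star S.s * S.s = S.ρ := by
  linear_combination S.norm_left + S.norm_right - S.row_left

theorem row_orthogonal : S.p * star S.r + S.q * star S.s = 0 := by
  have h := S.det_ne_zero
  have : (S.p * S.s - S.q * S.r) * (S.p * star S.r + S.q * star S.s) = 0 := by
    linear_combination S.p * S.q * S.norm_right - S.p * S.q * S.norm_left +
      S.p ^ 2 * S.orthogonal - S.q ^ 2 * S.orthogonal'
  exact (mul_eq_zero.mp this).resolve_left h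

theorem row_orthogonal' : star S.p * S.r + star S.q * S.s = 0 := by
  have := congrArg star S.row_orthogonal
  simpa [mul_comm] using this

/-- The similarity as a homeomorphism. -/
def toHomeomorph : (Fin 2 → ℂ) ≃ₜ (Fin 2 → ℂ) where
  toFun z := ![S.p * z 0 + S.q * z 1 + S.t₀, S.r * z 0 + S.s * z 1 + S.t₁]
  invFun z := ![(star S.p * (z 0 - S.t₀) + star S.r * (z 1 - S.t₁)) / S.ρ,
    (star S.q * (z 0 - S.t₀) + star S.s * (z 1 - S.t₁)) / S.ρ]
  left_inv z := by
    have hρ := S.ne_zero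
    funext j
    fin_cases j
    · simp only [Fin.zero_eta, Matrix.cons_val_zero, Matrix.cons_val_one]
      field_simp
      linear_combination z 0 * S.norm_left + z 1 * S.orthogonal
    · simp only [Fin.mk_one, Matrix.cons_val_zero, Matrix.cons_val_one]
      field_simp
      linear_combination z 0 * S.orthogonal' + z 1 * S.norm_right
  right_inv z := by
    have hρ := S.ne_zero
    funext j
    fin_cases j
    · simp only [Fin.zero_eta, Matrix.cons_val_zero, Matrix.cons_val_one]
      field_simp
      linear_combination (z 0 - S.t₀) * S.row_left + (z 1 - S.t₁) * S.row_orthogonal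
    · simp only [Fin.mk_one, Matrix.cons_val_zero, Matrix.cons_val_one]
      field_simp
      linear_combination (z 0 - S.t₀) * S.row_orthogonal' + (z 1 - S.t₁) * S.row_right
  continuous_toFun := by
    refine continuous_pi fun j => ?_
    fin_cases j <;> simp <;> fun_prop
  continuous_invFun := by
    refine continuous_pi fun j => ?_
    fin_cases j <;> simp <;> fun_prop

theorem apply_zero (z : Fin 2 → ℂ) : S.toHomeomorph z 0 = S.p * z 0 + S.q * z 1 + S.t₀ := rfl

theorem apply_one (z : Fin 2 → ℂ) : S.toHomeomorph z 1 = S.r * z 0 + S.s * z 1 + S.t₁ := rfl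

theorem symm_apply_zero (z : Fin 2 → ℂ) : S.toHomeomorph.symm z 0 =
    (star S.p * (z 0 - S.t₀) + star S.r * (z 1 - S.t₁)) / S.ρ := rfl

theorem symm_apply_one (z : Fin 2 → ℂ) : S.toHomeomorph.symm z 1 =
    (star S.q * (z 0 - S.t₀) + star S.s * (z 1 - S.t₁)) / S.ρ := rfl

end Similarity

/-- The similarity `S` carries the conic of `A'` to that of `A`. -/
structure Similarity.Carries (S : Similarity) (A' A : Matrix (Fin 3) (Fin 3) ℂ) (c : ℂ) :
    Prop where
  ne_zero : c ≠ 0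
  val : ∀ z, conicVal A' z = c * conicVal A (S.toHomeomorph z)
  grad_zero : ∀ z, conicGrad A' z 0 =
    c * (S.p * conicGrad A (S.toHomeomorph z) 0 + S.r * conicGrad A (S.toHomeomorph z) 1)
  grad_one : ∀ z, conicGrad A' z 1 =
    c * (S.q * conicGrad A (S.toHomeomorph z) 0 + S.s * conicGrad A (S.toHomeomorph z) 1)

/-- Gradients pull back by the transpose of N and conjugated differences are moved by the conjugate
of N. Because NN* = ρ, these are compatible up to nonzero factors: the two cross products expressing
proportionality differ by constants built from c, ρ and the conjugate of det N. -/
theorem Similarity.Carries.conicNormal_iff {S : Similarity} {A' A : Matrix (Fin 3) (Fin 3) ℂ}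
    {c : ℂ} (h : S.Carries A' A c) (z x y : Fin 2 → ℂ) :
    ConicNormal A' z (star (x - y)) ↔ ConicNormal A (S.toHomeomorph z)
      (star (S.toHomeomorph x - S.toHomeomorph y)) := by
  rw [ConicNormal, ConicNormal, h.val, mul_eq_zero, or_iff_right h.ne_zero, h.grad_zero,
    h.grad_one]
  refine and_congr_right fun _ => ?_
  rw [← sub_eq_zero, ← sub_eq_zero (a := conicGrad A (S.toHomeomorph z) 0 * _)]
  have hd : star (S.p * S.s - S.q * S.r) ≠ 0 := star_ne_zero.mpr S.det_ne_zero
  generalize conicGrad A (S.toHomeomorph z) 0 = a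
  generalize conicGrad A (S.toHomeomorph z) 1 = b
  simp only [Pi.star_apply, Pi.sub_apply, S.apply_zero, S.apply_one]
  have e1 : star (S.r * x 0 + S.s * x 1 + S.t₁ - (S.r * y 0 + S.s * y 1 + S.t₁)) =
      star S.r * star (x 0 - y 0) + star S.s * star (x 1 - y 1) := by
    simp only [star_sub, star_add, star_mul']; ring
  have e0 : star (S.p * x 0 + S.q * x 1 + S.t₀ - (S.p * y 0 + S.q * y 1 + S.t₀)) =
      star S.p * star (x 0 - y 0) + star S.q * star (x 1 - y 1) := by
    simp only [star_sub, star_add, star_mul']; ring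
  rw [e0, e1]
  generalize star (x 0 - y 0) = α
  generalize star (x 1 - y 1) = β
  have key : star (S.p * S.s - S.q * S.r) *
      (c * (S.p * a + S.r * b) * β - c * (S.q * a + S.s * b) * α) =
      c * S.ρ * (a * (star S.r * α + star S.s * β) - b * (star S.p * α + star S.q * β)) := by
    simp only [star_sub, star_mul']
    linear_combination (c * a * β) * (star S.s * S.row_left - star S.q * S.row_orthogonal) +
      (c * a * α) * (star S.r * S.row_left - star S.p * S.row_orthogonal) +
      (c * b * β) * (star S.s * S.row_orthogonal' - star S.q * S.row_right) +
      (c * b * α) * (star S.r * S.row_orthogonal' - star S.p * S.row_right)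
  constructor
  · intro h0
    rw [h0, mul_zero] at key
    exact (mul_eq_zero.mp key.symm).resolve_left (mul_ne_zero h.ne_zero S.ne_zero)
  · intro h0
    rw [h0, mul_zero] at key
    exact (mul_eq_zero.mp key).resolve_left hd

/-- Generically there are `d` virtual critical points. -/
def GenericCount (A : Matrix (Fin 3) (Fin 3) ℂ) (d : ℕ) : Prop :=
  Generic fun u v => (virtSet A u v).encard = d

/-- The numbers of critical points that occur on nonempty open sets. -/
def openCounts (A : Matrix (Fin 3) (Fin 3) ℂ) : Set ℕ :=
  {k | ∃ U : Set (Fin 2 → ℂ), IsOpen U ∧ U.Nonempty ∧ ∀ u ∈ U, (critSet A u).encard = k}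

/-- The similarity φ acts on z and u, and its conjugate v ↦ star (φ (star v)) acts on w and v. This
action preserves the critical equations. Both maps are polynomial bijections, so genericity is
transported. -/
theorem Similarity.Carries.genericCount {S : Similarity} {A' A : Matrix (Fin 3) (Fin 3) ℂ}
    {c : ℂ} (h : S.Carries A' A c) {d : ℕ} (hd : GenericCount A' d) : GenericCount A d := by
  set φ := S.toHomeomorph with hφ
  let P : Fin 2 → MvPolynomial (Fin 2 ⊕ Fin 2) ℂ :=
    ![C (star S.p / S.ρ) * (X (.inl 0) - C S.t₀) + C (star S.r / S.ρ) * (X (.inl 1) - C S.t₁),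
      C (star S.q / S.ρ) * (X (.inl 0) - C S.t₀) + C (star S.s / S.ρ) * (X (.inl 1) - C S.t₁)]
  let Q : Fin 2 → MvPolynomial (Fin 2 ⊕ Fin 2) ℂ :=
    ![C (S.p / S.ρ) * (X (.inr 0) - C (star S.t₀)) + C (S.r / S.ρ) * (X (.inr 1) - C (star S.t₁)),
      C (S.q / S.ρ) * (X (.inr 0) - C (star S.t₀)) + C (S.s / S.ρ) * (X (.inr 1) - C (star S.t₁))]
  have hP : ∀ u v, (fun j => eval (Sum.elim u v) (P j)) = φ.symm u := by
    intro u v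
    funext j
    fin_cases j
    · simp [P, hφ, S.symm_apply_zero]; ring
    · simp [P, hφ, S.symm_apply_one]; ring
  have hQ : ∀ u v, (fun j => eval (Sum.elim u v) (Q j)) = star (φ.symm (star v)) := by
    intro u v
    have hρ := S.star_rho
    simp only [← starRingEnd_apply] at hρ
    funext j
    fin_cases j
    · simp [Q, hφ, S.symm_apply_zero, hρ]; ring
    · simp [Q, hφ, S.symm_apply_one, hρ]; ring
  refine (hd.comp P Q fun u v => ?_).mono fun u v huv => ?_
  · refine ⟨φ u, star (φ (star v)), ?_, ?_⟩
    · rw [hP, Homeomorph.symm_apply_apply]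
    · rw [hQ, star_star, Homeomorph.symm_apply_apply, star_star]
  · simp only [hP, hQ] at huv
    rw [← huv]
    have hinj : Function.Injective (Prod.map φ fun w => star (φ (star w))) := by
      refine φ.injective.prodMap fun x y hxy => ?_
      exact star_injective (φ.injective (star_injective hxy))
    rw [← hinj.encard_image (virtSet A' _ _)]
    congr 1
    ext ⟨z, w⟩
    obtain ⟨z', rfl⟩ := φ.surjective z
    obtain ⟨w', rfl⟩ : ∃ w', w = star (φ (star w')) :=
      ⟨star (φ.symm (star w)), by simp⟩
    obtain ⟨u', rfl⟩ := φ.surjective u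
    obtain ⟨v', rfl⟩ : ∃ v', v = star (φ (star v')) :=
      ⟨star (φ.symm (star v)), by simp⟩
    have e := hinj.mem_set_image (s := virtSet A' u' v') (a := (z', w'))
    rw [Prod.map_apply] at e
    simp only [star_star, Homeomorph.symm_apply_apply]
    rw [e]
    simp only [virtSet, Set.mem_ofPred_eq]
    have h1 := h.conicNormal_iff z' (star v') (star w')
    have h2 := h.conicNormal_iff (star w') u' z'
    rw [← star_sub, star_star] at h1
    rw [h1, h2, star_star, star_sub (S.toHomeomorph (star v'))]

theorem Similarity.Carries.openCounts_eq {S : Similarity} {A' A : Matrix (Fin 3) (Fin 3) ℂ}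
    {c : ℂ} (h : S.Carries A' A c) : openCounts A = openCounts A' := by
  set φ := S.toHomeomorph with hφ
  have key : ∀ u, (critSet A (φ u)).encard = (critSet A' u).encard := by
    intro u
    rw [← φ.injective.encard_image (critSet A' u)]
    congr 1
    ext z
    obtain ⟨z', rfl⟩ := φ.surjective z
    rw [φ.injective.mem_set_image]
    exact (h.conicNormal_iff z' u z').symm
  ext k
  constructor
  · rintro ⟨U, hU, ⟨u, hu⟩, hk⟩
    refine ⟨φ ⁻¹' U, hU.preimage φ.continuous, ⟨φ.symm u, by simpa using hu⟩, fun u hu => ?_⟩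
    rw [← key]
    exact hk _ hu
  · rintro ⟨U, hU, ⟨u, hu⟩, hk⟩
    refine ⟨φ '' U, φ.isOpenMap _ hU, ⟨φ u, Set.mem_image_of_mem _ hu⟩, ?_⟩
    rintro _ ⟨u, hu, rfl⟩
    rw [key]
    exact hk _ hu

/-- `A` and `A'` have the same numbers of virtual and actual critical points. -/
def SameCounts (A A' : Matrix (Fin 3) (Fin 3) ℂ) : Prop :=
  (∀ d, GenericCount A' d → GenericCount A d) ∧ openCounts A = openCounts A'

theorem SameCounts.trans {A B C : Matrix (Fin 3) (Fin 3) ℂ} (h : SameCounts A B)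
    (h' : SameCounts B C) : SameCounts A C :=
  ⟨fun d hd => h.1 d (h'.1 d hd), h.2.trans h'.2⟩

theorem Similarity.Carries.sameCounts {S : Similarity} {A' A : Matrix (Fin 3) (Fin 3) ℂ}
    {c : ℂ} (h : S.Carries A' A c) : SameCounts A A' :=
  ⟨fun _ hd => h.genericCount hd, h.openCounts_eq⟩

end HermitianDistance
end

open MvPolynomial
noncomputable section
namespace HermitianDistance

/-! ### Takagi factorization -/

open Matrix in
-- Let x be an eigenvector of B*B; its eigenvalue is a square τ² with τ ≥ 0. By symmetry of B the
-- vector y formed as the conjugate of Bx plus τx satisfies By = τȳ. If y = 0, then Bx = -τx̄, and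
-- ix does the job. Normalizing gives the unit vector.
theorem exists_takagi_vector (B : Matrix (Fin 2) (Fin 2) ℂ) (hB : B.IsSymm) :
    ∃ (x : Fin 2 → ℂ) (σ : ℝ), 0 ≤ σ ∧ star x ⬝ᵥ x = 1 ∧ B *ᵥ x = (σ : ℂ) • star x := by
  have hBH : Bᴴ = B.map star := by rw [conjTranspose, hB.eq]
  have hconj : ∀ y, star (B *ᵥ star y) = Bᴴ *ᵥ y := by
    intro y
    have h1 : (B.map star)ᵀ = B.map star := by
      ext i j
      simp [hB.apply i j]
    rw [star_mulVec, star_star, ← mulVec_transpose, hBH, h1]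
  obtain ⟨lam, hl⟩ := Module.End.exists_eigenvalue (Matrix.toLin' (Bᴴ * B))
  obtain ⟨x, hx⟩ := hl.exists_hasEigenvector
  have hx0 := hx.2
  have hxe : Bᴴ *ᵥ (B *ᵥ x) = lam • x := by
    have := hx.apply_eq_smul
    rwa [toLin'_apply, ← mulVec_mulVec] at this
  have hnn : ∀ y : Fin 2 → ℂ, star y ⬝ᵥ y = ((∑ i, Complex.normSq (y i) : ℝ) : ℂ) := by
    intro y
    simp [dotProduct, Complex.normSq_eq_conj_mul_self]
  have hpos : ∀ y : Fin 2 → ℂ, y ≠ 0 → 0 < ∑ i, Complex.normSq (y i) := by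
    intro y hy
    obtain ⟨i, hi⟩ := Function.ne_iff.mp hy
    exact Finset.sum_pos' (fun i _ => Complex.normSq_nonneg _)
      ⟨i, Finset.mem_univ _, Complex.normSq_pos.mpr hi⟩
  have hlam : ∃ τ : ℝ, 0 ≤ τ ∧ lam = (τ : ℂ) ^ 2 := by
    have h1 : star (B *ᵥ x) ⬝ᵥ (B *ᵥ x) = lam * (star x ⬝ᵥ x) := by
      rw [star_mulVec, ← dotProduct_mulVec, hxe, dotProduct_smul, smul_eq_mul]
    rw [hnn, hnn] at h1
    have hp := hpos x hx0
    refine ⟨Real.sqrt ((∑ i, Complex.normSq ((B *ᵥ x) i)) / ∑ i, Complex.normSq (x i)),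
      Real.sqrt_nonneg _, ?_⟩
    rw [← Complex.ofReal_pow, Real.sq_sqrt (div_nonneg
      (Finset.sum_nonneg fun i _ => Complex.normSq_nonneg _) hp.le), Complex.ofReal_div, h1,
      mul_div_cancel_right₀]
    exact Complex.ofReal_ne_zero.mpr hp.ne'
  obtain ⟨τ, hτ, rfl⟩ := hlam
  obtain ⟨y, hy0, hy⟩ : ∃ y, y ≠ 0 ∧ B *ᵥ y = (τ : ℂ) • star y := by
    by_cases h : star (B *ᵥ x) + (τ : ℂ) • x = 0
    · refine ⟨Complex.I • x, smul_ne_zero Complex.I_ne_zero hx0, ?_⟩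
      have : B *ᵥ x = -((τ : ℂ) • star x) := by
        have := congrArg star h
        rw [star_add, star_star, star_smul, star_zero, Complex.star_def, Complex.conj_ofReal]
          at this
        exact eq_neg_of_add_eq_zero_left this
      rw [mulVec_smul, this]
      ext i
      simp
      try ring
    · refine ⟨_, h, ?_⟩
      have h2 : B *ᵥ star (B *ᵥ x) = (τ : ℂ) ^ 2 • star x := by
        rw [← star_inj, hconj, hxe]
        ext i
        simp
      rw [mulVec_add, mulVec_smul, h2]
      generalize B *ᵥ x = y
      ext i
      simp
      ring
  have hp := hpos y hy0
  set n := ∑ i, Complex.normSq (y i) with hn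
  have hs : Real.sqrt n ≠ 0 := (Real.sqrt_pos.mpr hp).ne'
  refine ⟨((Real.sqrt n)⁻¹ : ℂ) • y, τ, hτ, ?_, ?_⟩
  · rw [star_smul, smul_dotProduct, dotProduct_smul, hnn, ← hn]
    simp only [star_inv₀, smul_eq_mul, Complex.star_def, Complex.conj_ofReal]
    rw [← Complex.ofReal_inv, ← Complex.ofReal_mul, ← Complex.ofReal_mul, ← Complex.ofReal_one]
    congr 1
    field_simp
    rw [Real.sq_sqrt hp.le]
  · rw [mulVec_smul, hy, star_smul]
    ext i
    simp
    ring

open Matrix in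
/-- The Takagi factorization of a complex symmetric `2 × 2` matrix. -/
theorem exists_takagi (B : Matrix (Fin 2) (Fin 2) ℂ) (hB : B.IsSymm) :
    ∃ (U : Matrix (Fin 2) (Fin 2) ℂ) (σ τ : ℝ), Uᴴ * U = 1 ∧ 0 ≤ σ ∧ 0 ≤ τ ∧
      Uᵀ * B * U = !![(σ : ℂ), 0; 0, (τ : ℂ)] := by
  obtain ⟨x, σ, hσ, hx, hBx⟩ := exists_takagi_vector B hB
  have h10 := hB.apply 0 1
  have e0 := congrFun hBx 0
  have e1 := congrFun hBx 1
  simp only [mulVec, dotProduct, Fin.sum_univ_two, Pi.smul_apply, smul_eq_mul, Pi.star_apply, h10]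
    at e0 e1 hx
  set η := star (x 1) ^ 2 * B 0 0 - 2 * star (x 0) * star (x 1) * B 0 1 + star (x 0) ^ 2 * B 1 1
    with hη
  obtain ⟨ε, hε1, hε⟩ : ∃ ε : ℂ, star ε * ε = 1 ∧ ε ^ 2 * η = (‖η‖ : ℂ) := by
    refine ⟨Complex.exp (-(η.arg / 2 : ℝ) * Complex.I), ?_, ?_⟩
    · rw [Complex.star_def, ← Complex.exp_conj, ← Complex.exp_add, map_mul, map_neg,
        Complex.conj_ofReal, Complex.conj_I]
      ring_nf
      exact Complex.exp_zero
    · nth_rewrite 2 [← Complex.norm_mul_exp_arg_mul_I η]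
      rw [← Complex.exp_nat_mul, mul_left_comm, ← Complex.exp_add]
      have : (2 : ℕ) * (-((η.arg / 2 : ℝ) : ℂ) * Complex.I) + η.arg * Complex.I = 0 := by
        push_cast; ring
      rw [this, Complex.exp_zero, mul_one]
  -- The second column is the unit vector orthogonal to x, turned by the phase ε. Since Bx = σx̄,
  -- the off-diagonal entries vanish, and ε was chosen so that the last entry ε²η is the nonnegative
  -- number ‖η‖.
  refine ⟨!![x 0, -star (x 1) * ε; x 1, star (x 0) * ε], σ, ‖η‖, ?_, hσ, norm_nonneg _, ?_⟩
  · ext i j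
    fin_cases i <;> fin_cases j <;> simp [Matrix.mul_apply, Fin.sum_univ_two] at hx hε1 ⊢
    · linear_combination hx
    · ring
    · ring
    · linear_combination hε1 * (x 1 * starRingEnd ℂ (x 1) + x 0 * starRingEnd ℂ (x 0)) + hx
  · rw [← hε, hη]
    ext i j
    fin_cases i <;> fin_cases j <;>
      simp [Matrix.mul_apply, Fin.sum_univ_two, h10] at hx e0 e1 ⊢
    · linear_combination x 0 * e0 + x 1 * e1 + σ * hx
    · linear_combination -starRingEnd ℂ (x 1) * ε * e0 + starRingEnd ℂ (x 0) * ε * e1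
    · linear_combination -starRingEnd ℂ (x 1) * ε * e0 + starRingEnd ℂ (x 0) * ε * e1
    · ring

/-! ### Singular values -/

open Matrix in
-- The squared singular values are the eigenvalues of the Hermitian matrix B*B, which is scalar
-- exactly when they coincide.
theorem singularValue_eq_iff (B : Matrix (Fin 2) (Fin 2) ℂ) :
    singularValue B 0 = singularValue B 1 ↔ ∃ c : ℂ, Bᴴ * B = c • (1 : Matrix _ _ ℂ) := by
  set T := Matrix.toEuclideanLin B with hT
  have hn : Module.finrank ℂ (EuclideanSpace ℂ (Fin 2)) = 2 := by simp
  set b := T.isSymmetric_adjoint_comp_self.eigenvectorBasis hn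
  set e := T.isSymmetric_adjoint_comp_self.eigenvalues hn with he
  have hb : ∀ i, (LinearMap.adjoint T ∘ₗ T) (b i) = (e i : ℂ) • b i :=
    T.isSymmetric_adjoint_comp_self.apply_eigenvectorBasis hn
  have hsv : ∀ i : Fin 2, singularValue B i ^ 2 = e i := fun i => T.sq_singularValues_fin hn i
  have hadj : Matrix.toEuclideanLin (Bᴴ * B) = LinearMap.adjoint T ∘ₗ T := by
    rw [hT, ← Matrix.toEuclideanLin_conjTranspose_eq_adjoint]
    ext x i
    simp [Matrix.toEuclideanLin]
  have hsc : ∀ c : ℂ, Matrix.toEuclideanLin (c • (1 : Matrix (Fin 2) (Fin 2) ℂ)) =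
      c • LinearMap.id := by
    intro c
    ext x i
    simp [Matrix.toEuclideanLin]
  constructor
  · intro h
    refine ⟨e 0, Matrix.toEuclideanLin.injective ?_⟩
    rw [hadj, hsc]
    refine b.toBasis.ext fun i => ?_
    rw [OrthonormalBasis.coe_toBasis, hb]
    have h01 : e 1 = e 0 := by rw [← hsv, ← hsv, h]
    fin_cases i
    · rfl
    · simp [h01]
  · rintro ⟨c, hc⟩
    have hec : ∀ i, (e i : ℂ) = c := by
      intro i
      have h1 := hb i
      rw [← hadj, hc, hsc] at h1
      have h2 : ((e i : ℂ) - c) • b i = 0 := by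
        rw [sub_smul, ← h1]
        simp
      rcases smul_eq_zero.mp h2 with h | h
      · exact sub_eq_zero.mp h
      · exact absurd h (b.orthonormal.ne_zero i)
    have h01 : e 0 = e 1 := by
      have := (hec 0).trans (hec 1).symm
      exact_mod_cast this
    have h2 : singularValue B 0 ^ 2 = singularValue B 1 ^ 2 := by rw [hsv, hsv, h01]
    exact (sq_eq_sq₀ (T.singularValues_nonneg _) (T.singularValues_nonneg _)).mp h2

open Matrix in
theorem singularValue_eq_iff_of_takagi {B U : Matrix (Fin 2) (Fin 2) ℂ} {σ τ : ℝ}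
    (hU : Uᴴ * U = 1) (hσ : 0 ≤ σ) (hτ : 0 ≤ τ)
    (h : Uᵀ * B * U = !![(σ : ℂ), 0; 0, (τ : ℂ)]) :
    singularValue B 0 = singularValue B 1 ↔ σ = τ := by
  have hU' : U * Uᴴ = 1 := mul_eq_one_comm.mp hU
  have hUt : Uᵀᴴ * Uᵀ = 1 := by
    have := congrArg transpose hU'
    rwa [transpose_mul, transpose_one] at this
  have hD : Uᴴ * (Bᴴ * B) * U = !![(σ : ℂ) ^ 2, 0; 0, (τ : ℂ) ^ 2] := by
    calc Uᴴ * (Bᴴ * B) * U = Uᴴ * Bᴴ * 1 * B * U := by simp only [Matrix.mul_assoc, Matrix.one_mul]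
      _ = (Uᵀ * B * U)ᴴ * (Uᵀ * B * U) := by
        rw [← hUt]
        simp only [conjTranspose_mul, Matrix.mul_assoc]
      _ = _ := by
        rw [h]
        ext i j
        fin_cases i <;> fin_cases j <;> simp [Matrix.mul_apply, Fin.sum_univ_two, sq]
  rw [singularValue_eq_iff]
  constructor
  · rintro ⟨c, hc⟩
    rw [hc, Matrix.mul_smul, Matrix.mul_one, Matrix.smul_mul, hU] at hD
    have h0 := congrFun (congrFun hD 0) 0
    have h1 := congrFun (congrFun hD 1) 1
    simp at h0 h1
    have h2 : (σ : ℂ) ^ 2 = (τ : ℂ) ^ 2 := h0.symm.trans h1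
    have h3 : σ ^ 2 = τ ^ 2 := by exact_mod_cast h2
    exact (sq_eq_sq₀ hσ hτ).mp h3
  · rintro rfl
    refine ⟨(σ : ℂ) ^ 2, ?_⟩
    have h1 : (!![(σ : ℂ) ^ 2, 0; 0, (σ : ℂ) ^ 2] : Matrix (Fin 2) (Fin 2) ℂ) =
        (σ : ℂ) ^ 2 • (1 : Matrix (Fin 2) (Fin 2) ℂ) := by
      ext i j
      fin_cases i <;> fin_cases j <;> simp
    rw [h1] at hD
    calc Bᴴ * B = (U * Uᴴ) * (Bᴴ * B) * (U * Uᴴ) := by rw [hU', Matrix.one_mul, Matrix.mul_one]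
      _ = U * (Uᴴ * (Bᴴ * B) * U) * Uᴴ := by simp only [Matrix.mul_assoc]
      _ = _ := by rw [hD, Matrix.mul_smul, Matrix.mul_one, Matrix.smul_mul, hU']

/-! ### Normal forms -/

theorem Similarity.carries_of_entries (S : Similarity) {A A' : Matrix (Fin 3) (Fin 3) ℂ} {c : ℂ}
    (hc : c ≠ 0) (hA : A.IsSymm) (hA' : A'.IsSymm)
    (h00 : A' 0 0 = c * (S.p ^ 2 * A 0 0 + 2 * S.p * S.r * A 0 1 + S.r ^ 2 * A 1 1))
    (h01 : A' 0 1 = c * (S.p * S.q * A 0 0 + (S.p * S.s + S.q * S.r) * A 0 1 +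
      S.r * S.s * A 1 1))
    (h11 : A' 1 1 = c * (S.q ^ 2 * A 0 0 + 2 * S.q * S.s * A 0 1 + S.s ^ 2 * A 1 1))
    (h02 : A' 0 2 = c * (S.p * (A 0 0 * S.t₀ + A 0 1 * S.t₁ + A 0 2) +
      S.r * (A 0 1 * S.t₀ + A 1 1 * S.t₁ + A 1 2)))
    (h12 : A' 1 2 = c * (S.q * (A 0 0 * S.t₀ + A 0 1 * S.t₁ + A 0 2) +
      S.s * (A 0 1 * S.t₀ + A 1 1 * S.t₁ + A 1 2)))
    (h22 : A' 2 2 = c * (A 0 0 * S.t₀ ^ 2 + 2 * A 0 1 * S.t₀ * S.t₁ + A 1 1 * S.t₁ ^ 2 +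
      2 * A 0 2 * S.t₀ + 2 * A 1 2 * S.t₁ + A 2 2)) : S.Carries A' A c where
  ne_zero := hc
  val z := by
    simp only [conicVal_eq, conicGrad, S.apply_zero, S.apply_one, hA.apply 0 1, hA.apply 0 2,
      hA.apply 1 2, hA'.apply 0 1, hA'.apply 0 2, hA'.apply 1 2, h00, h01, h11, h02, h12, h22]
    ring
  grad_zero z := by
    simp only [conicGrad, S.apply_zero, S.apply_one, hA.apply 0 1, h00, h01, h02]
    ring
  grad_one z := by
    simp only [conicGrad, S.apply_zero, S.apply_one, hA.apply 0 1, hA'.apply 0 1, h11, h01, h12]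
    ring

/-- The symmetric matrix with entries `a, b, c, d, e, f`. -/
def symMat (a b c d e f : ℂ) : Matrix (Fin 3) (Fin 3) ℂ := !![a, b, d; b, c, e; d, e, f]

theorem isSymm_symMat (a b c d e f : ℂ) : (symMat a b c d e f).IsSymm := by
  ext i j
  fin_cases i <;> fin_cases j <;> rfl

theorem det_symMat (a b c d e f : ℂ) : (symMat a b c d e f).det =
    a * c * f - a * e ^ 2 - b ^ 2 * f + 2 * b * d * e - c * d ^ 2 := by
  simp [symMat, Matrix.det_fin_three]
  ring

theorem eq_symMat {A : Matrix (Fin 3) (Fin 3) ℂ} (hA : A.IsSymm) :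
    A = symMat (A 0 0) (A 0 1) (A 1 1) (A 0 2) (A 1 2) (A 2 2) := by
  ext i j
  fin_cases i <;> fin_cases j <;> simp [symMat, hA.apply 0 1, hA.apply 0 2, hA.apply 1 2]

theorem Similarity.sameCounts_symMat (S : Similarity) {c : ℂ} (hc : c ≠ 0) {A00 A01 A11 A02 A12 A22
    B00 B01 B11 B02 B12 B22 : ℂ}
    (h00 : B00 = c * (S.p ^ 2 * A00 + 2 * S.p * S.r * A01 + S.r ^ 2 * A11))
    (h01 : B01 = c * (S.p * S.q * A00 + (S.p * S.s + S.q * S.r) * A01 + S.r * S.s * A11))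
    (h11 : B11 = c * (S.q ^ 2 * A00 + 2 * S.q * S.s * A01 + S.s ^ 2 * A11))
    (h02 : B02 = c * (S.p * (A00 * S.t₀ + A01 * S.t₁ + A02) +
      S.r * (A01 * S.t₀ + A11 * S.t₁ + A12)))
    (h12 : B12 = c * (S.q * (A00 * S.t₀ + A01 * S.t₁ + A02) +
      S.s * (A01 * S.t₀ + A11 * S.t₁ + A12)))
    (h22 : B22 = c * (A00 * S.t₀ ^ 2 + 2 * A01 * S.t₀ * S.t₁ + A11 * S.t₁ ^ 2 +
      2 * A02 * S.t₀ + 2 * A12 * S.t₁ + A22)) :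
    SameCounts (symMat A00 A01 A11 A02 A12 A22) (symMat B00 B01 B11 B02 B12 B22) :=
  (S.carries_of_entries hc (isSymm_symMat _ _ _ _ _ _) (isSymm_symMat _ _ _ _ _ _)
    h00 h01 h11 h02 h12 h22).sameCounts

open Matrix in
theorem exists_sameCounts_diagonal {A : Matrix (Fin 3) (Fin 3) ℂ} (hA : A.IsSymm)
    (hd : A.det ≠ 0) : ∃ (σ τ : ℝ) (d e f : ℂ), 0 ≤ σ ∧ 0 ≤ τ ∧
      ((leadingBlock A).det = 0 ↔ σ = 0 ∨ τ = 0) ∧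
      (singularValue (leadingBlock A) 0 = singularValue (leadingBlock A) 1 ↔ σ = τ) ∧
      (symMat σ 0 τ d e f).det ≠ 0 ∧ SameCounts A (symMat σ 0 τ d e f) := by
  have hB : (leadingBlock A).IsSymm := by
    ext i j
    exact hA.apply _ _
  obtain ⟨U, σ, τ, hU, hσ, hτ, hUB⟩ := exists_takagi _ hB
  have n00 := congrFun (congrFun hU 0) 0
  have n01 := congrFun (congrFun hU 0) 1
  have n11 := congrFun (congrFun hU 1) 1
  simp only [Matrix.mul_apply, Fin.sum_univ_two, conjTranspose_apply, one_apply_eq] at n00 n01 n11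
  rw [one_apply_ne zero_ne_one] at n01
  let S : Similarity := ⟨U 0 0, U 0 1, U 1 0, U 1 1, 0, 0, 1, one_ne_zero, n00, n11, n01⟩
  have e00 := congrFun (congrFun hUB 0) 0
  have e01 := congrFun (congrFun hUB 0) 1
  have e11 := congrFun (congrFun hUB 1) 1
  have b00 : leadingBlock A 0 0 = A 0 0 := rfl
  have b01 : leadingBlock A 0 1 = A 0 1 := rfl
  have b10 : leadingBlock A 1 0 = A 0 1 := hA.apply 0 1
  have b11 : leadingBlock A 1 1 = A 1 1 := rfl
  simp [Matrix.mul_apply, Fin.sum_univ_two, b00, b01, b10, b11] at e00 e01 e11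
  have hdet : (U 0 0 * U 1 1 - U 0 1 * U 1 0) ≠ 0 := S.det_ne_zero
  refine ⟨σ, τ, U 0 0 * A 0 2 + U 1 0 * A 1 2, U 0 1 * A 0 2 + U 1 1 * A 1 2, A 2 2, hσ, hτ,
    ?_, singularValue_eq_iff_of_takagi hU hσ hτ hUB, ?_, ?_⟩
  · have h1 := congrArg Matrix.det hUB
    rw [det_mul, det_mul, det_transpose, det_fin_two_of, mul_zero, sub_zero, det_fin_two U] at h1
    rw [mul_comm (U 0 0 * U 1 1 - U 0 1 * U 1 0), mul_assoc] at h1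
    constructor
    · intro h
      rw [h, zero_mul, eq_comm, mul_eq_zero] at h1
      simpa using h1
    · intro h
      have h2 : (σ : ℂ) * τ = 0 := by
        rcases h with h | h <;> simp [h]
      rw [h2, mul_eq_zero] at h1
      exact h1.resolve_right (mul_ne_zero hdet hdet)
  · have : (symMat σ 0 τ (U 0 0 * A 0 2 + U 1 0 * A 1 2) (U 0 1 * A 0 2 + U 1 1 * A 1 2)
        (A 2 2)).det = (U 0 0 * U 1 1 - U 0 1 * U 1 0) ^ 2 * A.det := by
      rw [eq_symMat hA, det_symMat, det_symMat]
      simp only [symMat, of_apply, cons_val', cons_val_zero, cons_val_one, cons_val]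
      rw [← e00, ← e11]
      linear_combination -(-A 2 2 * (U 0 1 * (U 0 0 * A 0 0 + U 1 0 * A 0 1) +
        U 1 1 * (U 0 0 * A 0 1 + U 1 0 * A 1 1)) +
        2 * (U 0 0 * A 0 2 + U 1 0 * A 1 2) * (U 0 1 * A 0 2 + U 1 1 * A 1 2)) * e01
    rw [this]
    exact mul_ne_zero (pow_ne_zero _ hdet) hd
  · rw [eq_symMat hA]
    refine S.sameCounts_symMat (c := 1) one_ne_zero ?_ ?_ ?_ ?_ ?_ ?_ <;>
      simp only [symMat, of_apply, cons_val', cons_val_zero, cons_val_one, cons_val, S]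
    · linear_combination -e00
    · linear_combination -e01
    · linear_combination -e11
    · ring
    · ring
    · ring

theorem sameCounts_swap (a c d e f : ℂ) :
    SameCounts (symMat a 0 c d e f) (symMat c 0 a e d f) := by
  refine Similarity.sameCounts_symMat ⟨0, 1, 1, 0, 0, 0, 1, one_ne_zero, by simp, by simp, by simp⟩
    (c := 1) one_ne_zero ?_ ?_ ?_ ?_ ?_ ?_ <;> simp

/-- The matrix of the parabola `z₁² = 2 z₂`. -/
def parabolaMat : Matrix (Fin 3) (Fin 3) ℂ := symMat 1 0 0 0 (-1) 0

/-- The matrix of the circle `z₁ z₂ = 1` in isotropic coordinates. -/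
def circleMat : Matrix (Fin 3) (Fin 3) ℂ := symMat 0 (1 / 2) 0 0 0 (-1)

/-- The matrix of the ellipse `z₁² + k z₂² = 1`. -/
def ellipseMat (k : ℝ) : Matrix (Fin 3) (Fin 3) ℂ := symMat 1 0 k 0 0 (-1)

/-- Translation removes d and f, which is possible since the determinant forces σ and e to be
nonzero. The two diagonal entries of N both have modulus ‖e‖ / σ, and the phase of the second one
makes the coefficient of z₂ real. -/
theorem sameCounts_parabola {σ : ℝ} {d e f : ℂ}
    (hd : (symMat σ 0 0 d e f).det ≠ 0) : SameCounts (symMat σ 0 0 d e f) parabolaMat := by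
  rw [det_symMat] at hd
  have hσ0 : (σ : ℂ) ≠ 0 := by rintro h; simp [h] at hd
  have he : e ≠ 0 := by rintro rfl; simp at hd
  have hn : (‖e‖ : ℂ) ≠ 0 := by simpa using he
  have hne : (starRingEnd ℂ) e * e = (‖e‖ : ℂ) ^ 2 := by
    rw [← Complex.normSq_eq_conj_mul_self, Complex.normSq_eq_norm_sq]; push_cast; rfl
  have he' : (starRingEnd ℂ) e ≠ 0 := by simpa using he
  refine Similarity.sameCounts_symMat ⟨(‖e‖ / σ : ℂ), 0, 0, -(‖e‖ ^ 2 / (σ * e) : ℂ), -d / σ,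
    (d ^ 2 / σ - f) / (2 * e), (‖e‖ / σ) ^ 2, by positivity, ?_, ?_, ?_⟩
    (c := σ / ‖e‖ ^ 2) (by positivity) ?_ ?_ ?_ ?_ ?_ ?_ <;> simp
  · ring
  · field_simp
    linear_combination -hne
  all_goals first
    | field_simp
      done
    | field_simp
      ring_nf
      simp


/-- After completing squares the constant is g, which is nonzero by the determinant. Scaling both
coordinates by a complex square root of -g / σ is a similarity whatever the phase, so g can be
normalized while the ratio τ / σ survives. -/
theorem sameCounts_ellipse {σ τ : ℝ} (hσ : 0 < σ) (hτ : 0 < τ) {d e f : ℂ}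
    (hd : (symMat σ 0 τ d e f).det ≠ 0) :
    SameCounts (symMat σ 0 τ d e f) (ellipseMat (τ / σ)) := by
  rw [det_symMat] at hd
  have hσ0 : (σ : ℂ) ≠ 0 := by exact_mod_cast hσ.ne'
  have hτ0 : (τ : ℂ) ≠ 0 := by exact_mod_cast hτ.ne'
  set g := f - d ^ 2 / σ - e ^ 2 / τ with hg
  have hg0 : g ≠ 0 := by
    intro h
    apply hd
    rw [hg] at h
    field_simp at h
    linear_combination h
  obtain ⟨r, hr⟩ := IsAlgClosed.exists_pow_nat_eq (-g / σ) (n := 2) two_pos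
  have hr0 : r ≠ 0 := by
    rintro rfl
    rw [zero_pow two_ne_zero, eq_comm, div_eq_zero_iff, neg_eq_zero] at hr
    tauto
  have hr' : σ * r ^ 2 = -g := by rw [hr]; field_simp
  refine Similarity.sameCounts_symMat ⟨r, 0, 0, r, -d / σ, -e / τ, star r * r,
    mul_ne_zero (star_ne_zero.mpr hr0) hr0, by simp, by simp, by simp⟩
    (c := -1 / g) (div_ne_zero (by simp) hg0) ?_ ?_ ?_ ?_ ?_ ?_ <;> simp
  · field_simp
    linear_combination hr'
  · field_simp
    linear_combination hr'
  · field_simp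
    simp
  · field_simp
    simp
  · field_simp
    rw [hg]
    field_simp
    ring

/-- The substitution is (z₁ + z₂)/2 and i(z₂ - z₁)/2, whose squares add up to z₁z₂. Its columns are
orthogonal and of equal norm, so it is a similarity. -/
theorem sameCounts_circle : SameCounts (ellipseMat 1) circleMat := by
  have hI := Complex.I_sq
  refine Similarity.sameCounts_symMat ⟨1 / 2, 1 / 2, -Complex.I / 2, Complex.I / 2, 0, 0, 1 / 2,
    by simp, ?_, ?_, ?_⟩ (c := 1) one_ne_zero ?_ ?_ ?_ ?_ ?_ ?_ <;> simp
  all_goals ring_nf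
  all_goals simp
  all_goals norm_num

theorem sameCounts_cases {A : Matrix (Fin 3) (Fin 3) ℂ} (hA : A.IsSymm) (hd : A.det ≠ 0) :
    ((leadingBlock A).det = 0 → SameCounts A parabolaMat) ∧
    ((leadingBlock A).det ≠ 0 →
      singularValue (leadingBlock A) 0 = singularValue (leadingBlock A) 1 →
      SameCounts A circleMat) ∧
    ((leadingBlock A).det ≠ 0 →
      singularValue (leadingBlock A) 0 ≠ singularValue (leadingBlock A) 1 →
      ∃ k : ℝ, 1 < k ∧ SameCounts A (ellipseMat k)) := by
  obtain ⟨σ, τ, d, e, f, hσ, hτ, h1, h2, h3, h4⟩ := exists_sameCounts_diagonal hA hd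
  have hswap : (symMat τ 0 σ e d f).det ≠ 0 := by
    rw [det_symMat] at h3 ⊢
    intro h
    apply h3
    linear_combination h
  rw [Ne, h1, not_or]
  refine ⟨?_, ?_, ?_⟩
  · rintro (rfl | rfl)
    · exact h4.trans ((sameCounts_swap _ _ _ _ _).trans (sameCounts_parabola hswap))
    · exact h4.trans (sameCounts_parabola h3)
  · rintro ⟨hσ0, hτ0⟩ hst
    obtain rfl := h2.mp hst
    have hσ' : 0 < σ := lt_of_le_of_ne hσ (Ne.symm hσ0)
    have := sameCounts_ellipse hσ' hσ' h3
    rw [div_self hσ0] at this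
    exact h4.trans (this.trans sameCounts_circle)
  · rintro ⟨hσ0, hτ0⟩ hne
    have hσ' : 0 < σ := lt_of_le_of_ne hσ (Ne.symm hσ0)
    have hτ' : 0 < τ := lt_of_le_of_ne hτ (Ne.symm hτ0)
    rcases lt_or_gt_of_ne (fun h => hne (h2.mpr h) : σ ≠ τ) with h | h
    · exact ⟨τ / σ, (one_lt_div hσ').mpr h, h4.trans (sameCounts_ellipse hσ' hτ' h3)⟩
    · exact ⟨σ / τ, (one_lt_div hτ').mpr h,
        h4.trans ((sameCounts_swap _ _ _ _ _).trans (sameCounts_ellipse hτ' hσ' hswap))⟩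

end HermitianDistance
end

open MvPolynomial
noncomputable section
namespace HermitianDistance

/-! ### Numbers of critical points on open sets -/

open Topology Filter

theorem exists_of_mem_openCounts {A : Matrix (Fin 3) (Fin 3) ℂ} {k : ℕ} (hk : k ∈ openCounts A)
    {S : (Fin 2 → ℂ) → (Fin 2 → ℂ) → Prop} (hS : Generic S) :
    ∃ u, S u (star u) ∧ (critSet A u).encard = k := by
  obtain ⟨U, hU, hne, hk⟩ := hk
  obtain ⟨u, hu, h⟩ := hS.exists_mem hU hne
  exact ⟨u, h, hk u hu⟩

/-- The critical points are the fixed points of an involution of the virtual critical points. -/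
theorem GenericCount.mod_two {A : Matrix (Fin 3) (Fin 3) ℂ} {d : ℕ} (hd : GenericCount A d)
    {k : ℕ} (hk : k ∈ openCounts A) : k ≤ d ∧ k % 2 = d % 2 := by
  obtain ⟨u, hu, hk⟩ := exists_of_mem_openCounts hk hd
  obtain ⟨m, hm, hmd, hm2⟩ := encard_fixed_mod_two hu (fun p => (star p.2, star p.1))
    (fun p hp => by
      simp only [virtSet, Set.mem_ofPred_eq, star_star] at hp ⊢
      rw [star_sub] at hp
      rw [← star_sub]
      exact ⟨by simpa using hp.2, by simpa using hp.1⟩)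
    (fun p _ => by simp)
  have hinj : Function.Injective fun z : Fin 2 → ℂ => (z, star z) := fun x y h => congrArg Prod.fst h
  have : {p ∈ virtSet A u (star u) | (star p.2, star p.1) = p} =
      (fun z => (z, star z)) '' critSet A u := by
    ext ⟨z, w⟩
    simp only [virtSet, critSet, Set.mem_ofPred_eq, Set.mem_image, Prod.mk.injEq]
    constructor
    · rintro ⟨⟨h1, -⟩, -, h3⟩
      refine ⟨z, ?_, rfl, h3⟩
      rwa [star_sub, h3]
    · rintro ⟨x, h1, rfl, rfl⟩
      rw [star_star, ← star_sub]
      exact ⟨⟨h1, h1⟩, rfl, rfl⟩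
  rw [this, hinj.encard_image, hk] at hm
  have : k = m := by exact_mod_cast hm
  exact this ▸ ⟨hmd, hm2⟩

/-! ### Existence of a critical point -/

theorem hasStrictFDerivAt_conicVal {A : Matrix (Fin 3) (Fin 3) ℂ} (hA : A.IsSymm) (z : Fin 2 → ℂ) :
    HasStrictFDerivAt (𝕜 := ℝ) (conicVal A)
      ((2 * conicGrad A z 0) • (ContinuousLinearMap.proj 0 : (Fin 2 → ℂ) →L[ℝ] ℂ) +
        (2 * conicGrad A z 1) • (ContinuousLinearMap.proj 1 : (Fin 2 → ℂ) →L[ℝ] ℂ)) z := by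
  have h0 := (ContinuousLinearMap.proj 0 : (Fin 2 → ℂ) →L[ℝ] ℂ).hasStrictFDerivAt (x := z)
  have h1 := (ContinuousLinearMap.proj 1 : (Fin 2 → ℂ) →L[ℝ] ℂ).hasStrictFDerivAt (x := z)
  have hf : conicVal A = fun z : Fin 2 → ℂ => A 0 0 * (z 0 * z 0) + (2 * A 0 1) * (z 0 * z 1) +
      A 1 1 * (z 1 * z 1) + 2 * A 0 2 * z 0 + 2 * A 1 2 * z 1 + A 2 2 := by
    funext z
    simp only [conicVal_eq, conicGrad, hA.apply 0 1, hA.apply 0 2, hA.apply 1 2]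
    ring
  rw [hf]
  refine HasStrictFDerivAt.congr_fderiv ((((((h0.mul h0).const_mul (A 0 0)).add
    ((h0.mul h1).const_mul (2 * A 0 1))).add ((h1.mul h1).const_mul (A 1 1))).add
    (h0.const_mul (2 * A 0 2))).add (h1.const_mul (2 * A 1 2)) |>.add_const (A 2 2)) ?_
  ext t
  simp [conicGrad, hA.apply 0 1]
  ring

/-- A point of the conic nearest to u exists by compactness of the part at distance at most that of
z₀. Real Lagrange multipliers then give the Hermitian normality condition. -/
theorem exists_mem_critSet {A : Matrix (Fin 3) (Fin 3) ℂ} (hA : A.IsSymm) (hd : A.det ≠ 0)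
    {z₀ : Fin 2 → ℂ} (hz₀ : conicVal A z₀ = 0) (u : Fin 2 → ℂ) : (critSet A u).Nonempty := by
  have hcont : Continuous (conicVal A) := by
    refine continuous_iff_continuousAt.mpr fun z => ?_
    exact (hasStrictFDerivAt_conicVal hA z).hasFDerivAt.continuousAt
  have hq : ContDiff ℝ 1 (sqDist u) := by
    unfold sqDist
    refine ContDiff.sum fun j _ => ?_
    exact ContDiff.norm_sq ℝ (by fun_prop)
  set K := {z | conicVal A z = 0} ∩ {z | sqDist u z ≤ sqDist u z₀} with hK
  have hKc : IsCompact K := by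
    refine Metric.isCompact_of_isClosed_isBounded ((isClosed_eq hcont continuous_const).inter
      (isClosed_le hq.continuous continuous_const)) ?_
    refine (Metric.isBounded_closedBall (x := u) (r := 1 + sqDist u z₀)).subset ?_
    rintro z ⟨-, hz⟩
    have h0 : 0 ≤ sqDist u z₀ := Finset.sum_nonneg fun _ _ => by positivity
    rw [Metric.mem_closedBall, dist_comm, dist_pi_le_iff (by linarith)]
    intro j
    have h1 : ‖u j - z j‖ ^ 2 ≤ sqDist u z :=
      Finset.single_le_sum (f := fun j => ‖u j - z j‖ ^ 2) (fun _ _ => by positivity)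
        (Finset.mem_univ j)
    have h2 : ‖u j - z j‖ ^ 2 ≤ sqDist u z₀ := h1.trans hz
    rw [dist_eq_norm]
    nlinarith [sq_nonneg (‖u j - z j‖ - 1)]
  obtain ⟨z, hzK, hmin⟩ := hKc.exists_isMinOn ⟨z₀, hz₀, le_refl (sqDist u z₀)⟩
    hq.continuous.continuousOn
  have hz : conicVal A z = 0 := hzK.1
  have hmin' : IsLocalExtrOn (sqDist u) {x | conicVal A x = conicVal A z} z := by
    refine Or.inl ?_
    refine IsMinOn.localize fun x hx => ?_
    rw [Set.mem_ofPred_eq, hz] at hx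
    by_cases h : sqDist u x ≤ sqDist u z₀
    · exact hmin ⟨hx, h⟩
    · exact le_trans hzK.2 (not_le.mp h).le
  obtain ⟨Λ, Λ₀, hne, hΛ⟩ := hmin'.exists_linear_map_of_hasStrictFDerivAt
    (hasStrictFDerivAt_conicVal hA z) (hq.contDiffAt.hasStrictFDerivAt one_ne_zero)
  have hg := conicGrad_ne_zero hd hz
  refine ⟨z, hz, ?_⟩
  set g := conicGrad A z with hgdef
  -- If the multiplier of the distance vanished, the other multiplier would annihilate the range of
  -- the differential of `conicVal A`, which is all of ℂ at a smooth point.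
  have hΛ₀ : Λ₀ ≠ 0 := by
    rintro rfl
    apply hne
    rw [Prod.mk_eq_zero]
    refine ⟨?_, rfl⟩
    ext c
    simp only [zero_smul, add_zero] at hΛ
    rcases hg with h | h
    · have := hΛ ![c / (2 * g 0), 0]
      simp at this
      rwa [mul_div_cancel₀ _ (mul_ne_zero two_ne_zero h)] at this
    · have := hΛ ![0, c / (2 * g 1)]
      simp at this
      rwa [mul_div_cancel₀ _ (mul_ne_zero two_ne_zero h)] at this
  have key : ∀ c : ℂ, ((star (u 0 - z 0) * g 1 - star (u 1 - z 1) * g 0) * c).re = 0 := by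
    intro c
    have h1 := hΛ ![g 1 * c, -(g 0 * c)]
    have h2 : ((2 * g 0) • (ContinuousLinearMap.proj 0 : (Fin 2 → ℂ) →L[ℝ] ℂ) +
        (2 * g 1) • (ContinuousLinearMap.proj 1 : (Fin 2 → ℂ) →L[ℝ] ℂ))
        ![g 1 * c, -(g 0 * c)] = 0 := by
      simp
      ring
    rw [fderiv_sqDist, h2, map_zero, zero_add, smul_eq_mul, mul_eq_zero, or_iff_right hΛ₀,
      mul_eq_zero, or_iff_right (by norm_num), Fin.sum_univ_two, Matrix.cons_val_zero,
      Matrix.cons_val_one] at h1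
    have h3 : (star (u 0 - z 0) * g 1 - star (u 1 - z 1) * g 0) * c =
      star (u 0 - z 0) * (g 1 * c) + star (u 1 - z 1) * -(g 0 * c) := by ring
    rw [h3]
    exact h1
  set e := star (u 0 - z 0) * g 1 - star (u 1 - z 1) * g 0 with he
  have h1 := key (star e)
  rw [Complex.star_def, Complex.mul_conj, Complex.ofReal_re, Complex.normSq_eq_zero] at h1
  simp only [Pi.star_apply, Pi.sub_apply]
  linear_combination he - h1

/-! ### Local constancy of the number of critical points -/

/-- By the inverse function theorem Φ is injective on disjoint neighbourhoods of the points of the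
fiber, and their images are neighbourhoods of y₀. Outside these neighbourhoods, a compact set K
keeps its image away from y₀, so nearby fibers have no further points. The confinement to K is only
needed for y in Z. -/
theorem eventually_encard_fiber {E : Type*} [NormedAddCommGroup E] [NormedSpace ℝ E]
    [CompleteSpace E] {Φ : E → E} (hΦ : Continuous Φ) {y₀ : E} {n : ℕ}
    (hn : {x | Φ x = y₀}.encard = n)
    (hd : ∀ x, Φ x = y₀ → ∃ e : E ≃L[ℝ] E, HasStrictFDerivAt Φ (e : E →L[ℝ] E) x)
    {Z K : Set E} (hK : IsCompact K) (hZ : ∀ᶠ y in 𝓝[Z] y₀, ∀ x, Φ x = y → x ∈ K) :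
    ∀ᶠ y in 𝓝[Z] y₀, {x | Φ x = y}.encard = n := by
  have hfin : {x | Φ x = y₀}.Finite := Set.finite_of_encard_eq_coe hn
  obtain ⟨U, hU, hdisj⟩ := hfin.t2_separation
  have hW : ∀ x, ∃ W : Set E, IsOpen W ∧ W ⊆ U x ∧
      (Φ x = y₀ → x ∈ W ∧ Set.InjOn Φ W ∧ Φ '' W ∈ 𝓝 y₀) := by
    intro x
    by_cases hx : Φ x = y₀
    · obtain ⟨e, he⟩ := hd x hx
      let P := he.toOpenPartialHomeomorph Φ
      have hxP : x ∈ P.source := he.mem_toOpenPartialHomeomorph_source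
      refine ⟨P.source ∩ U x, P.open_source.inter (hU x).2, Set.inter_subset_right,
        fun _ => ⟨⟨hxP, (hU x).1⟩, ?_, ?_⟩⟩
      · exact P.injOn.mono Set.inter_subset_left
      · rw [← hx, ← he.map_nhds_eq_of_equiv]
        exact Filter.image_mem_map ((P.open_source.inter (hU x).2).mem_nhds ⟨hxP, (hU x).1⟩)
    · exact ⟨∅, isOpen_empty, Set.empty_subset _, fun h => absurd h hx⟩
  choose W hWo hWU hWy using hW
  have h1 : ∀ᶠ y in 𝓝[Z] y₀, ∀ x ∈ {x | Φ x = y₀}, y ∈ Φ '' W x := by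
    rw [hfin.eventually_all]
    exact fun x hx => mem_nhdsWithin_of_mem_nhds (hWy x hx).2.2
  have h2 : ∀ᶠ y in 𝓝[Z] y₀, y ∉ Φ '' (K \ ⋃ x ∈ {x | Φ x = y₀}, W x) := by
    refine mem_nhdsWithin_of_mem_nhds ?_
    refine (((hK.diff (isOpen_biUnion fun x _ => hWo x)).image hΦ).isClosed.isOpen_compl).mem_nhds ?_
    rintro ⟨x, ⟨-, hx⟩, hxy⟩
    exact hx (Set.mem_biUnion hxy (hWy x hxy).1)
  filter_upwards [h1, h2, hZ] with y h1 h2 h3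
  choose! s hsW hsy using h1
  have himg : {x | Φ x = y} = s '' {x | Φ x = y₀} := by
    ext x
    constructor
    · intro hx
      have hx' : x ∈ ⋃ x ∈ {x | Φ x = y₀}, W x := by
        by_contra h
        exact h2 ⟨x, ⟨h3 x hx, h⟩, hx⟩
      obtain ⟨x', hx', hxW⟩ := Set.mem_iUnion₂.mp hx'
      refine ⟨x', hx', ?_⟩
      refine (hWy x' hx').2.1 (hsW x' hx') hxW ?_
      rw [hsy x' hx']
      exact hx.symm
    · rintro ⟨x', hx', rfl⟩
      exact hsy x' hx'
  rw [himg, Set.InjOn.encard_image, hn]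
  intro a ha b hb hab
  by_contra hne
  refine Set.disjoint_left.mp (hdisj ha hb hne) (hWU a (hsW a ha)) ?_
  rw [hab]
  exact hWU b (hsW b hb)

/-- The equations of a critical point, with a Lagrange multiplier. -/
def lagrangeMap (A : Matrix (Fin 3) (Fin 3) ℂ) (x : ℂ × ℂ × ℂ) : ℂ × ℂ × ℂ :=
  (conicVal A ![x.1, x.2.1], x.1 + star (x.2.2 * conicGrad A ![x.1, x.2.1] 0),
    x.2.1 + star (x.2.2 * conicGrad A ![x.1, x.2.1] 1))

/-- The gradient does not vanish on the conic, so each critical point determines its multiplier. -/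
theorem encard_lagrangeMap_fiber {A : Matrix (Fin 3) (Fin 3) ℂ} (hd : A.det ≠ 0)
    (u : Fin 2 → ℂ) : {x | lagrangeMap A x = (0, u 0, u 1)}.encard = (critSet A u).encard := by
  have hinj : Set.InjOn (fun x : ℂ × ℂ × ℂ => (![x.1, x.2.1] : Fin 2 → ℂ))
      {x | lagrangeMap A x = (0, u 0, u 1)} := by
    rintro ⟨a, b, l⟩ h ⟨a', b', l'⟩ h' heq
    have e0 : a = a' := congrFun heq 0
    have e1 : b = b' := congrFun heq 1
    subst e0 e1
    simp only [lagrangeMap, Set.mem_ofPred_eq, Prod.mk.injEq] at h h'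
    have h0 := star_injective (add_left_cancel (h.2.1.trans h'.2.1.symm))
    have h1 := star_injective (add_left_cancel (h.2.2.trans h'.2.2.symm))
    rcases conicGrad_ne_zero hd h.1 with hg | hg
    · rw [mul_right_cancel₀ hg h0]
    · rw [mul_right_cancel₀ hg h1]
  rw [← hinj.encard_image]
  congr 1
  ext z
  constructor
  · rintro ⟨⟨a, b, l⟩, h, rfl⟩
    simp only [lagrangeMap, Set.mem_ofPred_eq, Prod.mk.injEq] at h
    refine ⟨h.1, ?_⟩
    simp only [Pi.star_apply, Pi.sub_apply, Matrix.cons_val_zero, Matrix.cons_val_one, ← h.2.1,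
      ← h.2.2, add_sub_cancel_left, star_star]
    ring
  · rintro ⟨h, hn⟩
    have hz : ![z 0, z 1] = z := by
      funext j
      fin_cases j <;> rfl
    simp only [Pi.star_apply, Pi.sub_apply] at hn
    rcases conicGrad_ne_zero hd h with hg | hg
    · refine ⟨(z 0, z 1, star (u 0 - z 0) / conicGrad A z 0), ?_, hz⟩
      simp only [lagrangeMap, Set.mem_ofPred_eq, Prod.mk.injEq, hz]
      have e : star (u 0 - z 0) / conicGrad A z 0 * conicGrad A z 1 = star (u 1 - z 1) := by
        field_simp
        linear_combination -hn
      rw [div_mul_cancel₀ _ hg, e, star_star, star_star]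
      simp [h]
    · refine ⟨(z 0, z 1, star (u 1 - z 1) / conicGrad A z 1), ?_, hz⟩
      simp only [lagrangeMap, Set.mem_ofPred_eq, Prod.mk.injEq, hz]
      have e : star (u 1 - z 1) / conicGrad A z 1 * conicGrad A z 0 = star (u 0 - z 0) := by
        field_simp
        linear_combination hn
      rw [div_mul_cancel₀ _ hg, e, star_star, star_star]
      simp [h]

theorem hasStrictFDerivAt_lagrangeMap {A : Matrix (Fin 3) (Fin 3) ℂ} (hA : A.IsSymm)
    (x : ℂ × ℂ × ℂ) : ∃ L : ℂ × ℂ × ℂ →L[ℝ] ℂ × ℂ × ℂ, HasStrictFDerivAt (lagrangeMap A) L x ∧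
      ∀ t, L t = (2 * (conicGrad A ![x.1, x.2.1] 0 * t.1 + conicGrad A ![x.1, x.2.1] 1 * t.2.1),
        t.1 + star (t.2.2 * conicGrad A ![x.1, x.2.1] 0 + x.2.2 * (A 0 0 * t.1 + A 0 1 * t.2.1)),
        t.2.1 + star (t.2.2 * conicGrad A ![x.1, x.2.1] 1 +
          x.2.2 * (A 0 1 * t.1 + A 1 1 * t.2.1))) := by
  let p0 : ℂ × ℂ × ℂ →L[ℝ] ℂ := ContinuousLinearMap.fst ℝ ℂ (ℂ × ℂ)
  let p1 : ℂ × ℂ × ℂ →L[ℝ] ℂ :=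
    (ContinuousLinearMap.fst ℝ ℂ ℂ).comp (ContinuousLinearMap.snd ℝ ℂ (ℂ × ℂ))
  let p2 : ℂ × ℂ × ℂ →L[ℝ] ℂ :=
    (ContinuousLinearMap.snd ℝ ℂ ℂ).comp (ContinuousLinearMap.snd ℝ ℂ (ℂ × ℂ))
  have h0 : HasStrictFDerivAt (fun x : ℂ × ℂ × ℂ => x.1) p0 x := p0.hasStrictFDerivAt
  have h1 : HasStrictFDerivAt (fun x : ℂ × ℂ × ℂ => x.2.1) p1 x := p1.hasStrictFDerivAt
  have h2 : HasStrictFDerivAt (fun x : ℂ × ℂ × ℂ => x.2.2) p2 x := p2.hasStrictFDerivAt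
  have hv : HasStrictFDerivAt (fun x : ℂ × ℂ × ℂ => conicVal A ![x.1, x.2.1]) _ x :=
    ((hasStrictFDerivAt_conicVal hA ![x.1, x.2.1]).comp x
      ((hasStrictFDerivAt_pi' (Φ := fun x : ℂ × ℂ × ℂ => ![x.1, x.2.1])
        (Φ' := ContinuousLinearMap.pi ![p0, p1])).mpr fun i => by
          fin_cases i
          · exact h0
          · exact h1))
  have g0 : HasStrictFDerivAt (fun x : ℂ × ℂ × ℂ => conicGrad A ![x.1, x.2.1] 0)
      (A 0 0 • p0 + A 0 1 • p1) x := by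
    have := ((h0.const_mul (A 0 0)).add (h1.const_mul (A 0 1))).add_const (A 0 2)
    simpa [conicGrad] using this
  have g1 : HasStrictFDerivAt (fun x : ℂ × ℂ × ℂ => conicGrad A ![x.1, x.2.1] 1)
      (A 0 1 • p0 + A 1 1 • p1) x := by
    have := ((h0.const_mul (A 0 1)).add (h1.const_mul (A 1 1))).add_const (A 1 2)
    simpa [conicGrad, hA.apply 0 1] using this
  refine ⟨_, hv.prodMk ((h0.add (h2.mul g0).star).prodMk (h1.add (h2.mul g1).star)), ?_⟩
  rintro ⟨a, b, c⟩
  simp only [p0, p1, p2, ContinuousLinearMap.prod_apply, add_apply,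
    ContinuousLinearMap.comp_apply, smul_apply, Prod.mk.injEq,
    ContinuousLinearMap.coe_fst', ContinuousLinearMap.coe_snd', ContinuousLinearMap.pi_apply,
    ContinuousLinearMap.proj_apply, Matrix.cons_val_zero, Matrix.cons_val_one, smul_eq_mul]
  refine ⟨by ring, ?_, ?_⟩
  · congr 1
    simp
    ring
  · congr 1
    simp
    ring

/-- `hnd` says that the kernel of the differential has no component along the curve. The multiplier
direction then drops out because the gradient is nonzero, so the differential is invertible. The
bound `R` is available only over targets whose first coordinate is 0, which is why the fibers are
compared inside the range of `j`. -/
theorem mem_openCounts {A : Matrix (Fin 3) (Fin 3) ℂ} (hA : A.IsSymm) (hd : A.det ≠ 0)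
    (u₀ : Fin 2 → ℂ) {n : ℕ} (hn : (critSet A u₀).encard = n)
    (hnd : ∀ a b l : ℂ, lagrangeMap A (a, b, l) = (0, u₀ 0, u₀ 1) → ∀ s t ν : ℂ,
      conicGrad A ![a, b] 0 * s + conicGrad A ![a, b] 1 * t = 0 →
      s + star (ν * conicGrad A ![a, b] 0 + l * (A 0 0 * s + A 0 1 * t)) = 0 →
      t + star (ν * conicGrad A ![a, b] 1 + l * (A 0 1 * s + A 1 1 * t)) = 0 → s = 0 ∧ t = 0)
    (R : ℝ) (hb : ∀ u : Fin 2 → ℂ, ‖u - u₀‖ < 1 → ∀ a b l : ℂ,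
      lagrangeMap A (a, b, l) = (0, u 0, u 1) → ‖a‖ ≤ R ∧ ‖b‖ ≤ R ∧ ‖l‖ ≤ R) :
    n ∈ openCounts A := by
  have hcont : Continuous (lagrangeMap A) := by
    refine continuous_iff_continuousAt.mpr fun x => ?_
    obtain ⟨L, hL, -⟩ := hasStrictFDerivAt_lagrangeMap hA x
    exact hL.hasFDerivAt.continuousAt
  let j : (Fin 2 → ℂ) → ℂ × ℂ × ℂ := fun u => (0, u 0, u 1)
  have hj : Continuous j := by fun_prop
  have hev : ∀ᶠ y in 𝓝[Set.range j] (j u₀), {x | lagrangeMap A x = y}.encard = n := by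
    refine eventually_encard_fiber hcont ?_ ?_ (isCompact_closedBall (0 : ℂ × ℂ × ℂ) R) ?_
    · rw [encard_lagrangeMap_fiber hd, hn]
    · rintro ⟨a, b, l⟩ hx
      obtain ⟨L, hL, hLt⟩ := hasStrictFDerivAt_lagrangeMap hA (a, b, l)
      have hval : conicVal A ![a, b] = 0 := congrArg Prod.fst hx
      have hinj : Function.Injective L := by
        rw [injective_iff_map_eq_zero]
        rintro ⟨s, t, ν⟩ h
        rw [hLt] at h
        simp only [Prod.mk_eq_zero, mul_eq_zero, two_ne_zero, false_or] at h
        obtain ⟨rfl, rfl⟩ := hnd a b l hx s t ν h.1 h.2.1 h.2.2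
        have hg := conicGrad_ne_zero hd hval
        simp only [mul_zero, add_zero, zero_add, star_eq_zero, mul_eq_zero] at h
        simp only [Prod.mk_eq_zero, true_and]
        tauto
      have hsurj : Function.Surjective L :=
        (LinearMap.injective_iff_surjective (f := (L : ℂ × ℂ × ℂ →ₗ[ℝ] ℂ × ℂ × ℂ))).mp hinj
      refine ⟨ContinuousLinearEquiv.ofBijective L (LinearMap.ker_eq_bot.mpr hinj)
        (LinearMap.range_eq_top.mpr hsurj), ?_⟩
      rwa [ContinuousLinearEquiv.coe_ofBijective]
    · have h1 : ∀ᶠ y in 𝓝[Set.range j] (j u₀), dist y (j u₀) < 1 :=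
        mem_nhdsWithin_of_mem_nhds (Metric.ball_mem_nhds _ one_pos)
      filter_upwards [h1, self_mem_nhdsWithin] with y hy hyj
      obtain ⟨u, rfl⟩ := hyj
      rintro ⟨a, b, l⟩ hx
      have hu : ‖u - u₀‖ < 1 := by
        rw [dist_eq_norm] at hy
        rw [pi_norm_lt_iff one_pos]
        intro i
        simp only [j, Prod.mk_sub_mk, Prod.norm_def, max_lt_iff] at hy
        fin_cases i
        · exact hy.2.1
        · exact hy.2.2
      obtain ⟨ha, hb', hl⟩ := hb u hu a b l hx
      rw [mem_closedBall_zero_iff]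
      simp only [Prod.norm_def, max_le_iff]
      exact ⟨ha, hb', hl⟩
  have hev' : ∀ᶠ u in 𝓝 u₀, {x | lagrangeMap A x = j u}.encard = n :=
    Tendsto.eventually (tendsto_nhdsWithin_iff.mpr
      ⟨hj.tendsto u₀, Eventually.of_forall fun u => Set.mem_range_self u⟩) hev
  obtain ⟨U, hU, hUo, hu₀⟩ := eventually_nhds_iff.mp hev'
  refine ⟨U, hUo, ⟨u₀, hu₀⟩, fun u hu => ?_⟩
  rw [← encard_lagrangeMap_fiber hd]
  exact hU u hu

end HermitianDistance
end

open MvPolynomial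
noncomputable section
namespace HermitianDistance

/-! ### Critical points of the normal forms at special points -/

theorem encard_quadruple {α : Type*} {a b c d : α} (hab : a ≠ b) (hac : a ≠ c) (had : a ≠ d)
    (hbc : b ≠ c) (hbd : b ≠ d) (hcd : c ≠ d) : ({a, b, c, d} : Set α).encard = 4 := by
  rw [Set.encard_insert_of_notMem (by simp [hab, hac, had]),
    Set.encard_insert_of_notMem (by simp [hbc, hbd]), Set.encard_pair hcd]
  norm_num

theorem norm_eq_of_add_star_mul_eq_zero {l b c : ℂ} (hb : b ≠ 0) (h : b + star (l * (c * b)) = 0) :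
    ‖l‖ * ‖c‖ = 1 := by
  have h1 := congrArg norm (eq_neg_of_add_eq_zero_left h)
  rw [norm_neg, norm_star, norm_mul, norm_mul] at h1
  have h2 : ‖b‖ ≠ 0 := norm_ne_zero_iff.mpr hb
  field_simp at h1
  linarith

theorem eq_zero_of_add_star_mul_eq_zero {l b c : ℂ} (h : b + star (l * (c * b)) = 0)
    (hl : ‖l‖ * ‖c‖ ≠ 1) : b = 0 := by
  by_contra hb
  exact hl (norm_eq_of_add_star_mul_eq_zero hb h)

section Ellipse

variable {k : ℝ}

theorem isSymm_ellipseMat (k : ℝ) : (ellipseMat k).IsSymm := isSymm_symMat _ _ _ _ _ _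

theorem det_ellipseMat (hk : k ≠ 0) : (ellipseMat k).det ≠ 0 := by
  rw [ellipseMat, det_symMat]
  simpa using hk

theorem conicGrad_ellipseMat_zero (k : ℝ) (z : Fin 2 → ℂ) : conicGrad (ellipseMat k) z 0 = z 0 := by
  simp [conicGrad, ellipseMat, symMat]

theorem conicGrad_ellipseMat_one (k : ℝ) (z : Fin 2 → ℂ) :
    conicGrad (ellipseMat k) z 1 = k * z 1 := by
  simp [conicGrad, ellipseMat, symMat]

theorem conicVal_ellipseMat (k : ℝ) (z : Fin 2 → ℂ) :
    conicVal (ellipseMat k) z = z 0 ^ 2 + k * z 1 ^ 2 - 1 := by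
  rw [conicVal_eq, conicGrad_ellipseMat_zero, conicGrad_ellipseMat_one]
  simp [conicGrad, ellipseMat, symMat]
  ring

theorem lagrangeMap_ellipseMat_iff {a b l : ℂ} {u₀ u₁ : ℂ} :
    lagrangeMap (ellipseMat k) (a, b, l) = (0, u₀, u₁) ↔
      a ^ 2 + k * b ^ 2 = 1 ∧ a + star (l * a) = u₀ ∧ b + star (l * (k * b)) = u₁ := by
  simp only [lagrangeMap, conicVal_ellipseMat, conicGrad_ellipseMat_zero, conicGrad_ellipseMat_one,
    Matrix.cons_val_zero, Matrix.cons_val_one, Prod.mk.injEq, sub_eq_zero]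

/-- Pairing the critical equations with the point gives l = (a ū₀ + b ū₁) - (|a|² + |b|²). If |l| ≤
2, this bounds a and b. If |l| > 2, the separate equations (|l| - 1)|a| ≤ M and (|l| - 1)|b| ≤ M do,
the second using k ≥ 1. The bound on l then follows from the same identity. -/
theorem bounded_lagrangeMap_ellipseMat (hk : 1 ≤ k) {a b l : ℂ} {u₀ u₁ : ℂ} {M : ℝ}
    (h : lagrangeMap (ellipseMat k) (a, b, l) = (0, u₀, u₁)) (h0 : ‖u₀‖ ≤ M) (h1 : ‖u₁‖ ≤ M) :
    ‖a‖ ≤ 4 * M ^ 2 + 2 * M + 4 ∧ ‖b‖ ≤ 4 * M ^ 2 + 2 * M + 4 ∧ ‖l‖ ≤ 4 * M ^ 2 + 2 * M + 4 := by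
  obtain ⟨e1, e2, e3⟩ := lagrangeMap_ellipseMat_iff.mp h
  have hM : 0 ≤ M := (norm_nonneg _).trans h0
  have ha := norm_nonneg a
  have hb := norm_nonneg b
  have hsa : l * a = star (u₀ - a) := by rw [← e2, add_sub_cancel_left, star_star]
  have hsb : l * (k * b) = star (u₁ - b) := by rw [← e3, add_sub_cancel_left, star_star]
  have hl : l = (a * star u₀ + b * star u₁) - (a * star a + b * star b) := by
    rw [star_sub] at hsa hsb
    linear_combination -l * e1 + a * hsa + b * hsb
  have hl' : (a * star a + b * star b) = ((‖a‖ ^ 2 + ‖b‖ ^ 2 : ℝ) : ℂ) := by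
    rw [Complex.star_def, Complex.mul_conj, Complex.mul_conj, Complex.normSq_eq_norm_sq,
      Complex.normSq_eq_norm_sq]
    push_cast
    rfl
  have hn : ‖a * star u₀ + b * star u₁‖ ≤ M * (‖a‖ + ‖b‖) := by
    refine (norm_add_le _ _).trans ?_
    rw [norm_mul, norm_mul, norm_star, norm_star]
    nlinarith
  have hn2 : ‖((‖a‖ ^ 2 + ‖b‖ ^ 2 : ℝ) : ℂ)‖ = ‖a‖ ^ 2 + ‖b‖ ^ 2 := by
    rw [Complex.norm_real, Real.norm_of_nonneg (by positivity)]
  rw [hl'] at hl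
  have hle : ‖l‖ ≤ M * (‖a‖ + ‖b‖) + (‖a‖ ^ 2 + ‖b‖ ^ 2) := by
    rw [hl]
    refine (norm_sub_le _ _).trans ?_
    rw [hn2]
    linarith
  have hge : ‖a‖ ^ 2 + ‖b‖ ^ 2 ≤ ‖l‖ + M * (‖a‖ + ‖b‖) := by
    have : ((‖a‖ ^ 2 + ‖b‖ ^ 2 : ℝ) : ℂ) = (a * star u₀ + b * star u₁) - l := by
      rw [hl]; ring
    rw [← hn2, this]
    refine (norm_sub_le _ _).trans ?_
    linarith
  have ta : ‖l‖ * ‖a‖ ≤ M + ‖a‖ := by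
    rw [← norm_mul, hsa, norm_star]
    exact (norm_sub_le _ _).trans (by linarith)
  have tb : ‖l‖ * ‖b‖ ≤ M + ‖b‖ := by
    have : ‖l‖ * (k * ‖b‖) ≤ M + ‖b‖ := by
      have hkn : k * ‖b‖ = ‖(k : ℂ) * b‖ := by
        rw [norm_mul, Complex.norm_real, Real.norm_of_nonneg (by linarith)]
      rw [hkn, ← norm_mul, hsb, norm_star]
      exact (norm_sub_le _ _).trans (by linarith)
    have h2 : ‖l‖ * ‖b‖ ≤ ‖l‖ * (k * ‖b‖) :=
      mul_le_mul_of_nonneg_left (by nlinarith) (norm_nonneg _)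
    linarith
  rcases le_or_gt ‖l‖ 2 with h2 | h2
  · have key : ∀ x y : ℝ, 0 ≤ x → 0 ≤ y → x ^ 2 + y ^ 2 ≤ 2 + M * (x + y) → x ≤ 2 * M + 4 := by
      intro x y hx hy hxy
      by_contra! hlt
      nlinarith [sq_nonneg (y - M / 2), mul_pos (sub_pos.mpr hlt) (sub_pos.mpr hlt)]
    have ka := key _ _ ha hb (by linarith)
    have kb := key _ _ hb ha (by linarith)
    refine ⟨by nlinarith, by nlinarith, by nlinarith⟩
  · have ka : ‖a‖ ≤ M := by nlinarith
    have kb : ‖b‖ ≤ M := by nlinarith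
    refine ⟨by nlinarith, by nlinarith, by nlinarith⟩

theorem mem_openCounts_ellipseMat (hk : 1 ≤ k) (u₀ u₁ : ℂ) {n : ℕ} (S : Set (ℂ × ℂ × ℂ))
    (hS : ∀ a b l, lagrangeMap (ellipseMat k) (a, b, l) = (0, u₀, u₁) ↔ (a, b, l) ∈ S)
    (hn : S.encard = n)
    (hnd : ∀ a b l : ℂ, (a, b, l) ∈ S → ∀ s t ν : ℂ, a * s + k * b * t = 0 →
      s + star (ν * a + l * s) = 0 → t + star (ν * (k * b) + l * (k * t)) = 0 → s = 0 ∧ t = 0) :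
    n ∈ openCounts (ellipseMat k) := by
  have hk0 : k ≠ 0 := by linarith
  refine mem_openCounts (isSymm_ellipseMat k) (det_ellipseMat hk0) ![u₀, u₁] ?_ ?_
    (4 * (‖(![u₀, u₁] : Fin 2 → ℂ)‖ + 1) ^ 2 + 2 * (‖(![u₀, u₁] : Fin 2 → ℂ)‖ + 1) + 4) ?_
  · rw [← encard_lagrangeMap_fiber (det_ellipseMat hk0), ← hn]
    congr 1
    ext ⟨a, b, l⟩
    exact hS a b l
  · intro a b l h s t ν
    simp only [conicGrad_ellipseMat_zero, conicGrad_ellipseMat_one, Matrix.cons_val_zero,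
      Matrix.cons_val_one]
    have h00 : ellipseMat k 0 0 = 1 := rfl
    have h01 : ellipseMat k 0 1 = 0 := rfl
    have h11 : ellipseMat k 1 1 = k := rfl
    rw [h00, h01, h11]
    simp only [one_mul, zero_mul, add_zero, zero_add]
    exact hnd a b l ((hS a b l).mp h) s t ν
  · intro u hu a b l h
    have hu' : ∀ j, ‖u j‖ ≤ ‖(![u₀, u₁] : Fin 2 → ℂ)‖ + 1 := by
      intro j
      refine (norm_le_pi_norm u j).trans ?_
      have := norm_add_le (u - ![u₀, u₁]) ![u₀, u₁]
      rw [sub_add_cancel] at this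
      linarith
    exact bounded_lagrangeMap_ellipseMat hk h (hu' 0) (hu' 1)

theorem sq_eq_one_cases {a : ℂ} (h : a ^ 2 = 1) : a = 1 ∨ a = -1 := sq_eq_one_iff.mp h

/-- At a point of the first axis, a critical point off that axis has a real multiplier. -/
theorem ellipse_multiplier {κ x : ℝ} (hκ : 0 < κ) (hκ1 : κ ≤ 1) (hx : 0 < x)
    (hx2 : 1 - κ ^ 2 < x ^ 2) {a l : ℂ} {s : ℝ} (hl : ‖l‖ = κ)
    (h1 : a + star (l * a) = x) (h2 : l * (1 - a ^ 2) = -s) :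
    ∃ r : ℝ, l = r ∧ r ^ 2 = κ ^ 2 := by
  have hll : l * star l = (κ : ℂ) ^ 2 := by
    rw [Complex.star_def, Complex.mul_conj, Complex.normSq_eq_norm_sq, hl]
    push_cast
    rfl
  have h1' : star a + l * a = x := by
    have := congrArg star h1
    simpa using this
  rw [star_mul'] at h1
  have hE : a * (1 - (κ : ℂ) ^ 2) = x * (1 - star l) := by
    linear_combination h1 - star l * h1' + a * hll
  have him : l.im = 0 := by
    rcases eq_or_lt_of_le hκ1 with rfl | hlt
    · have : star l = 1 := by
        have hx' : (x : ℂ) ≠ 0 := by exact_mod_cast hx.ne'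
        have : (x : ℂ) * (1 - star l) = 0 := by rw [← hE]; simp
        rcases mul_eq_zero.mp this with h | h
        · exact absurd h hx'
        · linear_combination -h
      have := congrArg Complex.im this
      simpa using this
    · have h3 : l * (1 - (κ : ℂ) ^ 2) ^ 2 - x ^ 2 * (l - 2 * κ ^ 2 + κ ^ 2 * star l) =
          -s * (1 - κ ^ 2) ^ 2 := by
        linear_combination (1 - (κ : ℂ) ^ 2) ^ 2 * h2 +
          l * (a * (1 - (κ : ℂ) ^ 2) + x * (1 - star l)) * hE +
          x ^ 2 * (star l - 2) * hll
      have h4 := congrArg Complex.im h3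
      have e1 : l * (1 - (κ : ℂ) ^ 2) ^ 2 - x ^ 2 * (l - 2 * κ ^ 2 + κ ^ 2 * star l) =
          (((1 - κ ^ 2) ^ 2 - x ^ 2 : ℝ) : ℂ) * l - ((x ^ 2 * κ ^ 2 : ℝ) : ℂ) * star l +
          ((2 * x ^ 2 * κ ^ 2 : ℝ) : ℂ) := by
        push_cast; ring
      have e2 : -s * (1 - (κ : ℂ) ^ 2) ^ 2 = ((-s * (1 - κ ^ 2) ^ 2 : ℝ) : ℂ) := by push_cast; rfl
      rw [e1, e2, Complex.add_im, Complex.sub_im, Complex.im_ofReal_mul, Complex.im_ofReal_mul,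
        Complex.ofReal_im, Complex.ofReal_im, Complex.star_def, Complex.conj_im] at h4
      have h5 : l.im * ((1 - κ ^ 2) * (1 - κ ^ 2 - x ^ 2)) = 0 := by linear_combination h4
      have hκ2 : κ ^ 2 < 1 := by nlinarith
      refine (mul_eq_zero.mp h5).resolve_right (mul_ne_zero (by linarith) (by linarith))
  refine ⟨l.re, Complex.ext rfl (by simpa using him), ?_⟩
  rw [← hl, ← Complex.normSq_eq_norm_sq, Complex.normSq_apply, him]
  ring

theorem mul_one_sub_sq_of_ellipse {a b l : ℂ} (e1 : a ^ 2 + k * b ^ 2 = 1)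
    (e3 : b + star (l * (k * b)) = 0) : l * (1 - a ^ 2) = -(‖b‖ ^ 2 : ℝ) := by
  have h : star b + l * (k * b) = 0 := by
    have := congrArg star e3
    simpa using this
  have hb : b * star b = ((‖b‖ ^ 2 : ℝ) : ℂ) := by
    rw [Complex.star_def, Complex.mul_conj, Complex.normSq_eq_norm_sq]
  linear_combination -l * e1 + b * h - hb

/-- The base point (x, 0) has x² = 1 + κ² with κ = 1/k. A critical point off the axis would have a
real multiplier ±κ, which requires x² > (1 + κ)² or x² < (1 - κ)². The chosen value lies strictly
between, so only the vertices (±1, 0) remain, with multipliers of modulus different from κ. -/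
theorem two_mem_openCounts_ellipseMat (hk : 1 ≤ k) : 2 ∈ openCounts (ellipseMat k) := by
  set κ := 1 / k with hκ
  have hk0 : 0 < k := by linarith
  have hκ0 : 0 < κ := by positivity
  have hκ1 : κ ≤ 1 := by rw [hκ, div_le_one hk0]; exact hk
  have hkκ : κ * k = 1 := by rw [hκ]; field_simp
  set x := Real.sqrt (1 + κ ^ 2) with hx
  have hx2 : x ^ 2 = 1 + κ ^ 2 := Real.sq_sqrt (by positivity)
  have hx1 : 1 < x := by
    rw [hx, Real.lt_sqrt zero_le_one]
    nlinarith
  refine mem_openCounts_ellipseMat hk x 0 {(1, 0, (x : ℂ) - 1), (-1, 0, -((x : ℂ) + 1))} ?_ ?_ ?_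
  · intro a b l
    rw [lagrangeMap_ellipseMat_iff]
    simp only [Set.mem_insert_iff, Set.mem_singleton_iff, Prod.mk.injEq]
    constructor
    · rintro ⟨e1, e2, e3⟩
      by_cases hb : b = 0
      · subst hb
        have ha : a = 1 ∨ a = -1 := sq_eq_one_cases (by simpa using e1)
        have e2' := congrArg star e2
        rw [star_add, star_star, Complex.star_def, Complex.conj_ofReal] at e2'
        rcases ha with rfl | rfl
        · refine Or.inl ⟨rfl, rfl, ?_⟩
          simp at e2'
          linear_combination e2'
        · refine Or.inr ⟨rfl, rfl, ?_⟩
          simp at e2'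
          linear_combination -e2'
      · exfalso
        have hl : ‖l‖ = κ := by
          have := norm_eq_of_add_star_mul_eq_zero hb e3
          rw [Complex.norm_real, Real.norm_of_nonneg hk0.le] at this
          rw [hκ, eq_div_iff hk0.ne', this]
        have h2 := mul_one_sub_sq_of_ellipse e1 e3
        obtain ⟨r, rfl, hr⟩ := ellipse_multiplier hκ0 hκ1 (by linarith) (by nlinarith) hl e2 h2
        have hs : 0 < ‖b‖ ^ 2 := by positivity
        have r0 : r ≠ 0 := by rintro rfl; nlinarith
        have c1 := congrArg Complex.re e2
        have c2 := congrArg Complex.re h2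
        have c3 := congrArg Complex.im h2
        simp [sq] at c1 c2 c3
        have hane : a.re ≠ 0 := by rintro h; rw [h] at c1; simp at c1; linarith
        have him : a.im = 0 := by
          rcases c3 with h | h
          · exact absurd h r0
          · have : a.re * a.im = 0 := by linarith
            exact (mul_eq_zero.mp this).resolve_left hane
        rw [him] at c2
        have hxa : x ^ 2 = (1 + r) ^ 2 * a.re ^ 2 := by rw [← c1]; ring
        have c2' : r * (1 - a.re ^ 2) < 0 := by nlinarith
        rcases lt_or_gt_of_ne r0 with h | h
        · have : a.re ^ 2 < 1 := by nlinarith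
          nlinarith [mul_nonneg (sq_nonneg (1 + r)) (sub_pos.mpr this).le]
        · have : 1 < a.re ^ 2 := by nlinarith
          nlinarith [mul_nonneg (sq_nonneg (1 + r)) (sub_pos.mpr this).le]
    · rintro (⟨rfl, rfl, rfl⟩ | ⟨rfl, rfl, rfl⟩)
      · simp
      · simp
  · rw [Set.encard_pair]
    · rfl
    · intro h
      have := congrArg (fun x => x.1.re) h
      norm_num at this
  · have main : ∀ c l : ℂ, c ≠ 0 → ‖l‖ ≠ κ → ∀ s t ν : ℂ, c * s + k * 0 * t = 0 →
        t + star (ν * (k * 0) + l * (k * t)) = 0 → s = 0 ∧ t = 0 := by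
      intro c l hc hl s t ν h1 h3
      refine ⟨by simpa [hc] using h1, eq_zero_of_add_star_mul_eq_zero (c := k) (l := l)
        (by simpa using h3) ?_⟩
      rw [Complex.norm_real, Real.norm_of_nonneg hk0.le]
      intro h
      exact hl (by rw [hκ, eq_div_iff hk0.ne', h])
    intro a b l h s t ν h1 _ h3
    simp only [Set.mem_insert_iff, Set.mem_singleton_iff, Prod.mk.injEq] at h
    rcases h with ⟨rfl, rfl, rfl⟩ | ⟨rfl, rfl, rfl⟩
    · refine main 1 _ one_ne_zero ?_ s t ν h1 h3
      have : (x : ℂ) - 1 = ((x - 1 : ℝ) : ℂ) := by push_cast; rfl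
      rw [this, Complex.norm_real, Real.norm_of_nonneg (by linarith)]
      intro h
      have : x = 1 + κ := by linarith
      rw [this] at hx2
      nlinarith
    · refine main (-1) _ (by simp) ?_ s t ν h1 h3
      have : -((x : ℂ) + 1) = ((-(x + 1) : ℝ) : ℂ) := by push_cast; rfl
      rw [this, Complex.norm_real, norm_neg, Real.norm_of_nonneg (by linarith)]
      linarith

/-- At u = 0 a critical point with both coordinates nonzero would have a multiplier of modulus 1 and
of modulus 1/k. For k > 1 this leaves the four vertices on the axes. -/
theorem four_mem_openCounts_ellipseMat (hk : 1 < k) : 4 ∈ openCounts (ellipseMat k) := by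
  have hk0 : 0 < k := by linarith
  set ρ := 1 / Real.sqrt k with hρ
  have hs : 0 < Real.sqrt k := Real.sqrt_pos.mpr hk0
  have hρ0 : 0 < ρ := by positivity
  have hρ2 : k * ρ ^ 2 = 1 := by rw [hρ, div_pow, Real.sq_sqrt hk0.le]; field_simp
  have hρ2' : (k : ℂ) * (ρ : ℂ) ^ 2 = 1 := by exact_mod_cast hρ2
  have hρc : (ρ : ℂ) ≠ 0 := by exact_mod_cast hρ0.ne'
  have hkc : (k : ℂ) ≠ 0 := by exact_mod_cast hk0.ne'
  refine mem_openCounts_ellipseMat hk.le 0 0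
    {(1, 0, -1), (-1, 0, -1), (0, (ρ : ℂ), -1 / (k : ℂ)), (0, -(ρ : ℂ), -1 / (k : ℂ))} ?_ ?_ ?_
  · intro a b l
    rw [lagrangeMap_ellipseMat_iff]
    simp only [Set.mem_insert_iff, Set.mem_singleton_iff, Prod.mk.injEq]
    constructor
    · rintro ⟨e1, e2, e3⟩
      by_cases ha : a = 0
      · subst ha
        have hb : b = ρ ∨ b = -ρ := by
          refine sq_eq_sq_iff_eq_or_eq_neg.mp (mul_left_cancel₀ hkc ?_)
          rw [hρ2']
          simpa using e1
        have hl : l = -1 / k := by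
          rw [eq_div_iff hkc]
          have e3' := congrArg star e3
          rw [star_add, star_star] at e3'
          rcases hb with rfl | rfl
          · simp at e3'
            refine mul_right_cancel₀ hρc ?_
            linear_combination e3'
          · simp at e3'
            refine mul_right_cancel₀ hρc ?_
            linear_combination -e3'
        rcases hb with rfl | rfl <;> simp [hl]
      · have hl1 : ‖l‖ = 1 := by
          have := norm_eq_of_add_star_mul_eq_zero (c := 1) ha (by simpa using e2)
          simpa using this
        by_cases hb : b = 0
        · subst hb
          have ha : a = 1 ∨ a = -1 := sq_eq_one_cases (by simpa using e1)
          have e2' := congrArg star e2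
          rw [star_add, star_star] at e2'
          rcases ha with rfl | rfl
          · simp at e2'
            refine Or.inl ⟨rfl, rfl, ?_⟩
            linear_combination e2'
          · simp at e2'
            refine Or.inr (Or.inl ⟨rfl, rfl, ?_⟩)
            linear_combination -e2'
        · exfalso
          have := norm_eq_of_add_star_mul_eq_zero hb e3
          rw [hl1, Complex.norm_real, Real.norm_of_nonneg hk0.le] at this
          linarith
    · rintro (⟨rfl, rfl, rfl⟩ | ⟨rfl, rfl, rfl⟩ | ⟨rfl, rfl, rfl⟩ | ⟨rfl, rfl, rfl⟩)
      · simp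
      · simp
      · simp [hρ2']
        field_simp
        ring
      · simp [hρ2']
        field_simp
        ring
  · rw [encard_quadruple] <;> simp [hρc, hρc.symm]
    · norm_num
    · exact fun h => hρc (self_eq_neg.mp h)
  · intro a b l h s t ν h1 h2 h3
    simp only [Set.mem_insert_iff, Set.mem_singleton_iff, Prod.mk.injEq] at h
    have m1 : ‖(-1 : ℂ)‖ * ‖(k : ℂ)‖ ≠ 1 := by
      rw [norm_neg, norm_one, Complex.norm_real, Real.norm_of_nonneg hk0.le]
      linarith
    have m2 : ‖(-1 / (k : ℂ) : ℂ)‖ * ‖(1 : ℂ)‖ ≠ 1 := by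
      rw [norm_div, norm_neg, norm_one, Complex.norm_real, Real.norm_of_nonneg hk0.le, mul_one]
      rw [Ne, div_eq_iff hk0.ne']
      linarith
    rcases h with ⟨rfl, rfl, rfl⟩ | ⟨rfl, rfl, rfl⟩ | ⟨rfl, rfl, rfl⟩ | ⟨rfl, rfl, rfl⟩
    · exact ⟨by simpa using h1, eq_zero_of_add_star_mul_eq_zero (by simpa using h3) m1⟩
    · exact ⟨by simpa using h1, eq_zero_of_add_star_mul_eq_zero (by simpa using h3) m1⟩
    · exact ⟨eq_zero_of_add_star_mul_eq_zero (by simpa using h2) m2,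
        by simpa [hkc, hρc] using h1⟩
    · exact ⟨eq_zero_of_add_star_mul_eq_zero (by simpa using h2) m2,
        by simpa [hkc, hρc] using h1⟩

/-- The circle has open sets with four critical points. -/
theorem four_mem_openCounts_ellipseMat_one : 4 ∈ openCounts (ellipseMat 1) := by
  set σ := Real.sqrt 3 with hσ
  have hσ0 : 0 < σ := Real.sqrt_pos.mpr (by norm_num)
  have hσ2 : σ ^ 2 = 3 := Real.sq_sqrt (by norm_num)
  have hσ2' : (σ : ℂ) ^ 2 = 3 := by exact_mod_cast hσ2
  have hσc : (σ : ℂ) ≠ 0 := by exact_mod_cast hσ0.ne'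
  have hI := Complex.I_sq
  have hI0 := Complex.I_ne_zero
  -- The centre is useless here, since all real points of the circle are critical for it. From (4,
  -- 0), an off-axis multiplier must be 1, so the first coordinate is 4/2 = 2 and the second is
  -- ±i√3.
  refine mem_openCounts_ellipseMat le_rfl (4 : ℝ) 0
    {(1, 0, 3), (-1, 0, -5), (2, σ * Complex.I, 1), (2, -(σ * Complex.I), 1)} ?_ ?_ ?_
  · intro a b l
    rw [lagrangeMap_ellipseMat_iff]
    simp only [Set.mem_insert_iff, Set.mem_singleton_iff, Prod.mk.injEq]
    constructor
    · rintro ⟨e1, e2, e3⟩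
      by_cases hb : b = 0
      · subst hb
        have ha : a = 1 ∨ a = -1 := sq_eq_one_cases (by simpa using e1)
        have e2' := congrArg star e2
        rw [star_add, star_star, Complex.star_def, Complex.conj_ofReal] at e2'
        rcases ha with rfl | rfl
        · refine Or.inl ⟨rfl, rfl, ?_⟩
          simp at e2'
          linear_combination e2'
        · refine Or.inr (Or.inl ⟨rfl, rfl, ?_⟩)
          simp at e2'
          linear_combination -e2'
      · have hl : ‖l‖ = 1 := by
          have := norm_eq_of_add_star_mul_eq_zero hb e3
          simpa using this
        have h2 := mul_one_sub_sq_of_ellipse e1 e3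
        obtain ⟨r, rfl, hr⟩ := ellipse_multiplier one_pos le_rfl (by norm_num) (by norm_num) hl e2 h2
        have c1 := congrArg Complex.re e2
        have c2 := congrArg Complex.im e1
        have c3 := congrArg Complex.re e1
        have c4 := congrArg Complex.re e3
        have hr1 : r = 1 := by
          rcases sq_eq_sq_iff_eq_or_eq_neg.mp hr with h | h
          · exact h
          · rw [h] at c1
            simp at c1
        subst hr1
        simp [sq] at c1 c2 c3 c4
        have h1 : a.re = 2 := by linarith
        have h3 : b.re = 0 := by linarith
        rw [h1, h3] at c2
        have h4 : a.im = 0 := by linarith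
        rw [h1, h3, h4] at c3
        have h5 : b.im = σ ∨ b.im = -σ := sq_eq_sq_iff_eq_or_eq_neg.mp (by linarith)
        have ha : a = 2 := Complex.ext h1 h4
        rcases h5 with h5 | h5
        · refine Or.inr (Or.inr (Or.inl ⟨ha, Complex.ext ?_ ?_, by simp⟩)) <;> simp [h3, h5]
        · refine Or.inr (Or.inr (Or.inr ⟨ha, Complex.ext ?_ ?_, by simp⟩)) <;> simp [h3, h5]
    · rintro (⟨rfl, rfl, rfl⟩ | ⟨rfl, rfl, rfl⟩ | ⟨rfl, rfl, rfl⟩ | ⟨rfl, rfl, rfl⟩)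
      · simp; norm_num
      · simp; norm_num
      · simp [mul_pow, hσ2']; norm_num
      · simp [mul_pow, hσ2']; norm_num
  · rw [encard_quadruple] <;> simp [hσc]
    · norm_num
    · exact fun h => mul_ne_zero hσc hI0 (self_eq_neg.mp h)
  · intro a b l h s t ν h1 h2 h3
    simp only [Set.mem_insert_iff, Set.mem_singleton_iff, Prod.mk.injEq] at h
    have main : ∀ τ : ℝ, τ ≠ 0 → b = τ * Complex.I → a = 2 → l = 1 → s = 0 ∧ t = 0 := by
      rintro τ hτ rfl rfl rfl
      have a1 := congrArg Complex.re h1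
      have a2 := congrArg Complex.im h1
      have b1 := congrArg Complex.re h2
      have b2 := congrArg Complex.im h2
      have d1 := congrArg Complex.re h3
      have d2 := congrArg Complex.im h3
      simp at a1 a2 b1 b2 d1 d2
      have n0 : ν.im = 0 := by linarith
      have n1 : ν.re = 0 := d2.resolve_right hτ
      rw [n0] at d1
      rw [n1] at b1
      have s1 : s.re = 0 := by linarith
      have t1 : t.re = 0 := by linarith
      rw [t1] at a2
      rw [s1] at a1
      have s2 : s.im = 0 := by linarith
      have t2 : t.im = 0 := by
        have : τ * t.im = 0 := by linarith
        exact (mul_eq_zero.mp this).resolve_left hτ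
      exact ⟨Complex.ext s1 s2, Complex.ext t1 t2⟩
    rcases h with ⟨rfl, rfl, rfl⟩ | ⟨rfl, rfl, rfl⟩ | ⟨rfl, hb, rfl⟩ | ⟨rfl, hb, rfl⟩
    · exact ⟨by simpa using h1, eq_zero_of_add_star_mul_eq_zero (l := 3) (c := 1)
        (by simpa using h3) (by norm_num)⟩
    · exact ⟨by simpa using h1, eq_zero_of_add_star_mul_eq_zero (l := (-5)) (c := 1)
        (by simpa using h3) (by norm_num)⟩
    · exact main σ hσ0.ne' hb rfl rfl
    · exact main (-σ) (neg_ne_zero.mpr hσ0.ne') (by rw [hb]; push_cast; ring) rfl rfl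

end Ellipse

section Parabola

theorem isSymm_parabolaMat : parabolaMat.IsSymm := isSymm_symMat _ _ _ _ _ _

theorem det_parabolaMat : parabolaMat.det ≠ 0 := by
  rw [parabolaMat, det_symMat]
  simp

theorem conicGrad_parabolaMat_zero (z : Fin 2 → ℂ) : conicGrad parabolaMat z 0 = z 0 := by
  simp [conicGrad, parabolaMat, symMat]

theorem conicGrad_parabolaMat_one (z : Fin 2 → ℂ) : conicGrad parabolaMat z 1 = -1 := by
  simp [conicGrad, parabolaMat, symMat]

theorem conicVal_parabolaMat (z : Fin 2 → ℂ) : conicVal parabolaMat z = z 0 ^ 2 - 2 * z 1 := by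
  rw [conicVal_eq, conicGrad_parabolaMat_zero, conicGrad_parabolaMat_one]
  simp [conicGrad, parabolaMat, symMat]
  ring

theorem lagrangeMap_parabolaMat_iff {a b l : ℂ} {u₀ u₁ : ℂ} :
    lagrangeMap parabolaMat (a, b, l) = (0, u₀, u₁) ↔
      a ^ 2 = 2 * b ∧ a + star (l * a) = u₀ ∧ b - star l = u₁ := by
  simp only [lagrangeMap, conicVal_parabolaMat, conicGrad_parabolaMat_zero,
    conicGrad_parabolaMat_one, Matrix.cons_val_zero, Matrix.cons_val_one, Prod.mk.injEq, sub_eq_zero,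
    mul_neg, mul_one, star_neg, ← sub_eq_add_neg]

/-- Eliminating b and l gives (2 + |a|²) a = 2 (u₀ + ā u₁), whose left side grows cubically in |a|
while the right side grows linearly. -/
theorem bounded_lagrangeMap_parabolaMat {a b l : ℂ} {u₀ u₁ : ℂ} {M : ℝ}
    (h : lagrangeMap parabolaMat (a, b, l) = (0, u₀, u₁)) (h0 : ‖u₀‖ ≤ M) (h1 : ‖u₁‖ ≤ M) :
    ‖a‖ ≤ (2 * M + 2) ^ 2 + M ∧ ‖b‖ ≤ (2 * M + 2) ^ 2 + M ∧ ‖l‖ ≤ (2 * M + 2) ^ 2 + M := by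
  obtain ⟨e1, e2, e3⟩ := lagrangeMap_parabolaMat_iff.mp h
  have hM : 0 ≤ M := (norm_nonneg _).trans h0
  have ha := norm_nonneg a
  have hs : star l = b - u₁ := by linear_combination -e3
  rw [star_mul', hs] at e2
  have e2' : a * ((2 + ‖a‖ ^ 2 : ℝ) : ℂ) = 2 * (u₀ + star a * u₁) := by
    have haa : a * star a = (‖a‖ : ℂ) ^ 2 := by
      rw [Complex.star_def, Complex.mul_conj, Complex.normSq_eq_norm_sq]
      push_cast
      rfl
    push_cast
    rw [← haa]
    linear_combination 2 * e2 + star a * e1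
  have hn := congrArg norm e2'
  rw [norm_mul, Complex.norm_real, Real.norm_of_nonneg (by positivity), norm_mul,
    Complex.norm_ofNat] at hn
  have hn2 : ‖u₀ + star a * u₁‖ ≤ M + ‖a‖ * M := by
    refine (norm_add_le _ _).trans (add_le_add h0 ?_)
    rw [norm_mul, norm_star]
    exact mul_le_mul_of_nonneg_left h1 ha
  have hab : ‖a‖ ≤ 2 * M + 2 := by
    by_contra! hlt
    nlinarith [mul_pos (sub_pos.mpr hlt) (sub_pos.mpr hlt)]
  have hb : 2 * ‖b‖ = ‖a‖ ^ 2 := by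
    have := congrArg norm e1
    rw [norm_pow, norm_mul, Complex.norm_ofNat] at this
    linarith
  have hl : ‖l‖ ≤ ‖b‖ + M := by
    rw [← norm_star, hs]
    exact (norm_sub_le _ _).trans (by linarith)
  refine ⟨by nlinarith, by nlinarith, by nlinarith⟩

theorem mem_openCounts_parabolaMat (u₀ u₁ : ℂ) {n : ℕ} (S : Set (ℂ × ℂ × ℂ))
    (hS : ∀ a b l, lagrangeMap parabolaMat (a, b, l) = (0, u₀, u₁) ↔ (a, b, l) ∈ S)
    (hn : S.encard = n)
    (hnd : ∀ a b l : ℂ, (a, b, l) ∈ S → ∀ s ν : ℂ,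
      s + star (ν * a + l * s) = 0 → a * s = star ν → s = 0) :
    n ∈ openCounts parabolaMat := by
  refine mem_openCounts isSymm_parabolaMat det_parabolaMat ![u₀, u₁] ?_ ?_
    ((2 * (‖(![u₀, u₁] : Fin 2 → ℂ)‖ + 1) + 2) ^ 2 + (‖(![u₀, u₁] : Fin 2 → ℂ)‖ + 1)) ?_
  · rw [← encard_lagrangeMap_fiber det_parabolaMat, ← hn]
    congr 1
    ext ⟨a, b, l⟩
    exact hS a b l
  · intro a b l h s t ν
    simp only [conicGrad_parabolaMat_zero, conicGrad_parabolaMat_one, Matrix.cons_val_zero]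
    have h00 : parabolaMat 0 0 = 1 := rfl
    have h01 : parabolaMat 0 1 = 0 := rfl
    have h11 : parabolaMat 1 1 = 0 := rfl
    rw [h00, h01, h11]
    simp only [one_mul, zero_mul, add_zero, mul_zero, mul_neg, mul_one, star_neg]
    intro e1 e2 e3
    have hs : s = 0 := by
      refine hnd a b l ((hS a b l).mp h) s ν e2 ?_
      linear_combination e1 + e3
    subst hs
    exact ⟨rfl, by simpa using e1⟩
  · intro u hu a b l h
    have hu' : ∀ j, ‖u j‖ ≤ ‖(![u₀, u₁] : Fin 2 → ℂ)‖ + 1 := by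
      intro j
      refine (norm_le_pi_norm u j).trans ?_
      have := norm_add_le (u - ![u₀, u₁]) ![u₀, u₁]
      rw [sub_add_cancel] at this
      linarith
    exact bounded_lagrangeMap_parabolaMat h (hu' 0) (hu' 1)

theorem parabola_axis {a b l c : ℂ} (h1 : a ^ 2 = 2 * b) (h2 : a + star (l * a) = 0)
    (h3 : b - star l = c) : a ^ 2 * (‖a‖ ^ 2 + 2) = 2 * c * ‖a‖ ^ 2 := by
  have haa : a * star a = (‖a‖ : ℂ) ^ 2 := by
    rw [Complex.star_def, Complex.mul_conj, Complex.normSq_eq_norm_sq]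
    push_cast
    rfl
  rw [star_mul'] at h2
  rw [← haa]
  linear_combination 2 * a * h2 + 2 * a * star a * h3 + a * star a * h1

theorem one_mem_openCounts_parabolaMat : 1 ∈ openCounts parabolaMat := by
  refine mem_openCounts_parabolaMat 0 0 {(0, 0, 0)} ?_ (by simp) ?_
  · intro a b l
    rw [lagrangeMap_parabolaMat_iff]
    simp only [Set.mem_singleton_iff, Prod.mk.injEq]
    constructor
    · rintro ⟨e1, e2, e3⟩
      by_cases ha : a = 0
      · subst ha
        have hb : b = 0 := by simpa using e1.symm
        subst hb
        exact ⟨rfl, rfl, by simpa using e3⟩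
      · exfalso
        have := parabola_axis e1 e2 e3
        rw [mul_zero, zero_mul, mul_eq_zero, or_iff_right (pow_ne_zero 2 ha)] at this
        have h2 : ‖a‖ ^ 2 + 2 = 0 := by exact_mod_cast this
        have : (0 : ℝ) ≤ ‖a‖ ^ 2 := by positivity
        linarith
    · rintro ⟨rfl, rfl, rfl⟩
      simp
  · intro a b l h s ν h1 h2
    obtain ⟨rfl, rfl, rfl⟩ : a = 0 ∧ b = 0 ∧ l = 0 := by simpa using h
    simpa using h1

/-- On the axis point (0, c), a critical point with a ≠ 0 satisfies a² (|a|² + 2) = 2c|a|². For c =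
3, taking norms gives |a|² = 4, and then a² = 4, so two more critical points join the vertex. -/
theorem three_mem_openCounts_parabolaMat : 3 ∈ openCounts parabolaMat := by
  refine mem_openCounts_parabolaMat 0 3 {(0, 0, -3), (2, 2, -1), (-2, 2, -1)} ?_ ?_ ?_
  · intro a b l
    rw [lagrangeMap_parabolaMat_iff]
    simp only [Set.mem_insert_iff, Set.mem_singleton_iff, Prod.mk.injEq]
    constructor
    · rintro ⟨e1, e2, e3⟩
      by_cases ha : a = 0
      · subst ha
        have hb : b = 0 := by simpa using e1.symm
        subst hb
        refine Or.inl ⟨rfl, rfl, star_injective ?_⟩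
        simp only [zero_sub] at e3
        rw [neg_eq_iff_eq_neg.mp e3]
        simp
      · have h := parabola_axis e1 e2 e3
        have hn := congrArg norm h
        rw [norm_mul, norm_pow] at hn
        have e4 : ((‖a‖ : ℂ) ^ 2 + 2) = ((‖a‖ ^ 2 + 2 : ℝ) : ℂ) := by push_cast; rfl
        have e5 : (2 * 3 * (‖a‖ : ℂ) ^ 2) = ((6 * ‖a‖ ^ 2 : ℝ) : ℂ) := by push_cast; ring
        have ha' : 0 < ‖a‖ ^ 2 := by positivity
        rw [e4, e5, Complex.norm_real, Complex.norm_real, Real.norm_of_nonneg (by positivity),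
          Real.norm_of_nonneg (by positivity)] at hn
        have h4 : ‖a‖ ^ 2 = 4 := by
          have : ‖a‖ ^ 2 * (‖a‖ ^ 2 - 4) = 0 := by linear_combination hn
          linarith [(mul_eq_zero.mp this).resolve_left ha'.ne']
        rw [e4, e5, h4] at h
        have ha2 : a ^ 2 = 2 ^ 2 := by
          push_cast at h
          linear_combination h / 6
        have hb : b = 2 := by linear_combination ha2 / 2 - e1 / 2
        have hl : l = -1 := by
          apply star_injective
          rw [star_neg, star_one]
          linear_combination -e3 + hb
        rcases sq_eq_sq_iff_eq_or_eq_neg.mp ha2 with h | h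
        · exact Or.inr (Or.inl ⟨h, hb, hl⟩)
        · exact Or.inr (Or.inr ⟨h, hb, hl⟩)
    · rintro (⟨rfl, rfl, rfl⟩ | ⟨rfl, rfl, rfl⟩ | ⟨rfl, rfl, rfl⟩)
      · simp
      · simp; norm_num
      · simp; norm_num
  · rw [Set.encard_insert_of_notMem (by simp), Set.encard_pair]
    · norm_num
    · intro h
      have := congrArg (fun x => x.1.re) h
      norm_num at this
  · intro a b l h s ν h1 h2
    simp only [Set.mem_insert_iff, Set.mem_singleton_iff, Prod.mk.injEq] at h
    have a1 := congrArg Complex.re h1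
    have a2 := congrArg Complex.im h1
    have b1 := congrArg Complex.re h2
    have b2 := congrArg Complex.im h2
    rcases h with ⟨rfl, rfl, rfl⟩ | ⟨rfl, rfl, rfl⟩ | ⟨rfl, rfl, rfl⟩ <;>
    · simp at a1 a2 b1 b2
      refine Complex.ext ?_ ?_ <;> simp <;> linarith

end Parabola

end HermitianDistance
end

open MvPolynomial
noncomputable section
namespace HermitianDistance

/-! ### Counting virtual critical points by the roots of a polynomial -/

/-- The polynomial `F` with coefficients in `ℂ[u, v]`, evaluated at `(u, v)`. -/
def polyAt (F : Polynomial (MvPolynomial (Fin 2 ⊕ Fin 2) ℂ)) (u v : Fin 2 → ℂ) : Polynomial ℂ :=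
  F.map (eval (Sum.elim u v))

theorem generic_separable_polyAt {F : Polynomial (MvPolynomial (Fin 2 ⊕ Fin 2) ℂ)} {n : ℕ}
    (hn : n ≠ 0) (hF : F.natDegree ≤ n) (u₀ v₀ : Fin 2 → ℂ)
    (hFc : eval (Sum.elim u₀ v₀) (F.coeff n) ≠ 0) (h₀ : (polyAt F u₀ v₀).Separable) :
    Generic fun u v => (polyAt F u v).Separable ∧ (polyAt F u v).natDegree = n :=
  generic_separable hn hF u₀ v₀ hFc h₀

/-- Generically, `f` is a bijection from the virtual critical points to the `n` distinct roots of
the polynomial `F`. -/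
def RootCount (A : Matrix (Fin 3) (Fin 3) ℂ) (F : Polynomial (MvPolynomial (Fin 2 ⊕ Fin 2) ℂ))
    (n : ℕ) (f : (Fin 2 → ℂ) × (Fin 2 → ℂ) → (Fin 2 → ℂ) → (Fin 2 → ℂ) → ℂ) : Prop :=
  Generic fun u v => ((polyAt F u v).Separable ∧ (polyAt F u v).natDegree = n) ∧
    Set.BijOn (fun x => f x u v) (virtSet A u v) {p | (polyAt F u v).eval p = 0}

variable {A : Matrix (Fin 3) (Fin 3) ℂ} {F : Polynomial (MvPolynomial (Fin 2 ⊕ Fin 2) ℂ)}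
  {n : ℕ} {f : (Fin 2 → ℂ) × (Fin 2 → ℂ) → (Fin 2 → ℂ) → (Fin 2 → ℂ) → ℂ}

theorem RootCount.genericCount (h : RootCount A F n f) : GenericCount A n := by
  refine h.mono fun u v ⟨⟨h1, h2⟩, h3⟩ => ?_
  rw [← h3.injOn.encard_image, h3.image_eq, encard_roots_of_separable h1, h2]

/-- If all virtual critical points are critical points then all roots come from critical points. -/
theorem RootCount.all_roots (h : RootCount A F n f) (hn : n ∈ openCounts A)
    {S : (Fin 2 → ℂ) → (Fin 2 → ℂ) → Prop} (hS : Generic S) :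
    ∃ u, S u (star u) ∧ (polyAt F u (star u)).natDegree = n ∧
      (polyAt F u (star u)).Separable ∧
      Set.BijOn (fun x => f x u (star u)) (virtSet A u (star u))
        {p | (polyAt F u (star u)).eval p = 0} ∧
      ∀ p, (polyAt F u (star u)).eval p = 0 → ∃ z ∈ critSet A u, f (z, star z) u (star u) = p := by
  obtain ⟨u, ⟨⟨⟨h1, h2⟩, h3⟩, hS⟩, hu⟩ := exists_of_mem_openCounts hn (h.and hS)
  refine ⟨u, hS, h2, h1, h3, fun p hp => ?_⟩
  have hmem : ∀ z ∈ critSet A u, (z, star z) ∈ virtSet A u (star u) := by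
    intro z hz
    simp only [virtSet, Set.mem_ofPred_eq, star_star, ← star_sub]
    exact ⟨hz, hz⟩
  have hinj : Set.InjOn (fun z => f (z, star z) u (star u)) (critSet A u) := by
    intro z hz z' hz' hzz
    exact congrArg Prod.fst (h3.injOn (hmem z hz) (hmem z' hz') hzz)
  have hsub : (fun z => f (z, star z) u (star u)) '' critSet A u ⊆
      {p | (polyAt F u (star u)).eval p = 0} := by
    rintro _ ⟨z, hz, rfl⟩
    exact h3.mapsTo (hmem z hz)
  have hroots := encard_roots_of_separable h1
  rw [h2] at hroots
  -- The n critical points have n distinct images among the n roots, so they exhaust the roots.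
  have heq := Set.Finite.eq_of_subset_of_encard_le' (Set.finite_of_encard_eq_coe hroots) hsub
    (by rw [hinj.encard_image, hroots, hu])
  rw [Set.ext_iff] at heq
  exact (heq p).mpr hp

/-- The elementary symmetric functions of a multiset of positive real numbers are positive. -/
theorem esymm_pos {s : Multiset ℝ} (hs : ∀ x ∈ s, 0 < x) {i : ℕ} (hi : i ≤ s.card) :
    0 < s.esymm i := by
  have hpos : ∀ x ∈ (s.powersetCard i).map Multiset.prod, 0 < x := by
    intro x hx
    obtain ⟨t, ht, rfl⟩ := Multiset.mem_map.mp hx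
    exact Multiset.prod_pos fun y hy => hs y (Multiset.mem_of_le (Multiset.mem_powersetCard.mp ht).1 hy)
  have hne : (s.powersetCard i).map Multiset.prod ≠ 0 := by
    rw [← Multiset.card_pos, Multiset.card_map, Multiset.card_powersetCard]
    exact Nat.choose_pos hi
  obtain ⟨a, ha⟩ := Multiset.exists_mem_of_ne_zero hne
  obtain ⟨t, ht⟩ := Multiset.exists_cons_of_mem ha
  rw [Multiset.esymm, ht, Multiset.sum_cons]
  refine add_pos_of_pos_of_nonneg (hpos a ha) (Multiset.sum_nonneg fun x hx => (hpos x ?_).le)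
  rw [ht]
  exact Multiset.mem_cons_of_mem hx

/-- The coefficients of a polynomial with positive roots alternate in sign. -/
theorem coeff_of_pos_roots {P : Polynomial ℂ}
    (hP : ∀ p, P.eval p = 0 → ∃ r : ℝ, 0 < r ∧ p = r) :
    ∃ s : Multiset ℝ, (∀ x ∈ s, 0 < x ∧ P.eval (x : ℂ) = 0) ∧ s.card = P.natDegree ∧
      ∀ i ≤ P.natDegree, P.coeff (P.natDegree - i) =
        P.leadingCoeff * (-1) ^ i * (s.esymm i : ℂ) := by
  by_cases h0 : P = 0
  -- For the zero polynomial -1 would be a root, contradicting positivity.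
  · subst h0
    obtain ⟨r, hr, h⟩ := hP (-1) (by simp)
    have := congrArg Complex.re h
    simp at this
    linarith
  have hr : ∀ p ∈ P.roots, ∃ r : ℝ, (r : ℂ) = p := by
    intro p hp
    obtain ⟨r, -, rfl⟩ := hP p (Polynomial.mem_roots h0 |>.mp hp)
    exact ⟨r, rfl⟩
  obtain ⟨s, hs⟩ : ∃ s : Multiset ℝ, s.map (fun x : ℝ => (x : ℂ)) = P.roots := by
    refine ⟨P.roots.map Complex.re, ?_⟩
    rw [Multiset.map_map]
    conv_rhs => rw [← Multiset.map_id P.roots]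
    refine Multiset.map_congr rfl fun p hp => ?_
    obtain ⟨r, rfl⟩ := hr p hp
    simp
  have hcard : P.roots.card = P.natDegree := ((IsAlgClosed.splits P).natDegree_eq_card_roots).symm
  refine ⟨s, fun x hx => ?_, by rw [← hcard, ← hs, Multiset.card_map], fun i hi => ?_⟩
  · have hx' : (x : ℂ) ∈ P.roots := by
      rw [← hs]
      exact Multiset.mem_map_of_mem _ hx
    have hx2 : P.eval (x : ℂ) = 0 := Polynomial.mem_roots h0 |>.mp hx'
    obtain ⟨r, hr, h⟩ := hP _ hx2
    exact ⟨by rwa [Complex.ofReal_injective h], hx2⟩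
  · rw [Polynomial.coeff_eq_esymm_roots_of_card hcard (Nat.sub_le _ _), Nat.sub_sub_self hi, ← hs]
    congr 1
    simp only [Multiset.esymm, Multiset.powersetCard_map, Multiset.map_map, Function.comp_def]
    rw [← Complex.ofRealHom_eq_coe, map_multiset_sum, Multiset.map_map]
    congr 1
    refine Multiset.map_congr rfl fun t _ => ?_
    simp only [Function.comp_apply, map_multiset_prod]
    rfl

/-! ### Real symmetric matrices -/

theorem conicNormal_star (hr : ∀ i j, star (A i j) = A i j) (z a : Fin 2 → ℂ) :
    ConicNormal A (star z) (star a) ↔ ConicNormal A z a := by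
  have hg : ∀ i, conicGrad A (star z) i = star (conicGrad A z i) := by
    intro i
    simp only [conicGrad, star_add, star_mul', hr, Pi.star_apply]
  have hv : conicVal A (star z) = star (conicVal A z) := by
    simp only [conicVal_eq, hg, star_add, star_mul', Pi.star_apply]
  rw [ConicNormal, ConicNormal, hv, hg, hg, star_eq_zero]
  refine and_congr_right fun _ => ?_
  simp only [Pi.star_apply, ← star_mul', star_inj]

/-- For a real matrix the conjugations in the second condition cancel, and the system becomes
symmetric under exchanging (z, u) with (w, v). -/
theorem mem_virtSet_iff (hr : ∀ i j, star (A i j) = A i j) (z w u v : Fin 2 → ℂ) :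
    (z, w) ∈ virtSet A u v ↔ ConicNormal A z (v - w) ∧ ConicNormal A w (u - z) := by
  simp only [virtSet, Set.mem_ofPred_eq, conicNormal_star hr]

theorem star_symMat {a b c d e f : ℂ} (ha : star a = a) (hb : star b = b) (hc : star c = c)
    (hd : star d = d) (he : star e = e) (hf : star f = f) (i j : Fin 3) :
    star (symMat a b c d e f i j) = symMat a b c d e f i j := by
  fin_cases i <;> fin_cases j <;> simpa [symMat]

end HermitianDistance
end

open MvPolynomial
noncomputable section
namespace HermitianDistance

/-- The coordinates of the generic point `u`. -/
def uM (i : Fin 2) : MvPolynomial (Fin 2 ⊕ Fin 2) ℂ := X (Sum.inl i)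

/-- The coordinates of the generic point `v`. -/
def vM (i : Fin 2) : MvPolynomial (Fin 2 ⊕ Fin 2) ℂ := X (Sum.inr i)

@[simp] theorem eval_uM (u v : Fin 2 → ℂ) (i : Fin 2) : eval (Sum.elim u v) (uM i) = u i := by
  simp [uM]

@[simp] theorem eval_vM (u v : Fin 2 → ℂ) (i : Fin 2) : eval (Sum.elim u v) (vM i) = v i := by
  simp [vM]

section Parabola

/-! ### The parabola -/

theorem conicNormal_parabolaMat (z a : Fin 2 → ℂ) :
    ConicNormal parabolaMat z a ↔ z 0 ^ 2 = 2 * z 1 ∧ z 0 * a 1 = -a 0 := by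
  rw [ConicNormal, conicVal_parabolaMat, conicGrad_parabolaMat_zero, conicGrad_parabolaMat_one,
    sub_eq_zero, neg_one_mul]

/-- The polynomial whose roots are the numbers `1 + z₁ w₁ / 2`. -/
def parabolaFamily {R : Type*} [CommRing R] (a b c d : R) : Polynomial R :=
  2 * (Polynomial.X - 1) * (Polynomial.X ^ 2 - Polynomial.C b * Polynomial.C d) ^ 2 -
    (Polynomial.X * Polynomial.C a + Polynomial.C b * Polynomial.C c) *
      (Polynomial.X * Polynomial.C c + Polynomial.C d * Polynomial.C a)

theorem parabolaFamily_eq {R : Type*} [CommRing R] (a b c d : R) : parabolaFamily a b c d =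
    Polynomial.C 2 * Polynomial.X ^ 5 + Polynomial.C (-2) * Polynomial.X ^ 4 +
      Polynomial.C (-4 * b * d) * Polynomial.X ^ 3 +
      Polynomial.C (4 * b * d - a * c) * Polynomial.X ^ 2 +
      Polynomial.C (2 * (b * d) ^ 2 - a ^ 2 * d - b * c ^ 2) * Polynomial.X ^ 1 +
      Polynomial.C (-2 * (b * d) ^ 2 - b * c * d * a) := by
  simp only [parabolaFamily, map_sub, map_mul, map_pow, map_neg, map_ofNat]
  ring

theorem natDegree_parabolaFamily {R : Type*} [CommRing R] (a b c d : R) :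
    (parabolaFamily a b c d).natDegree ≤ 5 := by
  rw [parabolaFamily_eq]
  compute_degree

theorem coeff_parabolaFamily_five {R : Type*} [CommRing R] (a b c d : R) :
    (parabolaFamily a b c d).coeff 5 = 2 := by
  rw [parabolaFamily_eq]
  simp only [Polynomial.coeff_add, Polynomial.coeff_C_mul, Polynomial.coeff_X_pow,
    Polynomial.coeff_C]
  simp

theorem coeff_parabolaFamily_four {R : Type*} [CommRing R] (a b c d : R) :
    (parabolaFamily a b c d).coeff 4 = -2 := by
  rw [parabolaFamily_eq]
  simp only [Polynomial.coeff_add, Polynomial.coeff_C_mul, Polynomial.coeff_X_pow,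
    Polynomial.coeff_C]
  simp

/-- The generic member of `parabolaFamily`. -/
def parabolaPoly : Polynomial (MvPolynomial (Fin 2 ⊕ Fin 2) ℂ) :=
  parabolaFamily (uM 0) (uM 1) (vM 0) (vM 1)

theorem polyAt_parabolaPoly (u v : Fin 2 → ℂ) :
    polyAt parabolaPoly u v = parabolaFamily (u 0) (u 1) (v 0) (v 1) := by
  simp [polyAt, parabolaPoly, parabolaFamily]

theorem eval_parabolaPoly (u v : Fin 2 → ℂ) (r : ℂ) : (polyAt parabolaPoly u v).eval r =
    2 * (r - 1) * (r ^ 2 - u 1 * v 1) ^ 2 - (r * u 0 + u 1 * v 0) * (r * v 0 + v 1 * u 0) := by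
  simp [polyAt_parabolaPoly, parabolaFamily]
  ring

/-- Put r = 1 + z₁w₁/2. The normality equations become r z₁ = u₁ + w₁u₂ and r w₁ = v₁ + z₁v₂, a
linear system with determinant r² - u₂v₂. Substituting its solution into z₁w₁ = 2(r - 1) yields the
quintic, and the same formulas rebuild the solution from a root. -/
theorem rootCount_parabolaMat :
    RootCount parabolaMat parabolaPoly 5 fun p _ _ => 1 + p.1 0 * p.2 0 / 2 := by
  have hsep : Generic fun u v => (polyAt parabolaPoly u v).Separable ∧
      (polyAt parabolaPoly u v).natDegree = 5 := by
    -- At u = (b, 1), v = (0, 1) the quintic is this pencil with parameter c = b².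
    have hfin : {c : ℂ | ¬ ((2 * (Polynomial.X - 1) * (Polynomial.X ^ 2 - 1) ^ 2 : Polynomial ℂ) +
        Polynomial.C c * -Polynomial.X).Separable}.Finite := by
      refine finite_not_separable_pencil ?_ ?_
      · rw [Polynomial.isCoprime_iff_aeval_ne_zero_of_isAlgClosed ℂ ℂ]
        intro a
        by_cases ha : a = 0
        · left; simp [ha]
        · right; simpa using ha
      · intro h
        have := congrArg (Polynomial.eval 0) h
        simp at this
    obtain ⟨c, hc⟩ := hfin.infinite_compl.nonempty
    rw [Set.mem_compl_iff, Set.mem_ofPred_eq, not_not] at hc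
    obtain ⟨b, rfl⟩ := IsAlgClosed.exists_pow_nat_eq c two_pos
    refine generic_separable_polyAt (by norm_num)
      (natDegree_parabolaFamily _ _ _ _) ![b, 1] ![0, 1] ?_ ?_
    · rw [parabolaPoly, coeff_parabolaFamily_five]
      simp
    · convert hc using 1
      simp [polyAt_parabolaPoly, parabolaFamily]
      ring
  have hgen : Generic fun u v => u 1 * v 1 * (v 1 * u 0 ^ 2 - u 1 * v 0 ^ 2) ≠ 0 := by
    refine Generic.of_eval (uM 1 * vM 1 * (vM 1 * uM 0 ^ 2 - uM 1 * vM 0 ^ 2)) ![1, 1] ![0, 1] (by simp) fun u v h => ?_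
    simpa using h
  refine (hsep.and hgen).mono fun u v ⟨h1, h2⟩ => ⟨h1, ?_⟩
  have hr : ∀ i j, star (parabolaMat i j) = parabolaMat i j :=
    star_symMat (by simp) (by simp) (by simp) (by simp) (by simp) (by simp)
  have hmem : ∀ z w : Fin 2 → ℂ, (z, w) ∈ virtSet parabolaMat u v ↔
      (z 0 ^ 2 = 2 * z 1 ∧ z 0 * (v 1 - w 1) = -(v 0 - w 0)) ∧
        (w 0 ^ 2 = 2 * w 1 ∧ w 0 * (u 1 - z 1) = -(u 0 - z 0)) := by
    intro z w
    rw [mem_virtSet_iff hr, conicNormal_parabolaMat, conicNormal_parabolaMat]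
    rfl
  -- If the determinant vanished at a root, one of the numerators in Cramer's rule would vanish too,
  -- which forces v₂u₁² = u₂v₁².
  have hD : ∀ r, (polyAt parabolaPoly u v).eval r = 0 → r ^ 2 - u 1 * v 1 ≠ 0 := by
    intro r hr hD
    rw [eval_parabolaPoly, hD] at hr
    have hu1 : u 1 ≠ 0 := left_ne_zero_of_mul (left_ne_zero_of_mul h2)
    have hv1 : v 1 ≠ 0 := right_ne_zero_of_mul (left_ne_zero_of_mul h2)
    have h3 : (r * u 0 + u 1 * v 0) * (r * v 0 + v 1 * u 0) = 0 := by linear_combination -hr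
    apply right_ne_zero_of_mul h2
    rcases mul_eq_zero.mp h3 with h | h
    · refine mul_left_cancel₀ hu1 ?_
      linear_combination (r * u 0 - u 1 * v 0) * h - u 0 ^ 2 * hD
    · refine mul_left_cancel₀ hv1 ?_
      linear_combination (-r * v 0 + v 1 * u 0) * h + v 0 ^ 2 * hD
  have hlin : ∀ z w : Fin 2 → ℂ, (z, w) ∈ virtSet parabolaMat u v →
      ((1 + z 0 * w 0 / 2) ^ 2 - u 1 * v 1) * z 0 = (1 + z 0 * w 0 / 2) * u 0 + u 1 * v 0 ∧
      ((1 + z 0 * w 0 / 2) ^ 2 - u 1 * v 1) * w 0 = (1 + z 0 * w 0 / 2) * v 0 + v 1 * u 0 := by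
    intro z w h
    obtain ⟨⟨a1, a2⟩, b1, b2⟩ := (hmem z w).mp h
    have e1 : z 0 * (1 + z 0 * w 0 / 2) = u 0 + w 0 * u 1 := by
      linear_combination w 0 / 2 * a1 - b2
    have e2 : w 0 * (1 + z 0 * w 0 / 2) = v 0 + z 0 * v 1 := by
      linear_combination z 0 / 2 * b1 - a2
    constructor
    · linear_combination (1 + z 0 * w 0 / 2) * e1 + u 1 * e2
    · linear_combination (1 + z 0 * w 0 / 2) * e2 + v 1 * e1
  have hroot : ∀ z w : Fin 2 → ℂ, (z, w) ∈ virtSet parabolaMat u v →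
      (polyAt parabolaPoly u v).eval (1 + z 0 * w 0 / 2) = 0 := by
    intro z w h
    obtain ⟨e1, e2⟩ := hlin z w h
    rw [eval_parabolaPoly, ← e1, ← e2]
    ring
  refine ⟨?_, ?_, ?_⟩
  · rintro ⟨z, w⟩ h
    exact hroot z w h
  · rintro ⟨z, w⟩ h ⟨z', w'⟩ h' heq
    have hr := hD _ (hroot z w h)
    obtain ⟨e1, e2⟩ := hlin z w h
    obtain ⟨e1', e2'⟩ := hlin z' w' h'
    obtain ⟨⟨a1, -⟩, b1, -⟩ := (hmem z w).mp h
    obtain ⟨⟨a1', -⟩, b1', -⟩ := (hmem z' w').mp h'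
    dsimp only at heq
    rw [← heq] at e1' e2'
    have hz := mul_left_cancel₀ hr (e1.trans e1'.symm)
    have hw := mul_left_cancel₀ hr (e2.trans e2'.symm)
    rw [hz] at a1
    rw [hw] at b1
    have hz1 : z 1 = z' 1 := by linear_combination (a1' - a1) / 2
    have hw1 : w 1 = w' 1 := by linear_combination (b1' - b1) / 2
    rw [Prod.mk.injEq]
    constructor <;> funext j <;> fin_cases j <;> assumption
  · intro r hr
    have hD := hD r hr
    rw [Set.mem_ofPred_eq, eval_parabolaPoly] at hr
    set D := r ^ 2 - u 1 * v 1 with hDdef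
    set a := (r * u 0 + u 1 * v 0) / D with ha
    set b := (r * v 0 + v 1 * u 0) / D with hb
    have ea : D * a = r * u 0 + u 1 * v 0 := by rw [ha]; field_simp
    have eb : D * b = r * v 0 + v 1 * u 0 := by rw [hb]; field_simp
    have hab : a * b = 2 * (r - 1) := by
      refine mul_left_cancel₀ (pow_ne_zero 2 hD) ?_
      linear_combination eb * (D * a) + (r * v 0 + v 1 * u 0) * ea - hr
    refine ⟨(![a, a ^ 2 / 2], ![b, b ^ 2 / 2]), (hmem _ _).mpr ?_, ?_⟩
    · simp only [Matrix.cons_val_zero, Matrix.cons_val_one]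
      refine ⟨⟨by ring, ?_⟩, by ring, ?_⟩
      · have : D * (a * v 1 + v 0 - b * r) = 0 := by
          linear_combination v 1 * ea - r * eb + v 0 * hDdef
        have := (mul_eq_zero.mp this).resolve_left hD
        linear_combination this - b / 2 * hab
      · have : D * (b * u 1 + u 0 - a * r) = 0 := by
          linear_combination u 1 * eb - r * ea + u 0 * hDdef
        have := (mul_eq_zero.mp this).resolve_left hD
        linear_combination this - a / 2 * hab
    · simp only [Matrix.cons_val_zero]
      linear_combination hab / 2

/-- At a critical point the root is 1 + |z₁|²/2 ≥ 1. Five such roots would add up to at least 5, but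
the two leading coefficients 2 and -2 make the sum of the roots equal to 1. -/
theorem five_notMem_openCounts_parabolaMat : 5 ∉ openCounts parabolaMat := by
  intro h5
  obtain ⟨u, -, hdeg, -, -, hroots⟩ :=
    rootCount_parabolaMat.all_roots h5 rootCount_parabolaMat.genericCount
  have hone : ∀ p, (polyAt parabolaPoly u (star u)).eval p = 0 → ∃ r : ℝ, 1 ≤ r ∧ p = r := by
    intro p hp
    obtain ⟨z, -, rfl⟩ := hroots p hp
    refine ⟨1 + ‖z 0‖ ^ 2 / 2, by linarith [sq_nonneg ‖z 0‖], ?_⟩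
    have : z 0 * star (z 0) = (‖z 0‖ : ℂ) ^ 2 := by
      rw [Complex.star_def, Complex.mul_conj, Complex.normSq_eq_norm_sq]
      push_cast
      rfl
    simp only [Pi.star_apply, this]
    push_cast
    rfl
  obtain ⟨s, hs, hcard, hcoeff⟩ := coeff_of_pos_roots
    fun p hp => (hone p hp).imp fun r hr => ⟨by linarith [hr.1], hr.2⟩
  have h1 := hcoeff 1 (by omega)
  rw [Polynomial.leadingCoeff, hdeg, polyAt_parabolaPoly, coeff_parabolaFamily_four,
    coeff_parabolaFamily_five] at h1
  have hsum : s.esymm 1 = s.sum := by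
    simp [Multiset.esymm, Multiset.powersetCard_one]
  rw [hsum] at h1
  have h2 : s.sum = 1 := by
    have : (s.sum : ℂ) = 1 := by
      have h1' : (-2 : ℂ) = 2 * -1 * (s.sum : ℂ) := by simpa using h1
      linear_combination h1' / 2
    exact_mod_cast this
  have h3 : s.card • (1 : ℝ) ≤ s.sum := by
    refine Multiset.card_nsmul_le_sum fun x hx => ?_
    obtain ⟨r, hr, h⟩ := hone _ (hs x hx).2
    rwa [Complex.ofReal_injective h]
  rw [hcard, hdeg, h2] at h3
  norm_num at h3

theorem openCounts_parabolaMat : openCounts parabolaMat = {1, 3} := by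
  ext k
  simp only [Set.mem_insert_iff, Set.mem_singleton_iff]
  constructor
  · intro hk
    obtain ⟨h1, h2⟩ := rootCount_parabolaMat.genericCount.mod_two hk
    have h3 : k ≠ 5 := by
      rintro rfl
      exact five_notMem_openCounts_parabolaMat hk
    omega
  · rintro (rfl | rfl)
    · exact one_mem_openCounts_parabolaMat
    · exact three_mem_openCounts_parabolaMat

end Parabola

section Circle

/-! ### The circle -/

theorem conicVal_circleMat (z : Fin 2 → ℂ) : conicVal circleMat z = z 0 * z 1 - 1 := by
  rw [conicVal_eq]
  simp [conicGrad, circleMat, symMat]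
  ring

theorem conicNormal_circleMat (z a : Fin 2 → ℂ) :
    ConicNormal circleMat z a ↔ z 0 * z 1 = 1 ∧ z 1 * a 1 = z 0 * a 0 := by
  rw [ConicNormal, conicVal_circleMat, sub_eq_zero]
  have h0 : conicGrad circleMat z 0 = z 1 / 2 := by
    simp [conicGrad, circleMat, symMat]
    ring
  have h1 : conicGrad circleMat z 1 = z 0 / 2 := by
    simp [conicGrad, circleMat, symMat]
    ring
  rw [h0, h1, div_mul_eq_mul_div, div_mul_eq_mul_div, div_left_inj' two_ne_zero]

/-- The polynomial whose roots are the numbers `z₁ w₁`. -/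
def circleFamily {R : Type*} [CommRing R] (a b c d : R) : Polynomial R :=
  (Polynomial.X ^ 2 - 1) ^ 2 * ((Polynomial.X * Polynomial.C a + Polynomial.C d) *
    (Polynomial.X * Polynomial.C c + Polynomial.C b)) -
    Polynomial.X * (Polynomial.X ^ 2 * (Polynomial.C a * Polynomial.C c) -
      Polynomial.C b * Polynomial.C d) ^ 2

theorem circleFamily_eq {R : Type*} [CommRing R] (a b c d : R) : circleFamily a b c d =
    Polynomial.C (a * c) * Polynomial.X ^ 6 +
    Polynomial.C (a * b + c * d - (a * c) ^ 2) * Polynomial.X ^ 5 +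
    Polynomial.C (b * d - 2 * (a * c)) * Polynomial.X ^ 4 +
    Polynomial.C (2 * (a * c) * (b * d) - 2 * (a * b + c * d)) * Polynomial.X ^ 3 +
    Polynomial.C (a * c - 2 * (b * d)) * Polynomial.X ^ 2 +
    Polynomial.C (a * b + c * d - (b * d) ^ 2) * Polynomial.X ^ 1 + Polynomial.C (b * d) := by
  simp only [circleFamily, map_add, map_sub, map_mul, map_pow, map_ofNat]
  ring

theorem natDegree_circleFamily {R : Type*} [CommRing R] (a b c d : R) :
    (circleFamily a b c d).natDegree ≤ 6 := by
  rw [circleFamily_eq]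
  compute_degree

theorem coeff_circleFamily {R : Type*} [CommRing R] (a b c d : R) :
    (circleFamily a b c d).coeff 6 = a * c ∧ (circleFamily a b c d).coeff 4 = b * d - 2 * (a * c) ∧
      (circleFamily a b c d).coeff 2 = a * c - 2 * (b * d) := by
  rw [circleFamily_eq]
  simp only [Polynomial.coeff_add, Polynomial.coeff_C_mul, Polynomial.coeff_X_pow,
    Polynomial.coeff_C]
  simp

/-- The generic member of `circleFamily`. -/
def circlePoly : Polynomial (MvPolynomial (Fin 2 ⊕ Fin 2) ℂ) :=
  circleFamily (uM 0) (uM 1) (vM 0) (vM 1)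

theorem polyAt_circlePoly (u v : Fin 2 → ℂ) :
    polyAt circlePoly u v = circleFamily (u 0) (u 1) (v 0) (v 1) := by
  simp [polyAt, circlePoly, circleFamily]

theorem eval_circlePoly (u v : Fin 2 → ℂ) (r : ℂ) : (polyAt circlePoly u v).eval r =
    (r ^ 2 - 1) ^ 2 * ((r * u 0 + v 1) * (r * v 0 + u 1)) -
      r * (r ^ 2 * (u 0 * v 0) - u 1 * v 1) ^ 2 := by
  rw [polyAt_circlePoly]
  simp only [circleFamily, Polynomial.eval_sub, Polynomial.eval_mul, Polynomial.eval_pow,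
    Polynomial.eval_add, Polynomial.eval_X, Polynomial.eval_one, Polynomial.eval_C]

/-- With r = z₁w₁, eliminating z₂ and w₂ gives r v₁z₁ - v₂w₁ = r² - 1 and r u₁w₁ - u₂z₁ = r² - 1.
This linear system for z₁, w₁ has determinant r²u₁v₁ - u₂v₂, and the sextic expresses z₁w₁ = r. -/
theorem rootCount_circleMat : RootCount circleMat circlePoly 6 fun p _ _ => p.1 0 * p.2 0 := by
  have hsep : Generic fun u v => (polyAt circlePoly u v).Separable ∧
      (polyAt circlePoly u v).natDegree = 6 := by
    -- At u = (1, c), v = (1, 0) the sextic is X times this pencil. The value c = 0 is avoided to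
    -- keep the second factor nonzero at 0.
    have hfin : {c : ℂ | ¬ ((Polynomial.X * (Polynomial.X ^ 2 - 1) ^ 2 - Polynomial.X ^ 4 :
        Polynomial ℂ) + Polynomial.C c * (Polynomial.X ^ 2 - 1) ^ 2).Separable}.Finite := by
      refine finite_not_separable_pencil ?_ ?_
      · rw [Polynomial.isCoprime_iff_aeval_ne_zero_of_isAlgClosed ℂ ℂ]
        intro a
        by_cases ha : a ^ 2 - 1 = 0
        · left
          have h4 : a ^ 4 = 1 := by linear_combination (a ^ 2 + 1) * ha
          simp [ha, h4]
        · right; simpa using ha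
      · intro h
        have := congrArg (Polynomial.eval 0) h
        simp at this
    obtain ⟨c, hc⟩ := (hfin.union (Set.finite_singleton 0)).infinite_compl.nonempty
    simp only [Set.mem_compl_iff, Set.mem_union, Set.mem_ofPred_eq, not_or, not_not,
      Set.mem_singleton_iff] at hc
    refine generic_separable_polyAt (by norm_num)
      (natDegree_circleFamily _ _ _ _) ![1, c] ![1, 0] ?_ ?_
    · rw [circlePoly, (coeff_circleFamily _ _ _ _).1]
      simp
    · have : polyAt circlePoly ![1, c] ![1, 0] =
          Polynomial.X * ((Polynomial.X * (Polynomial.X ^ 2 - 1) ^ 2 - Polynomial.X ^ 4 :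
          Polynomial ℂ) + Polynomial.C c * (Polynomial.X ^ 2 - 1) ^ 2) := by
        simp [polyAt_circlePoly, circleFamily]
        ring
      rw [this]
      refine Polynomial.separable_X.mul hc.1 ?_
      rw [Polynomial.isCoprime_iff_aeval_ne_zero_of_isAlgClosed ℂ ℂ]
      intro a
      by_cases ha : a = 0
      · right; simpa [ha] using hc.2
      · left; simpa using ha
  have hgen : Generic fun u v => u 1 * v 1 * (u 0 * v 0 - u 1 * v 1) *
      (u 0 * u 1 - v 0 * v 1) ≠ 0 := by
    refine Generic.of_eval (uM 1 * vM 1 * (uM 0 * vM 0 - uM 1 * vM 1) *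
      (uM 0 * uM 1 - vM 0 * vM 1)) ![1, 1] ![0, 1] (by simp) fun u v h => ?_
    simpa using h
  refine (hsep.and hgen).mono fun u v ⟨h1, h2⟩ => ⟨h1, ?_⟩
  have hr : ∀ i j, star (circleMat i j) = circleMat i j :=
    star_symMat (by simp) (by simp) (by simp) (by simp) (by simp) (by simp)
  have hmem : ∀ z w : Fin 2 → ℂ, (z, w) ∈ virtSet circleMat u v ↔
      (z 0 * z 1 = 1 ∧ z 1 * (v 1 - w 1) = z 0 * (v 0 - w 0)) ∧
        (w 0 * w 1 = 1 ∧ w 1 * (u 1 - z 1) = w 0 * (u 0 - z 0)) := by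
    intro z w
    rw [mem_virtSet_iff hr, conicNormal_circleMat, conicNormal_circleMat]
    rfl
  have hu1 : u 1 ≠ 0 := fun h => h2 (by simp [h])
  have hv1 : v 1 ≠ 0 := fun h => h2 (by simp [h])
  have hd1 : u 0 * v 0 - u 1 * v 1 ≠ 0 := fun h => h2 (by simp [h])
  have hd2 : u 0 * u 1 - v 0 * v 1 ≠ 0 := fun h => h2 (by simp [h])
  have hr0 : ∀ r, (polyAt circlePoly u v).eval r = 0 → r ≠ 0 := by
    rintro r hr rfl
    rw [eval_circlePoly] at hr
    exact mul_ne_zero hu1 hv1 (by linear_combination hr)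
  have hD : ∀ r, (polyAt circlePoly u v).eval r = 0 → r ^ 2 * (u 0 * v 0) - u 1 * v 1 ≠ 0 := by
    intro r hr hD
    rw [eval_circlePoly, hD, zero_pow two_ne_zero, mul_zero, sub_zero, mul_eq_zero, mul_eq_zero,
      pow_eq_zero_iff two_ne_zero] at hr
    rcases hr with h | h | h
    · exact hd1 (by linear_combination hD - u 0 * v 0 * h)
    · have h3 : v 1 * (r * v 0 + u 1) = 0 := by linear_combination r * v 0 * h - hD
      have h4 := (mul_eq_zero.mp h3).resolve_left hv1
      exact hd2 (by linear_combination u 0 * h4 - v 0 * h)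
    · have h3 : u 1 * (r * u 0 + v 1) = 0 := by linear_combination r * u 0 * h - hD
      have h4 := (mul_eq_zero.mp h3).resolve_left hu1
      exact hd2 (by linear_combination u 0 * h - v 0 * h4)
  have hlin : ∀ z w : Fin 2 → ℂ, (z, w) ∈ virtSet circleMat u v →
      ((z 0 * w 0) ^ 2 * (u 0 * v 0) - u 1 * v 1) * z 0 =
        ((z 0 * w 0) ^ 2 - 1) * (z 0 * w 0 * u 0 + v 1) ∧
      ((z 0 * w 0) ^ 2 * (u 0 * v 0) - u 1 * v 1) * w 0 =
        ((z 0 * w 0) ^ 2 - 1) * (z 0 * w 0 * v 0 + u 1) := by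
    intro z w h
    obtain ⟨⟨a1, a2⟩, b1, b2⟩ := (hmem z w).mp h
    have e1 : z 0 * (z 0 * w 0) * v 0 - w 0 * v 1 = (z 0 * w 0) ^ 2 - 1 := by
      linear_combination -z 0 * w 0 * a2 + (w 0 * v 1 - w 0 * w 1) * a1 - b1
    have e2 : w 0 * (z 0 * w 0) * u 0 - z 0 * u 1 = (z 0 * w 0) ^ 2 - 1 := by
      linear_combination -z 0 * w 0 * b2 + (z 0 * u 1 - z 0 * z 1) * b1 - a1
    constructor
    · linear_combination z 0 * w 0 * u 0 * e1 + v 1 * e2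
    · linear_combination z 0 * w 0 * v 0 * e2 + u 1 * e1
  have hne : ∀ z w : Fin 2 → ℂ, (z, w) ∈ virtSet circleMat u v → z 0 * w 0 ≠ 0 := by
    intro z w h
    obtain ⟨⟨a1, -⟩, b1, -⟩ := (hmem z w).mp h
    refine mul_ne_zero ?_ ?_
    · intro h; simp [h] at a1
    · intro h; simp [h] at b1
  have hroot : ∀ z w : Fin 2 → ℂ, (z, w) ∈ virtSet circleMat u v →
      (polyAt circlePoly u v).eval (z 0 * w 0) = 0 := by
    intro z w h
    obtain ⟨e1, e2⟩ := hlin z w h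
    rw [eval_circlePoly]
    linear_combination -((z 0 * w 0) ^ 2 * (u 0 * v 0) - u 1 * v 1) * w 0 * e1 -
      ((z 0 * w 0) ^ 2 - 1) * (z 0 * w 0 * u 0 + v 1) * e2
  refine ⟨?_, ?_, ?_⟩
  · rintro ⟨z, w⟩ h
    exact hroot z w h
  · rintro ⟨z, w⟩ h ⟨z', w'⟩ h' heq
    have hr := hD _ (hroot z w h)
    obtain ⟨e1, e2⟩ := hlin z w h
    obtain ⟨e1', e2'⟩ := hlin z' w' h'
    obtain ⟨⟨a1, -⟩, b1, -⟩ := (hmem z w).mp h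
    obtain ⟨⟨a1', -⟩, b1', -⟩ := (hmem z' w').mp h'
    dsimp only at heq
    rw [← heq] at e1' e2'
    have hz := mul_left_cancel₀ hr (e1.trans e1'.symm)
    have hw := mul_left_cancel₀ hr (e2.trans e2'.symm)
    have hz0 := left_ne_zero_of_mul (hne z w h)
    have hw0 := right_ne_zero_of_mul (hne z w h)
    rw [← hz] at a1'
    rw [← hw] at b1'
    have hz1 := mul_left_cancel₀ hz0 (a1.trans a1'.symm)
    have hw1 := mul_left_cancel₀ hw0 (b1.trans b1'.symm)
    rw [Prod.mk.injEq]
    constructor <;> funext j <;> fin_cases j <;> assumption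
  · intro r hr
    have hD := hD r hr
    have hr0 := hr0 r hr
    rw [Set.mem_ofPred_eq, eval_circlePoly] at hr
    set D := r ^ 2 * (u 0 * v 0) - u 1 * v 1 with hDdef
    set a := (r ^ 2 - 1) * (r * u 0 + v 1) / D with ha
    set b := (r ^ 2 - 1) * (r * v 0 + u 1) / D with hb
    have ea : D * a = (r ^ 2 - 1) * (r * u 0 + v 1) := by rw [ha]; field_simp
    have eb : D * b = (r ^ 2 - 1) * (r * v 0 + u 1) := by rw [hb]; field_simp
    have hab : a * b = r := by
      refine mul_left_cancel₀ (pow_ne_zero 2 hD) ?_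
      linear_combination eb * (D * a) + (r ^ 2 - 1) * (r * v 0 + u 1) * ea + hr
    have ha0 : a ≠ 0 := left_ne_zero_of_mul (hab.trans_ne hr0)
    have hb0 : b ≠ 0 := right_ne_zero_of_mul (hab.trans_ne hr0)
    have e1 : a * r * v 0 - b * v 1 = r ^ 2 - 1 := by
      refine mul_left_cancel₀ hD ?_
      linear_combination r * v 0 * ea - v 1 * eb - (r ^ 2 - 1) * hDdef
    have e2 : b * r * u 0 - a * u 1 = r ^ 2 - 1 := by
      refine mul_left_cancel₀ hD ?_
      linear_combination r * u 0 * eb - u 1 * ea - (r ^ 2 - 1) * hDdef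
    refine ⟨(![a, a⁻¹], ![b, b⁻¹]), (hmem _ _).mpr ?_, ?_⟩
    · simp only [Matrix.cons_val_zero, Matrix.cons_val_one]
      refine ⟨⟨mul_inv_cancel₀ ha0, ?_⟩, mul_inv_cancel₀ hb0, ?_⟩
      · field_simp
        linear_combination -e1 - (a * v 0 - (a * b + r)) * hab
      · field_simp
        linear_combination -e2 - (b * u 0 - (a * b + r)) * hab
    · simpa only [Matrix.cons_val_zero] using hab

/-- The roots would be the positive numbers |z₁|², so the coefficients alternate in sign. Those in
degrees 4 and 2 then give |u₂|² ≥ 2|u₁|² and |u₁|² ≥ 2|u₂|², hence u₁ = 0. But |u₁|² is the leading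
coefficient. -/
theorem six_notMem_openCounts_circleMat : 6 ∉ openCounts circleMat := by
  intro h6
  obtain ⟨u, -, hdeg, -, hbij, hroots⟩ :=
    rootCount_circleMat.all_roots h6 rootCount_circleMat.genericCount
  have hpos : ∀ p, (polyAt circlePoly u (star u)).eval p = 0 → ∃ r : ℝ, 0 < r ∧ p = r := by
    intro p hp
    obtain ⟨z, hz, rfl⟩ := hroots p hp
    have hz1 := ((conicNormal_circleMat _ _).mp hz).1
    have hz0 : z 0 ≠ 0 := by intro h; simp [h] at hz1
    refine ⟨‖z 0‖ ^ 2, by positivity, ?_⟩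
    have : z 0 * star (z 0) = (‖z 0‖ : ℂ) ^ 2 := by
      rw [Complex.star_def, Complex.mul_conj, Complex.normSq_eq_norm_sq]
      push_cast
      rfl
    simp only [Pi.star_apply, this]
    push_cast
    rfl
  obtain ⟨s, hs, hcard, hcoeff⟩ := coeff_of_pos_roots hpos
  have h2 := hcoeff 2 (by omega)
  have h4 := hcoeff 4 (by omega)
  rw [hdeg] at hcard
  have p2 := esymm_pos (fun x hx => (hs x hx).1) (i := 2) (by omega)
  have p4 := esymm_pos (fun x hx => (hs x hx).1) (i := 4) (by omega)
  obtain ⟨c6, c4, c2⟩ := coeff_circleFamily (u 0) (u 1) (star u 0) (star u 1)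
  rw [← polyAt_circlePoly] at c6 c4 c2
  rw [Polynomial.leadingCoeff, hdeg, c6] at h2 h4
  rw [c4] at h2
  rw [c2] at h4
  have e : ∀ i, u i * star u i = ((‖u i‖ ^ 2 : ℝ) : ℂ) := by
    intro i
    rw [Pi.star_apply, Complex.star_def, Complex.mul_conj, Complex.normSq_eq_norm_sq]
  rw [e, e] at h2 h4
  rw [e] at c6
  have h2' : ‖u 1‖ ^ 2 - 2 * ‖u 0‖ ^ 2 = ‖u 0‖ ^ 2 * (-1) ^ 2 * s.esymm 2 := by exact_mod_cast h2
  have h4' : ‖u 0‖ ^ 2 - 2 * ‖u 1‖ ^ 2 = ‖u 0‖ ^ 2 * (-1) ^ 4 * s.esymm 4 := by exact_mod_cast h4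
  have h0 : 0 ≤ ‖u 0‖ ^ 2 := by positivity
  have h1 : 0 ≤ ‖u 1‖ ^ 2 := by positivity
  have hu : ‖u 0‖ ^ 2 = 0 := by nlinarith [mul_nonneg h0 p2.le, mul_nonneg h0 p4.le]
  have hc : (polyAt circlePoly u (star u)).coeff 6 = 0 := by
    rw [c6, hu, Complex.ofReal_zero]
  have hP : polyAt circlePoly u (star u) ≠ 0 := by
    intro h
    rw [h] at hdeg
    simp at hdeg
  rw [← hdeg, Polynomial.coeff_natDegree, Polynomial.leadingCoeff_eq_zero] at hc
  exact hP hc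

theorem openCounts_circleMat : openCounts circleMat = {2, 4} := by
  ext k
  simp only [Set.mem_insert_iff, Set.mem_singleton_iff]
  constructor
  · intro hk
    obtain ⟨h1, h2⟩ := rootCount_circleMat.genericCount.mod_two hk
    have h3 : k ≠ 6 := by
      rintro rfl
      exact six_notMem_openCounts_circleMat hk
    have h4 : k ≠ 0 := by
      rintro rfl
      obtain ⟨U, -, ⟨u, hu⟩, h⟩ := hk
      have hd : circleMat.det ≠ 0 := by
        rw [circleMat, det_symMat]
        norm_num
      have := exists_mem_critSet (A := circleMat) (isSymm_symMat _ _ _ _ _ _) hd (z₀ := ![1, 1])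
        (by rw [conicVal_circleMat]; simp) u
      rw [← Set.encard_pos, h u hu] at this
      simp at this
    omega
  · rw [← sameCounts_circle.2]
    rintro (rfl | rfl)
    · exact two_mem_openCounts_ellipseMat le_rfl
    · exact four_mem_openCounts_ellipseMat_one

end Circle

end HermitianDistance
end

open MvPolynomial
noncomputable section
namespace HermitianDistance

/-! ### The octic of an ellipse -/

section Octic

variable {R : Type*} [CommRing R]

/-- The polynomial `W` of the elimination. -/
def octicW (k a b p : R) : R := a ^ 2 * (1 - k ^ 2 * p) + k * b ^ 2 * (1 - p) - (1 - p) * (1 - k ^ 2 * p)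

/-- The polynomial `S` of the elimination. -/
def octicS (k a b c d p : R) : R :=
  a * c * (1 - k ^ 2 * p) ^ 2 + k ^ 2 * (b * d) * (1 - p) ^ 2

/-- The polynomial `E` of the elimination. -/
def octicE (k a b c d p : R) : R :=
  k * (a ^ 2 * d ^ 2 + b ^ 2 * c ^ 2) * (1 - k ^ 2 * p ^ 2) -
    ((a ^ 2 + c ^ 2) * (1 - k ^ 2 * p) ^ 2 + k * (b ^ 2 + d ^ 2) * (1 - p) ^ 2) +
    (1 - p) ^ 2 * (1 - k ^ 2 * p) ^ 2

/-- The determinant of the linear equations for the multipliers, up to a factor. -/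
def octicD (k a b c d p : R) : R :=
  (a * c) ^ 2 * (1 - k ^ 2 * p) ^ 3 * (1 + p) + k ^ 2 * (b * d) ^ 2 * (1 - p) ^ 3 * (1 + k ^ 2 * p) +
    (1 - p) * (1 - k ^ 2 * p) * octicE k a b c d p

/-- The terms of lower degree of the octic. -/
def octicLow (k a b c d p : R) : R :=
  -(a * c) ^ 4 * (1 - k ^ 2 * p) ^ 4 - k ^ 4 * (b * d) ^ 4 * (1 - p) ^ 4 +
    (a * c) ^ 2 * (b * d) ^ 2 * k ^ 2 * (4 * p * ((1 - k ^ 2 * p) ^ 2 + k ^ 2 * (1 - p) ^ 2) -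
      2 * (1 - p) * (1 - k ^ 2 * p) * (1 + p) * (1 + k ^ 2 * p)) +
    8 * p * k ^ 2 * (a * c) * (b * d) * octicW k a b p * octicW k c d p +
    (1 - k ^ 2 * p) ^ 2 * (a * c) ^ 2 * (-2 * k * (a ^ 2 * d ^ 2 + b ^ 2 * c ^ 2) *
      (1 + k ^ 2 * p ^ 2) + 2 * (1 - k ^ 2 * p) ^ 2 * (a ^ 2 + c ^ 2) +
      k * (b ^ 2 + d ^ 2) * (2 * (1 + p) * (1 - p) - 4 * p * (1 - k ^ 2 * p)) +
      4 * p * (1 - k ^ 2 * p) ^ 2 - 2 * (1 + p) * (1 - p) * (1 - k ^ 2 * p) ^ 2) +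
    k ^ 2 * (b * d) ^ 2 * (1 - p) ^ 2 * (-2 * k * (a ^ 2 * d ^ 2 + b ^ 2 * c ^ 2) *
      (1 + k ^ 2 * p ^ 2) + 2 * k * (1 - p) ^ 2 * (b ^ 2 + d ^ 2) +
      (a ^ 2 + c ^ 2) * (2 * (1 + k ^ 2 * p) * (1 - k ^ 2 * p) - 4 * p * k ^ 2 * (1 - p)) +
      4 * p * k ^ 2 * (1 - p) ^ 2 - 2 * (1 + k ^ 2 * p) * (1 - p) ^ 2 * (1 - k ^ 2 * p))

/-- The resolvent of the critical equations of the ellipse `z₁² + k z₂² = 1`. -/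
def octic (k a b c d p : R) : R := octicLow k a b c d p - octicE k a b c d p ^ 2

/-- For multipliers l, m with lm = p, Cramer's rule gives D l = 2p S W(c, d) and D m = 2p S W(a, b).
Multiplying them forces the right-hand side to vanish for p ≠ 0. The octic is what remains after
removing the spurious factors 1 - p and 1 - k²p. -/
theorem octic_identity (k a b c d p : R) :
    (1 - p) ^ 2 * (1 - k ^ 2 * p) ^ 2 * octic k a b c d p =
      4 * p * octicS k a b c d p ^ 2 * octicW k a b p * octicW k c d p - octicD k a b c d p ^ 2 := by
  simp only [octic, octicD, octicLow, octicE, octicS, octicW]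
  ring

/-- The right-hand side is the determinant of the two linear equations that the multipliers satisfy
once their product is fixed. -/
theorem octicD_identity (k a b c d p : R) :
    (1 - p) * (1 - k ^ 2 * p) * octicD k a b c d p =
      (a ^ 2 * (1 - k ^ 2 * p) ^ 2 + k * b ^ 2 * (1 - p) ^ 2 - (1 - p) ^ 2 * (1 - k ^ 2 * p) ^ 2) *
      (c ^ 2 * (1 - k ^ 2 * p) ^ 2 + k * d ^ 2 * (1 - p) ^ 2 - (1 - p) ^ 2 * (1 - k ^ 2 * p) ^ 2) -
      p ^ 2 * (a ^ 2 * (1 - k ^ 2 * p) ^ 2 + k ^ 3 * b ^ 2 * (1 - p) ^ 2) *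
        (c ^ 2 * (1 - k ^ 2 * p) ^ 2 + k ^ 3 * d ^ 2 * (1 - p) ^ 2) := by
  simp only [octicD, octicE]
  ring

theorem map_octic {R' : Type*} [CommRing R'] (φ : R →+* R') (k a b c d p : R) :
    φ (octic k a b c d p) = octic (φ k) (φ a) (φ b) (φ c) (φ d) (φ p) := by
  simp only [octic, octicLow, octicE, octicW, map_add, map_sub, map_mul, map_pow, map_neg, map_one,
    map_ofNat]

/-- The octic as a polynomial. -/
def octicFamily (k a b c d : R) : Polynomial R :=
  octic (Polynomial.C k) (Polynomial.C a) (Polynomial.C b) (Polynomial.C c) (Polynomial.C d)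
    Polynomial.X

theorem eval_octicFamily (k a b c d p : R) :
    (octicFamily k a b c d).eval p = octic k a b c d p := by
  have := map_octic (Polynomial.evalRingHom p) (Polynomial.C k) (Polynomial.C a) (Polynomial.C b)
    (Polynomial.C c) (Polynomial.C d) Polynomial.X
  simpa [octicFamily] using this

theorem map_octicFamily {R' : Type*} [CommRing R'] (φ : R →+* R') (k a b c d : R) :
    (octicFamily k a b c d).map φ = octicFamily (φ k) (φ a) (φ b) (φ c) (φ d) := by
  have := map_octic (Polynomial.mapRingHom φ) (Polynomial.C k) (Polynomial.C a) (Polynomial.C b)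
    (Polynomial.C c) (Polynomial.C d) Polynomial.X
  simpa [octicFamily] using this

theorem degree_octicE (k a b c d : R) :
    (octicE (Polynomial.C k) (Polynomial.C a) (Polynomial.C b) (Polynomial.C c) (Polynomial.C d) Polynomial.X).natDegree ≤ 4 ∧
      (octicE (Polynomial.C k) (Polynomial.C a) (Polynomial.C b) (Polynomial.C c) (Polynomial.C d) Polynomial.X).coeff 4 = k ^ 4 := by
  have : octicE (Polynomial.C k) (Polynomial.C a) (Polynomial.C b) (Polynomial.C c) (Polynomial.C d) Polynomial.X = Polynomial.C (k ^ 4) * Polynomial.X ^ 4 +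
      Polynomial.C (-2 * k ^ 2 * (1 + k ^ 2)) * Polynomial.X ^ 3 +
      Polynomial.C (-k ^ 3 * (a ^ 2 * d ^ 2 + b ^ 2 * c ^ 2) - ((a ^ 2 + c ^ 2) * k ^ 4 + k * (b ^ 2 + d ^ 2)) +
        (1 + 4 * k ^ 2 + k ^ 4)) * Polynomial.X ^ 2 +
      Polynomial.C (2 * ((a ^ 2 + c ^ 2) * k ^ 2 + k * (b ^ 2 + d ^ 2)) - 2 * (1 + k ^ 2)) * Polynomial.X ^ 1 +
      Polynomial.C (k * (a ^ 2 * d ^ 2 + b ^ 2 * c ^ 2) - (a ^ 2 + c ^ 2) - k * (b ^ 2 + d ^ 2) + 1) := by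
    simp only [octicE, map_add, map_sub, map_mul, map_pow, map_neg, map_ofNat, map_one]
    ring
  rw [this]
  constructor
  · compute_degree
  · simp only [Polynomial.coeff_add, Polynomial.coeff_C_mul, Polynomial.coeff_X_pow, Polynomial.coeff_C]
    simp

theorem natDegree_octicLow (k a b c d : R) :
    (octicLow (Polynomial.C k) (Polynomial.C a) (Polynomial.C b) (Polynomial.C c) (Polynomial.C d) Polynomial.X).natDegree ≤ 7 := by
  unfold octicLow octicW
  compute_degree
  norm_num

theorem natDegree_octicFamily (k a b c d : R) : (octicFamily k a b c d).natDegree ≤ 8 := by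
  unfold octicFamily octic
  refine (Polynomial.natDegree_sub_le _ _).trans (max_le
    ((natDegree_octicLow k a b c d).trans (by norm_num)) ?_)
  exact Polynomial.natDegree_pow_le_of_le 2 (degree_octicE k a b c d).1

/-- Only the term `octicE ^ 2` reaches degree 8. -/
theorem coeff_octicFamily (k a b c d : R) : (octicFamily k a b c d).coeff 8 = -k ^ 8 := by
  have h := Polynomial.coeff_pow_of_natDegree_le (m := 2) (degree_octicE k a b c d).1
  rw [show 2 * 4 = 8 from rfl, (degree_octicE k a b c d).2] at h
  unfold octicFamily octic
  rw [Polynomial.coeff_sub, Polynomial.coeff_eq_zero_of_natDegree_lt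
    (lt_of_le_of_lt (natDegree_octicLow k a b c d) (by norm_num)), h]
  ring

end Octic

end HermitianDistance
end

open MvPolynomial
noncomputable section
namespace HermitianDistance

/-- A small perturbation of the negative square of a separable polynomial is separable if it moves
the roots. -/
theorem exists_separable_perturbation {Q P T : Polynomial ℂ} {n : ℕ} (hn : n ≠ 0)
    (hQn : Q.natDegree = n) (hP : P.natDegree ≤ 2 * n) (hT : T.natDegree ≤ 2 * n)
    (hQ : Q.Separable) (hQP : IsCoprime Q P) :
    ∃ t : ℂ, t ≠ 0 ∧ (-Q ^ 2 + Polynomial.C t * P + Polynomial.C (t ^ 2) * T).Separable := by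
  let i : ℂ →+* Polynomial ℂ := Polynomial.C
  let F : Polynomial (Polynomial ℂ) := -(Q.map i) ^ 2 + Polynomial.C Polynomial.X * P.map i +
    Polynomial.C (Polynomial.X ^ 2) * T.map i
  -- For f = -Q² + tP + t²T the combination Qf' - 2Q'f equals t (D P + t D T), so for t ≠ 0 a double
  -- root of f is a common root of f and D P + t D T. At t = 0 these are -Q² and QP' - 2Q'P, which
  -- are coprime. Their resultant is a polynomial in t that is nonzero at 0, so almost every t
  -- works.
  let D (P : Polynomial ℂ) : Polynomial ℂ :=
    Q * Polynomial.derivative P - 2 * Polynomial.derivative Q * P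
  let K : Polynomial (Polynomial ℂ) := (D P).map i + Polynomial.C Polynomial.X * (D T).map i
  have hi : ∀ t, (Polynomial.evalRingHom t).comp i = RingHom.id ℂ := by
    intro t
    ext x
    simp [i]
  have hFm : ∀ t, F.map (Polynomial.evalRingHom t) =
      -Q ^ 2 + Polynomial.C t * P + Polynomial.C (t ^ 2) * T := by
    intro t
    simp [F, Polynomial.map_map, hi]
  have hKm : ∀ t, K.map (Polynomial.evalRingHom t) = D P + Polynomial.C t * D T := by
    intro t
    simp only [K, Polynomial.map_add, Polynomial.map_mul, Polynomial.map_map, hi, Polynomial.map_C,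
      Polynomial.map_id, Polynomial.coe_evalRingHom, Polynomial.eval_X]
  have hF : F.natDegree ≤ 2 * n := by
    refine Polynomial.natDegree_add_le_of_degree_le (Polynomial.natDegree_add_le_of_degree_le ?_ ?_) ?_
    · rw [Polynomial.natDegree_neg]
      exact Polynomial.natDegree_pow_le_of_le 2 (Polynomial.natDegree_map_le.trans hQn.le)
    · exact (Polynomial.natDegree_C_mul_le _ _).trans (Polynomial.natDegree_map_le.trans hP)
    · exact (Polynomial.natDegree_C_mul_le _ _).trans (Polynomial.natDegree_map_le.trans hT)
  obtain ⟨g, hg, hg'⟩ := exists_isCoprime_map_iff F K (by omega : 2 * n ≠ 0) hF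
  have hg0 : Polynomial.evalRingHom 0 g ≠ 0 := by
    refine hg' _ ?_ ?_
    · rw [← Polynomial.coeff_map, hFm]
      have := Polynomial.coeff_pow_of_natDegree_le (m := 2) hQn.le
      rw [Polynomial.C_0]
      simp only [zero_mul, add_zero, ne_eq, OfNat.ofNat_ne_zero, not_false_eq_true, zero_pow,
        Polynomial.C_0, Polynomial.coeff_neg, this, neg_eq_zero]
      rw [← hQn]
      exact pow_ne_zero _ (Polynomial.leadingCoeff_ne_zero.mpr hQ.ne_zero)
    · rw [hFm, hKm, Polynomial.isCoprime_iff_aeval_ne_zero_of_isAlgClosed ℂ ℂ]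
      intro p
      by_contra! h
      obtain ⟨h1, h2⟩ := h
      rw [Polynomial.isCoprime_iff_aeval_ne_zero_of_isAlgClosed ℂ ℂ] at hQP
      have hQ' : IsCoprime _ _ := hQ
      rw [Polynomial.isCoprime_iff_aeval_ne_zero_of_isAlgClosed ℂ ℂ] at hQ'
      have h3 : Q.eval p = 0 := by simpa using h1
      simp [D, h3] at h2
      rcases h2 with h2 | h2
      · exact (hQ' p).elim (fun h => h h3) (fun h => h h2)
      · exact (hQP p).elim (fun h => h h3) (fun h => h h2)
  have hgne : g ≠ 0 := by
    rintro rfl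
    simp at hg0
  obtain ⟨t, ht⟩ := ((Set.finite_singleton (0 : ℂ)).union
    g.roots.toFinset.finite_toSet).infinite_compl.nonempty
  simp only [Set.mem_compl_iff, Set.mem_union, Set.mem_singleton_iff, Finset.mem_coe,
    Multiset.mem_toFinset, Polynomial.mem_roots hgne, Polynomial.IsRoot.def, not_or] at ht
  refine ⟨t, ht.1, ?_⟩
  have hco := hg (Polynomial.evalRingHom t) ht.2
  rw [hFm, hKm] at hco
  set f := -Q ^ 2 + Polynomial.C t * P + Polynomial.C (t ^ 2) * T with hf
  have hid : Q * Polynomial.derivative f - 2 * Polynomial.derivative Q * f =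
      Polynomial.C t * (D P + Polynomial.C t * D T) := by
    simp only [hf, D, Polynomial.derivative_add, Polynomial.derivative_neg, Polynomial.derivative_pow,
      Polynomial.derivative_C_mul, Nat.cast_ofNat, map_ofNat]
    simp only [Polynomial.C_pow]
    ring
  change IsCoprime _ _
  rw [Polynomial.isCoprime_iff_aeval_ne_zero_of_isAlgClosed ℂ ℂ] at hco ⊢
  intro p
  by_contra! h
  obtain ⟨h1, h2⟩ := h
  simp only [Polynomial.coe_aeval_eq_eval] at h1 h2 hco
  have := congrArg (Polynomial.eval p) hid
  rw [Polynomial.eval_sub, Polynomial.eval_mul, Polynomial.eval_mul, h1, h2,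
    Polynomial.eval_mul (p := Polynomial.C t), Polynomial.eval_C] at this
  rcases hco p with h | h
  · exact h h1
  · exact mul_ne_zero ht.1 h (by linear_combination -this)

/-! ### A separable member of the family of octics -/

section Separable

variable {R : Type*} [CommRing R]

/-- The square root of the octic at `a = d = 0`, up to sign. -/
def octicQ (k x y p : R) : R :=
  (1 - k ^ 2 * p) ^ 2 * ((1 - p) ^ 2 - y) + x * (y * (1 - k ^ 2 * p ^ 2) - (1 - p) ^ 2)

/-- The coefficient of `a ^ 2` in the octic at `d = 0`. -/
def octicP (k x y p : R) : R :=
  2 * octicQ k x y p * (1 - k ^ 2 * p) ^ 2 + y * (1 - k ^ 2 * p) ^ 2 *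
    (-2 * y * x * (1 + k ^ 2 * p ^ 2) + 2 * (1 - k ^ 2 * p) ^ 2 * y +
      x * (2 * (1 + p) * (1 - p) - 4 * p * (1 - k ^ 2 * p)) + 4 * p * (1 - k ^ 2 * p) ^ 2 -
      2 * (1 + p) * (1 - p) * (1 - k ^ 2 * p) ^ 2)

/-- For a = d = 0 the octic is minus a square, hence never separable. The expansion in a² shows how
the double roots split. -/
theorem octic_eq_perturbation (k a b c p : R) : octic k a b c 0 p =
    -octicQ k (k * b ^ 2) (c ^ 2) p ^ 2 + a ^ 2 * octicP k (k * b ^ 2) (c ^ 2) p +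
      (a ^ 2) ^ 2 * -((1 - k ^ 2 * p) ^ 4 * (c ^ 2 - 1) ^ 2) := by
  simp only [octic, octicLow, octicE, octicP, octicQ]
  ring

/-- Modulo `octicQ` the perturbation term becomes a product of simple factors, so its zeros at roots
of `octicQ` can be ruled out one factor at a time. -/
theorem octicP_mul (k x y p : R) : octicP k x y p * (1 - p) =
    4 * p * y * (y - (1 - p)) * (x - (1 - k ^ 2 * p)) * (1 - k ^ 2 * p) ^ 3 -
      2 * octicQ k x y p * (1 - k ^ 2 * p) ^ 2 * (y * (1 + p) - (1 - p)) := by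
  simp only [octicP, octicQ]
  ring

theorem octicQ_eq (k x y p : R) : octicQ k x y p =
    (1 - k ^ 2 * p) * k ^ 2 * p * (1 - p) * (y - (1 - p)) +
      (x - (1 - k ^ 2 * p)) * (y * (1 - k ^ 2 * p ^ 2) - (1 - p) ^ 2) := by
  simp only [octicQ]
  ring

theorem map_octicQ {R' : Type*} [CommRing R'] (φ : R →+* R') (k x y p : R) :
    φ (octicQ k x y p) = octicQ (φ k) (φ x) (φ y) (φ p) := by
  simp only [octicQ, map_add, map_sub, map_mul, map_pow, map_one]

theorem map_octicP {R' : Type*} [CommRing R'] (φ : R →+* R') (k x y p : R) :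
    φ (octicP k x y p) = octicP (φ k) (φ x) (φ y) (φ p) := by
  simp only [octicP, map_octicQ, map_add, map_sub, map_mul, map_pow, map_neg, map_one, map_ofNat]

theorem degree_octicQ (k x y : R) :
    (octicQ (Polynomial.C k) (Polynomial.C x) (Polynomial.C y) Polynomial.X).natDegree ≤ 4 ∧
    (octicQ (Polynomial.C k) (Polynomial.C x) (Polynomial.C y) Polynomial.X).coeff 4 = k ^ 4 := by
  have : octicQ (Polynomial.C k) (Polynomial.C x) (Polynomial.C y) Polynomial.X =
      Polynomial.C (k ^ 4) * Polynomial.X ^ 4 +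
      Polynomial.C (-2 * k ^ 2 * (1 + k ^ 2)) * Polynomial.X ^ 3 +
      Polynomial.C (1 + 4 * k ^ 2 + k ^ 4 - y * k ^ 4 - x * (y * k ^ 2 + 1)) * Polynomial.X ^ 2 +
      Polynomial.C (2 * y * k ^ 2 + 2 * x - 2 * (1 + k ^ 2)) * Polynomial.X ^ 1 +
      Polynomial.C (1 - y + x * (y - 1)) := by
    simp only [octicQ, map_add, map_sub, map_mul, map_pow, map_neg, map_ofNat, map_one]
    ring
  rw [this]
  constructor
  · compute_degree
  · simp only [Polynomial.coeff_add, Polynomial.coeff_C_mul, Polynomial.coeff_X_pow,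
      Polynomial.coeff_C]
    simp

theorem natDegree_octicP (k x y : R) :
    (octicP (Polynomial.C k) (Polynomial.C x) (Polynomial.C y) Polynomial.X).natDegree ≤ 8 := by
  unfold octicP octicQ
  compute_degree
  norm_num

end Separable

/-- Take d = 0 and c = 2. The quartic `octicQ` is a pencil in x = k b² and is separable for almost
all x. For almost all x it is also coprime to `octicP`, and a suitable nonzero value of a² then
separates the double roots. The factor 3k² + 1 comes from the coprimality of the pencil for c² = 4.
-/
theorem exists_separable_octicFamily {k : ℂ} (hk0 : k ≠ 0) (hk1 : k ^ 2 ≠ 1)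
    (hk3 : 3 * k ^ 2 + 1 ≠ 0) : ∃ a b c : ℂ, (octicFamily k a b c 0).Separable := by
  have hk2 : k ^ 2 ≠ 0 := pow_ne_zero 2 hk0
  have hev : ∀ x p : ℂ, (octicQ (Polynomial.C k) (Polynomial.C x) (Polynomial.C 4)
      Polynomial.X).eval p = octicQ k x 4 p := by
    intro x p
    have := map_octicQ (Polynomial.evalRingHom p) (Polynomial.C k) (Polynomial.C x)
      (Polynomial.C 4) Polynomial.X
    simpa using this
  have hevP : ∀ x p : ℂ, (octicP (Polynomial.C k) (Polynomial.C x) (Polynomial.C 4)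
      Polynomial.X).eval p = octicP k x 4 p := by
    intro x p
    have := map_octicP (Polynomial.evalRingHom p) (Polynomial.C k) (Polynomial.C x)
      (Polynomial.C 4) Polynomial.X
    simpa using this
  let B : Polynomial ℂ := 1 - Polynomial.C k ^ 2 * Polynomial.X
  let A : Polynomial ℂ := 1 - Polynomial.X
  have hfin : {x : ℂ | ¬ (B ^ 2 * (A ^ 2 - Polynomial.C 4) + Polynomial.C x *
      (Polynomial.C 4 * (1 - Polynomial.C k ^ 2 * Polynomial.X ^ 2) - A ^ 2)).Separable}.Finite := by
    refine finite_not_separable_pencil ?_ ?_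
    · rw [Polynomial.isCoprime_iff_aeval_ne_zero_of_isAlgClosed ℂ ℂ]
      intro p
      by_contra! h
      simp [A, B] at h
      obtain ⟨h1 | h1, h2⟩ := h
      · have h3 : (k ^ 2 - 1) * (3 * k ^ 2 + 1) = 0 := by
          linear_combination k ^ 4 * h2 + (-4 * k ^ 4 * p - 4 * k ^ 2 + k ^ 2 * (2 - p) - 1) * h1
        exact mul_ne_zero (sub_ne_zero.mpr hk1) hk3 h3
      · have h3 : k ^ 2 * p ^ 2 = 0 := by linear_combination (-h1 - h2) / 4
        have hp : p = 0 := by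
          have := (mul_eq_zero.mp h3).resolve_left hk2
          exact pow_eq_zero_iff two_ne_zero |>.mp this
        rw [hp] at h1
        norm_num at h1
    · intro h
      have := congrArg (Polynomial.eval 0) h
      simp [A, B, Polynomial.derivative_pow] at this
      apply hk2
      linear_combination this / 18
  -- These values of x are excluded for a common root of `octicQ` and `octicP`: 0 when 1 - k²p = 0,
  -- and the other three for p = 0, 1 and -3.
  obtain ⟨x, hx⟩ := (hfin.union (Set.toFinite {0, 1, 1 - k ^ 2, 1 + 3 * k ^ 2})).infinite_compl.nonempty
  simp only [Set.mem_compl_iff, Set.mem_union, Set.mem_ofPred_eq, not_or, not_not,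
    Set.mem_singleton_iff, Set.mem_insert_iff] at hx
  obtain ⟨hx, hx0, hx1, hx2, hx3⟩ := hx
  have hQ : octicQ (Polynomial.C k) (Polynomial.C x) (Polynomial.C 4) Polynomial.X =
      B ^ 2 * (A ^ 2 - Polynomial.C 4) + Polynomial.C x *
      (Polynomial.C 4 * (1 - Polynomial.C k ^ 2 * Polynomial.X ^ 2) - A ^ 2) := rfl
  rw [← hQ] at hx
  have hdeg := degree_octicQ k x 4
  have hcop : IsCoprime (octicQ (Polynomial.C k) (Polynomial.C x) (Polynomial.C 4) Polynomial.X)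
      (octicP (Polynomial.C k) (Polynomial.C x) (Polynomial.C 4) Polynomial.X) := by
    rw [Polynomial.isCoprime_iff_aeval_ne_zero_of_isAlgClosed ℂ ℂ]
    intro p
    by_contra! h
    simp only [Polynomial.coe_aeval_eq_eval, hev, hevP] at h
    obtain ⟨h1, h2⟩ := h
    have h3 := octicP_mul k x 4 p
    have h4 := octicQ_eq k x 4 p
    rw [h1, h2] at h3
    rw [h1] at h4
    have h5 : p * (4 - (1 - p)) * (x - (1 - k ^ 2 * p)) * (1 - k ^ 2 * p) ^ 3 = 0 := by
      linear_combination -h3 / 16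
    rw [octicQ] at h1
    have hB : 1 - k ^ 2 * p ≠ 0 := by
      intro hB
      have h6 : 4 * (1 - k ^ 2 * p ^ 2) - (1 - p) ^ 2 = 0 := by
        refine mul_left_cancel₀ hx0 ?_
        rw [mul_zero, ← h1, hB]
        ring
      have h3 : (k ^ 2 - 1) * (3 * k ^ 2 + 1) = 0 := by
        linear_combination k ^ 4 * h6 + (-4 * k ^ 4 * p - 4 * k ^ 2 + k ^ 2 * (2 - p) - 1) * hB
      exact mul_ne_zero (sub_ne_zero.mpr hk1) hk3 h3
    have h6 := (mul_eq_zero.mp h5).resolve_right (pow_ne_zero 3 hB)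
    rcases mul_eq_zero.mp h6 with h7 | h7
    · rcases mul_eq_zero.mp h7 with h | h
      · rw [h] at h1
        exact hx1 (by linear_combination h1 / 3)
      · have hp : p = -3 := by linear_combination h
        rw [hp] at h1 hB
        refine hx3 (mul_left_cancel₀ hB ?_)
        linear_combination -h1 / 12
    · rw [h7] at h4
      have h8 : (1 - k ^ 2 * p) * k ^ 2 * p * (1 - p) * (4 - (1 - p)) = 0 := by
        linear_combination -h4
      rcases mul_eq_zero.mp h8 with h8 | h
      · rcases mul_eq_zero.mp h8 with h8 | h
        · rcases mul_eq_zero.mp h8 with h8 | h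
          · exact mul_ne_zero hB hk2 h8
          · exact hx1 (by linear_combination h7 - k ^ 2 * h)
        · exact hx2 (by linear_combination h7 + k ^ 2 * h)
      · exact hx3 (by linear_combination h7 - k ^ 2 * h)
  obtain ⟨t, ht, hsep⟩ := exists_separable_perturbation
    (T := -((1 - Polynomial.C k ^ 2 * Polynomial.X) ^ 4 * (Polynomial.C 2 ^ 2 - 1) ^ 2))
    four_ne_zero
    (Polynomial.natDegree_eq_of_le_of_coeff_ne_zero hdeg.1
      (by rw [hdeg.2]; exact pow_ne_zero 4 hk0))
    (natDegree_octicP k x 4) (by compute_degree; norm_num) hx hcop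
  obtain ⟨a, rfl⟩ := IsAlgClosed.exists_pow_nat_eq t two_pos
  obtain ⟨b, hb⟩ := IsAlgClosed.exists_pow_nat_eq (x / k) two_pos
  refine ⟨a, b, 2, ?_⟩
  have hb' : x = k * b ^ 2 := by rw [hb]; field_simp
  have h4 : (Polynomial.C 4 : Polynomial ℂ) = Polynomial.C 2 ^ 2 := by
    rw [← Polynomial.C_pow]
    norm_num
  rw [octicFamily, Polynomial.C_0, octic_eq_perturbation]
  rw [hb', h4] at hsep
  simpa only [Polynomial.C_mul, Polynomial.C_pow] using hsep

end HermitianDistance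
end

open MvPolynomial
noncomputable section
namespace HermitianDistance

/-! ### The virtual critical points of an ellipse -/

/-- The equations of the virtual critical points of the ellipse with multipliers `l` and `m`. -/
structure EllipseSolution (k a b c d z₀ z₁ w₀ w₁ l m : ℂ) : Prop where
  hz : z₀ ^ 2 + k * z₁ ^ 2 = 1
  hw : w₀ ^ 2 + k * w₁ ^ 2 = 1
  h0 : c - w₀ = l * z₀
  h1 : d - w₁ = l * (k * z₁)
  h2 : a - z₀ = m * w₀
  h3 : b - z₁ = m * (k * w₁)

variable {k a b c d z₀ z₁ w₀ w₁ l m p : ℂ}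

namespace EllipseSolution

theorem symm (h : EllipseSolution k a b c d z₀ z₁ w₀ w₁ l m) :
    EllipseSolution k c d a b w₀ w₁ z₀ z₁ m l :=
  ⟨h.hw, h.hz, h.h2, h.h3, h.h0, h.h1⟩

theorem z₀_mul (h : EllipseSolution k a b c d z₀ z₁ w₀ w₁ l m) :
    z₀ * (1 - l * m) = a - m * c := by
  linear_combination -h.h2 + m * h.h0

theorem z₁_mul (h : EllipseSolution k a b c d z₀ z₁ w₀ w₁ l m) :
    z₁ * (1 - k ^ 2 * (l * m)) = b - k * m * d := by
  linear_combination -h.h3 + m * k * h.h1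

theorem w₀_mul (h : EllipseSolution k a b c d z₀ z₁ w₀ w₁ l m) :
    w₀ * (1 - l * m) = c - l * a := by
  linear_combination -h.h0 + l * h.h2

theorem w₁_mul (h : EllipseSolution k a b c d z₀ z₁ w₀ w₁ l m) :
    w₁ * (1 - k ^ 2 * (l * m)) = d - k * l * b := by
  linear_combination -h.h1 + l * k * h.h3

theorem lm_ne_zero (h : EllipseSolution k a b c d z₀ z₁ w₀ w₁ l m)
    (hac : (a ^ 2 + k * b ^ 2 - 1) * (c ^ 2 + k * d ^ 2 - 1) ≠ 0) : l * m ≠ 0 := by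
  have h0 := h.h0
  have h1 := h.h1
  have h2 := h.h2
  have h3 := h.h3
  intro hlm
  apply hac
  rcases mul_eq_zero.mp hlm with rfl | rfl
  · have e0 : c = w₀ := by linear_combination h0
    have e1 : d = w₁ := by linear_combination h1
    rw [e0, e1, h.hw]
    ring
  · have e0 : a = z₀ := by linear_combination h2
    have e1 : b = z₁ := by linear_combination h3
    rw [e0, e1, h.hz]
    ring

/-- If lm = 1, the conic equations determine the squares of c z₀ and of ac - c z₀ in terms of a, b,
c, d. Eliminating c z₀ gives exactly the relation excluded by the hypothesis. The case k²lm = 1 is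
analogous with d z₁. -/
theorem lm_ne_one (h : EllipseSolution k a b c d z₀ z₁ w₀ w₁ l m)
    (hG : ((1 - k ^ 2) ^ 2 * (a * c) ^ 2 + ((1 - k ^ 2) ^ 2 * c ^ 2 - k * (b * c - k * a * d) ^ 2) -
      ((1 - k ^ 2) ^ 2 * a ^ 2 - k * (a * d - k * b * c) ^ 2)) ^ 2 -
      4 * (a * c) ^ 2 * (1 - k ^ 2) ^ 2 *
        ((1 - k ^ 2) ^ 2 * c ^ 2 - k * (b * c - k * a * d) ^ 2) ≠ 0) : l * m ≠ 1 := by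
  intro hp
  have e0 := h.z₀_mul
  have e1 := h.z₁_mul
  have e2 := h.w₀_mul
  have e3 := h.w₁_mul
  rw [hp] at e0 e1 e2 e3
  have f0 : c * ((1 - k ^ 2) * z₁) = b * c - k * a * d := by
    linear_combination c * e1 - k * d * e0
  have f1 : a * w₀ = a * c - c * z₀ := by linear_combination -z₀ * e2 - a * h.h0
  have f2 : a * ((1 - k ^ 2) * w₁) = a * d - k * b * c := by
    linear_combination a * e3 - k * b * e2
  have g1 : (1 - k ^ 2) ^ 2 * (c * z₀) ^ 2 =
      (1 - k ^ 2) ^ 2 * c ^ 2 - k * (b * c - k * a * d) ^ 2 := by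
    rw [← f0]
    linear_combination (1 - k ^ 2) ^ 2 * c ^ 2 * h.hz
  have g2 : (1 - k ^ 2) ^ 2 * (a * c - c * z₀) ^ 2 =
      (1 - k ^ 2) ^ 2 * a ^ 2 - k * (a * d - k * b * c) ^ 2 := by
    rw [← f2, ← f1]
    linear_combination (1 - k ^ 2) ^ 2 * a ^ 2 * h.hw
  apply hG
  rw [← g1, ← g2]
  ring

theorem lm_ne_inv (h : EllipseSolution k a b c d z₀ z₁ w₀ w₁ l m)
    (hG : ((k ^ 2 - 1) ^ 2 * k * (b * d) ^ 2 +
      ((k ^ 2 - 1) ^ 2 * d ^ 2 - (k ^ 2 * (a * d) - k * (b * c)) ^ 2) -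
      ((k ^ 2 - 1) ^ 2 * b ^ 2 - (k ^ 2 * (b * c) - k * (a * d)) ^ 2)) ^ 2 -
      4 * (k ^ 2 - 1) ^ 2 * k * (b * d) ^ 2 *
        ((k ^ 2 - 1) ^ 2 * d ^ 2 - (k ^ 2 * (a * d) - k * (b * c)) ^ 2) ≠ 0) :
    k ^ 2 * (l * m) ≠ 1 := by
  intro hp
  have e0 := h.z₀_mul
  have e1 := h.z₁_mul
  have e2 := h.w₀_mul
  have e3 := h.w₁_mul
  rw [hp] at e1 e3
  have f0 : (k ^ 2 - 1) * (d * z₀) = k ^ 2 * (a * d) - k * (b * c) := by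
    linear_combination k ^ 2 * d * e0 + d * z₀ * hp - k * c * e1
  have f1 : b * w₁ = b * d - d * z₁ := by linear_combination -z₁ * e3 - b * h.h1
  have f2 : (k ^ 2 - 1) * (b * w₀) = k ^ 2 * (b * c) - k * (a * d) := by
    linear_combination k ^ 2 * b * e2 + b * w₀ * hp - k * a * e3
  have g1 : (k ^ 2 - 1) ^ 2 * k * (d * z₁) ^ 2 =
      (k ^ 2 - 1) ^ 2 * d ^ 2 - (k ^ 2 * (a * d) - k * (b * c)) ^ 2 := by
    rw [← f0]
    linear_combination (k ^ 2 - 1) ^ 2 * d ^ 2 * h.hz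
  have g2 : (k ^ 2 - 1) ^ 2 * k * (b * d - d * z₁) ^ 2 =
      (k ^ 2 - 1) ^ 2 * b ^ 2 - (k ^ 2 * (b * c) - k * (a * d)) ^ 2 := by
    rw [← f2, ← f1]
    linear_combination (k ^ 2 - 1) ^ 2 * b ^ 2 * h.hw
  apply hG
  rw [← g1, ← g2]
  ring

theorem conic_mul (h : EllipseSolution k a b c d z₀ z₁ w₀ w₁ l m) :
    (a - m * c) ^ 2 * (1 - k ^ 2 * (l * m)) ^ 2 + k * (b - k * m * d) ^ 2 * (1 - l * m) ^ 2 =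
      (1 - l * m) ^ 2 * (1 - k ^ 2 * (l * m)) ^ 2 := by
  rw [← h.z₀_mul, ← h.z₁_mul]
  linear_combination (1 - l * m) ^ 2 * (1 - k ^ 2 * (l * m)) ^ 2 * h.hz

/-- The multiplier is determined by the product of the multipliers. -/
theorem octicD_mul (h : EllipseSolution k a b c d z₀ z₁ w₀ w₁ l m) (hA : l * m ≠ 1)
    (hB : k ^ 2 * (l * m) ≠ 1) :
    octicD k a b c d (l * m) * l = 2 * (l * m) * octicS k a b c d (l * m) * octicW k c d (l * m) := by
  have hA' : 1 - l * m ≠ 0 := sub_ne_zero.mpr hA.symm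
  have hB' : 1 - k ^ 2 * (l * m) ≠ 0 := sub_ne_zero.mpr hB.symm
  refine mul_left_cancel₀ (mul_ne_zero hA' hB') ?_
  have e1 := h.conic_mul
  have e2 := h.symm.conic_mul
  rw [mul_comm m l] at e2
  rw [← mul_assoc ((1 - l * m) * (1 - k ^ 2 * (l * m))) (octicD k a b c d (l * m)),
    octicD_identity, octicS, octicW]
  generalize hp : l * m = p at e1 e2 ⊢
  -- The conic equation for z is quadratic in m, but multiplied by l and reduced by lm = p it is
  -- linear in l and m. The equation for w gives a second such relation.
  have E1 : l * (a ^ 2 * (1 - k ^ 2 * p) ^ 2 + k * b ^ 2 * (1 - p) ^ 2 -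
      (1 - p) ^ 2 * (1 - k ^ 2 * p) ^ 2) +
      p * m * (c ^ 2 * (1 - k ^ 2 * p) ^ 2 + k ^ 3 * d ^ 2 * (1 - p) ^ 2) =
      2 * p * (a * c * (1 - k ^ 2 * p) ^ 2 + k ^ 2 * (b * d) * (1 - p) ^ 2) := by
    linear_combination l * e1 + (2 * (a * c * (1 - k ^ 2 * p) ^ 2 + k ^ 2 * (b * d) * (1 - p) ^ 2) -
      m * (c ^ 2 * (1 - k ^ 2 * p) ^ 2 + k ^ 3 * d ^ 2 * (1 - p) ^ 2)) * hp
  have E2 : m * (c ^ 2 * (1 - k ^ 2 * p) ^ 2 + k * d ^ 2 * (1 - p) ^ 2 -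
      (1 - p) ^ 2 * (1 - k ^ 2 * p) ^ 2) +
      p * l * (a ^ 2 * (1 - k ^ 2 * p) ^ 2 + k ^ 3 * b ^ 2 * (1 - p) ^ 2) =
      2 * p * (a * c * (1 - k ^ 2 * p) ^ 2 + k ^ 2 * (b * d) * (1 - p) ^ 2) := by
    linear_combination m * e2 + (2 * (a * c * (1 - k ^ 2 * p) ^ 2 + k ^ 2 * (b * d) * (1 - p) ^ 2) -
      l * (a ^ 2 * (1 - k ^ 2 * p) ^ 2 + k ^ 3 * b ^ 2 * (1 - p) ^ 2)) * hp
  linear_combination (c ^ 2 * (1 - k ^ 2 * p) ^ 2 + k * d ^ 2 * (1 - p) ^ 2 -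
      (1 - p) ^ 2 * (1 - k ^ 2 * p) ^ 2) * E1 -
    p * (c ^ 2 * (1 - k ^ 2 * p) ^ 2 + k ^ 3 * d ^ 2 * (1 - p) ^ 2) * E2

theorem octicD_mul' (h : EllipseSolution k a b c d z₀ z₁ w₀ w₁ l m) (hA : l * m ≠ 1)
    (hB : k ^ 2 * (l * m) ≠ 1) :
    octicD k a b c d (l * m) * m = 2 * (l * m) * octicS k a b c d (l * m) * octicW k a b (l * m) := by
  have := h.symm.octicD_mul (by rwa [mul_comm]) (by rwa [mul_comm m])
  rw [mul_comm m l] at this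
  rw [show octicD k a b c d (l * m) = octicD k c d a b (l * m) by
    simp only [octicD, octicE]; ring, this]
  simp only [octicS]
  ring

theorem octic_eq_zero (h : EllipseSolution k a b c d z₀ z₁ w₀ w₁ l m) (hA : l * m ≠ 1)
    (hB : k ^ 2 * (l * m) ≠ 1) (h0 : l * m ≠ 0) : octic k a b c d (l * m) = 0 := by
  have hA' : 1 - l * m ≠ 0 := sub_ne_zero.mpr hA.symm
  have hB' : 1 - k ^ 2 * (l * m) ≠ 0 := sub_ne_zero.mpr hB.symm
  refine mul_left_cancel₀ (mul_ne_zero h0 (mul_ne_zero (pow_ne_zero 2 hA') (pow_ne_zero 2 hB'))) ?_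
  rw [mul_assoc, octic_identity]
  have e1 := h.octicD_mul hA hB
  have e2 := h.octicD_mul' hA hB
  linear_combination (-octicD k a b c d (l * m) * m) * e1 -
    2 * (l * m) * octicS k a b c d (l * m) * octicW k c d (l * m) * e2

theorem ext_of_multipliers {z₀' z₁' w₀' w₁' : ℂ}
    (h : EllipseSolution k a b c d z₀ z₁ w₀ w₁ l m)
    (h' : EllipseSolution k a b c d z₀' z₁' w₀' w₁' l m) (hA : l * m ≠ 1)
    (hB : k ^ 2 * (l * m) ≠ 1) : z₀ = z₀' ∧ z₁ = z₁' ∧ w₀ = w₀' ∧ w₁ = w₁' := by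
  have hA' : 1 - l * m ≠ 0 := sub_ne_zero.mpr hA.symm
  have hB' : 1 - k ^ 2 * (l * m) ≠ 0 := sub_ne_zero.mpr hB.symm
  exact ⟨mul_right_cancel₀ hA' (h.z₀_mul.trans h'.z₀_mul.symm),
    mul_right_cancel₀ hB' (h.z₁_mul.trans h'.z₁_mul.symm),
    mul_right_cancel₀ hA' (h.w₀_mul.trans h'.w₀_mul.symm),
    mul_right_cancel₀ hB' (h.w₁_mul.trans h'.w₁_mul.symm)⟩

end EllipseSolution

/-- The roots of the octic come from solutions. -/
theorem exists_ellipseSolution (h : octic k a b c d p = 0) (h0 : p ≠ 0) (hA : p ≠ 1)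
    (hB : k ^ 2 * p ≠ 1) (hD : octicD k a b c d p ≠ 0) :
    ∃ z₀ z₁ w₀ w₁ l m, EllipseSolution k a b c d z₀ z₁ w₀ w₁ l m ∧ l * m = p := by
  have hA' : 1 - p ≠ 0 := sub_ne_zero.mpr hA.symm
  have hB' : 1 - k ^ 2 * p ≠ 0 := sub_ne_zero.mpr hB.symm
  have hid := octic_identity k a b c d p
  have hid2 := octicD_identity k a b c d p
  rw [h, mul_zero] at hid
  set D := octicD k a b c d p
  set S := octicS k a b c d p with hS
  set Wu := octicW k a b p with hWu
  set Wv := octicW k c d p with hWv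
  -- The multipliers are defined by Cramer's rule. The vanishing of the octic is then precisely the
  -- consistency condition lm = p.
  obtain ⟨l, hl⟩ : ∃ l, D * l = 2 * p * S * Wv := ⟨2 * p * S * Wv / D, by field_simp⟩
  obtain ⟨m, hm⟩ : ∃ m, D * m = 2 * p * S * Wu := ⟨2 * p * S * Wu / D, by field_simp⟩
  have hp : l * m = p := by
    refine mul_left_cancel₀ (pow_ne_zero 2 hD) ?_
    linear_combination D * m * hl + 2 * p * S * Wv * hm - p * hid
  have hl0 : l ≠ 0 := left_ne_zero_of_mul (hp.trans_ne h0)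
  have hm0 : m ≠ 0 := right_ne_zero_of_mul (hp.trans_ne h0)
  have E1 : l * (a ^ 2 * (1 - k ^ 2 * p) ^ 2 + k * b ^ 2 * (1 - p) ^ 2 -
      (1 - p) ^ 2 * (1 - k ^ 2 * p) ^ 2) +
      p * m * (c ^ 2 * (1 - k ^ 2 * p) ^ 2 + k ^ 3 * d ^ 2 * (1 - p) ^ 2) = 2 * p * S := by
    refine mul_left_cancel₀ (mul_ne_zero (mul_ne_zero hA' hB') hD) ?_
    rw [hWu, octicW] at hm
    rw [hWv, octicW] at hl
    linear_combination (1 - p) * (1 - k ^ 2 * p) * (a ^ 2 * (1 - k ^ 2 * p) ^ 2 +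
      k * b ^ 2 * (1 - p) ^ 2 - (1 - p) ^ 2 * (1 - k ^ 2 * p) ^ 2) * hl +
      (1 - p) * (1 - k ^ 2 * p) * p * (c ^ 2 * (1 - k ^ 2 * p) ^ 2 +
        k ^ 3 * d ^ 2 * (1 - p) ^ 2) * hm - 2 * p * S * hid2
  have E2 : m * (c ^ 2 * (1 - k ^ 2 * p) ^ 2 + k * d ^ 2 * (1 - p) ^ 2 -
      (1 - p) ^ 2 * (1 - k ^ 2 * p) ^ 2) +
      p * l * (a ^ 2 * (1 - k ^ 2 * p) ^ 2 + k ^ 3 * b ^ 2 * (1 - p) ^ 2) = 2 * p * S := by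
    refine mul_left_cancel₀ (mul_ne_zero (mul_ne_zero hA' hB') hD) ?_
    rw [hWu, octicW] at hm
    rw [hWv, octicW] at hl
    linear_combination (1 - p) * (1 - k ^ 2 * p) * (c ^ 2 * (1 - k ^ 2 * p) ^ 2 +
      k * d ^ 2 * (1 - p) ^ 2 - (1 - p) ^ 2 * (1 - k ^ 2 * p) ^ 2) * hm +
      (1 - p) * (1 - k ^ 2 * p) * p * (a ^ 2 * (1 - k ^ 2 * p) ^ 2 +
        k ^ 3 * b ^ 2 * (1 - p) ^ 2) * hl - 2 * p * S * hid2
  rw [hS, octicS] at E1 E2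
  obtain ⟨z₀, e0⟩ : ∃ z, z * (1 - p) = a - m * c := ⟨_, div_mul_cancel₀ _ hA'⟩
  obtain ⟨z₁, e1⟩ : ∃ z, z * (1 - k ^ 2 * p) = b - k * m * d := ⟨_, div_mul_cancel₀ _ hB'⟩
  obtain ⟨w₀, e2⟩ : ∃ z, z * (1 - p) = c - l * a := ⟨_, div_mul_cancel₀ _ hA'⟩
  obtain ⟨w₁, e3⟩ : ∃ z, z * (1 - k ^ 2 * p) = d - k * l * b := ⟨_, div_mul_cancel₀ _ hB'⟩
  refine ⟨z₀, z₁, w₀, w₁, l, m, ⟨?_, ?_, ?_, ?_, ?_, ?_⟩, hp⟩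
  · refine mul_left_cancel₀ (mul_ne_zero hl0
      (mul_ne_zero (pow_ne_zero 2 hA') (pow_ne_zero 2 hB'))) ?_
    have e : l * ((a - m * c) ^ 2 * (1 - k ^ 2 * p) ^ 2 + k * (b - k * m * d) ^ 2 * (1 - p) ^ 2) =
        l * ((1 - p) ^ 2 * (1 - k ^ 2 * p) ^ 2) := by
      linear_combination E1 + (m * (c ^ 2 * (1 - k ^ 2 * p) ^ 2 + k ^ 3 * d ^ 2 * (1 - p) ^ 2) -
        2 * (a * c * (1 - k ^ 2 * p) ^ 2 + k ^ 2 * (b * d) * (1 - p) ^ 2)) * hp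
    rw [← e0, ← e1] at e
    linear_combination e
  · refine mul_left_cancel₀ (mul_ne_zero hm0
      (mul_ne_zero (pow_ne_zero 2 hA') (pow_ne_zero 2 hB'))) ?_
    have e : m * ((c - l * a) ^ 2 * (1 - k ^ 2 * p) ^ 2 + k * (d - k * l * b) ^ 2 * (1 - p) ^ 2) =
        m * ((1 - p) ^ 2 * (1 - k ^ 2 * p) ^ 2) := by
      linear_combination E2 + (l * (a ^ 2 * (1 - k ^ 2 * p) ^ 2 + k ^ 3 * b ^ 2 * (1 - p) ^ 2) -
        2 * (a * c * (1 - k ^ 2 * p) ^ 2 + k ^ 2 * (b * d) * (1 - p) ^ 2)) * hp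
    rw [← e2, ← e3] at e
    linear_combination e
  · refine mul_right_cancel₀ hA' ?_
    linear_combination -e2 - l * e0 + c * hp
  · refine mul_right_cancel₀ hB' ?_
    linear_combination -e3 - l * k * e1 + k ^ 2 * d * hp
  · refine mul_right_cancel₀ hA' ?_
    linear_combination -e0 - m * e2 + a * hp
  · refine mul_right_cancel₀ hB' ?_
    linear_combination -e1 - m * k * e3 + k ^ 2 * b * hp

end HermitianDistance
end

open MvPolynomial
noncomputable section
namespace HermitianDistance

/-! ### Exceptional roots of the octic, and the virtual count for the ellipse. -/

variable {k a b c d p : ℂ}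

/-- Dividing `octicW` by (1 - p)(1 - k²p) gives a²/(1 - p) + k b²/(1 - k²p) - 1, whose derivative
has the second expression as numerator. If both vanished, p would be a double root of the quadratic
`octicW`. The expression in `hG` is its discriminant. -/
theorem octicW_octicU_ne_zero (hA : p ≠ 1) (hB : k ^ 2 * p ≠ 1) (hk1 : k ^ 2 ≠ 1)
    (hG : (k ^ 2 - 1 + k ^ 2 * a ^ 2 + k * b ^ 2) ^ 2 - 4 * k ^ 2 * (k ^ 2 - 1) * a ^ 2 ≠ 0)
    (hW : octicW k a b p = 0) :
    a ^ 2 * (1 - k ^ 2 * p) ^ 2 + k ^ 3 * b ^ 2 * (1 - p) ^ 2 ≠ 0 := by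
  intro hU
  rw [octicW] at hW
  have hA' : 1 - p ≠ 0 := sub_ne_zero.mpr hA.symm
  have hB' : 1 - k ^ 2 * p ≠ 0 := sub_ne_zero.mpr hB.symm
  have e1 : (1 - k ^ 2 * p) ^ 2 = -(k * (k ^ 2 - 1) * b ^ 2) := by
    refine mul_left_cancel₀ hA' ?_
    linear_combination hU - (1 - k ^ 2 * p) * hW
  have e2 : k ^ 2 * (1 - p) ^ 2 = (k ^ 2 - 1) * a ^ 2 := by
    refine mul_left_cancel₀ hB' ?_
    linear_combination hU - k ^ 2 * (1 - p) * hW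
  have e3 : 2 * k ^ 2 * (1 - p) = k ^ 2 - 1 + k ^ 2 * a ^ 2 + k * b ^ 2 := by
    refine mul_left_cancel₀ (sub_ne_zero.mpr hk1) ?_
    linear_combination k ^ 2 * e2 - e1
  apply hG
  linear_combination -(k ^ 2 - 1 + k ^ 2 * a ^ 2 + k * b ^ 2 + 2 * k ^ 2 * (1 - p)) * e3 +
    4 * k ^ 2 * e2

/-- If D vanished at a root, then so would S²W(a, b)W(c, d). If S or both W vanish, then p is a
double root of the octic, against separability. If exactly one W vanishes, the determinant formula
for D leaves a product of nonzero factors. -/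
theorem octicD_ne_zero (hsep : (octicFamily k a b c d).Separable) (h : octic k a b c d p = 0)
    (h0 : p ≠ 0) (hA : p ≠ 1) (hB : k ^ 2 * p ≠ 1) (hk1 : k ^ 2 ≠ 1)
    (hG : (k ^ 2 - 1 + k ^ 2 * a ^ 2 + k * b ^ 2) ^ 2 - 4 * k ^ 2 * (k ^ 2 - 1) * a ^ 2 ≠ 0)
    (hG' : (k ^ 2 - 1 + k ^ 2 * c ^ 2 + k * d ^ 2) ^ 2 - 4 * k ^ 2 * (k ^ 2 - 1) * c ^ 2 ≠ 0) :
    octicD k a b c d p ≠ 0 := by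
  intro hD
  have hA' : 1 - p ≠ 0 := sub_ne_zero.mpr hA.symm
  have hB' : 1 - k ^ 2 * p ≠ 0 := sub_ne_zero.mpr hB.symm
  have hAB := mul_ne_zero hA' hB'
  have hid := octic_identity k a b c d p
  have hid2 := octicD_identity k a b c d p
  rw [h, hD] at hid
  rw [hD] at hid2
  let S := octicS (Polynomial.C k) (Polynomial.C a) (Polynomial.C b) (Polynomial.C c) (Polynomial.C d)
    Polynomial.X
  let D := octicD (Polynomial.C k) (Polynomial.C a) (Polynomial.C b) (Polynomial.C c) (Polynomial.C d)
    Polynomial.X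
  let Wu := octicW (Polynomial.C k) (Polynomial.C a) (Polynomial.C b) Polynomial.X
  let Wv := octicW (Polynomial.C k) (Polynomial.C c) (Polynomial.C d) Polynomial.X
  have hpoly : (1 - Polynomial.X) ^ 2 * (1 - Polynomial.C k ^ 2 * Polynomial.X) ^ 2 *
      octicFamily k a b c d = 4 * Polynomial.X * S ^ 2 * Wu * Wv - D ^ 2 := octic_identity _ _ _ _ _ _
  have eS : S.eval p = octicS k a b c d p := by simp [S, octicS]
  have eWu : Wu.eval p = octicW k a b p := by simp [Wu, octicW]
  have eWv : Wv.eval p = octicW k c d p := by simp [Wv, octicW]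
  have eD : D.eval p = octicD k a b c d p := by simp [D, octicD, octicE]
  have key : ¬ (Polynomial.X - Polynomial.C p) ^ 2 ∣ S ^ 2 * (Wu * Wv) := by
    intro hdvd
    have hDdvd : (Polynomial.X - Polynomial.C p) ^ 2 ∣ D ^ 2 :=
      pow_dvd_pow_of_dvd (Polynomial.dvd_iff_isRoot.mpr (eD.trans hD)) 2
    have h1 : (Polynomial.X - Polynomial.C p) ^ 2 ∣ (1 - Polynomial.X) ^ 2 *
        (1 - Polynomial.C k ^ 2 * Polynomial.X) ^ 2 * octicFamily k a b c d := by
      rw [hpoly]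
      refine dvd_sub ?_ hDdvd
      rw [show 4 * Polynomial.X * S ^ 2 * Wu * Wv = (S ^ 2 * (Wu * Wv)) * (4 * Polynomial.X) by ring]
      exact hdvd.mul_right _
    have hco : IsCoprime ((Polynomial.X - Polynomial.C p) ^ 2)
        ((1 - Polynomial.X) ^ 2 * (1 - Polynomial.C k ^ 2 * Polynomial.X) ^ 2) := by
      rw [← mul_pow]
      refine IsCoprime.pow ?_
      rw [Polynomial.isCoprime_iff_aeval_ne_zero_of_isAlgClosed ℂ ℂ]
      intro q
      by_cases hq : q = p
      · right
        simpa [hq] using hAB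
      · left
        simpa [sub_eq_zero] using hq
    have h2 := hco.dvd_of_dvd_mul_left h1
    rw [sq] at h2
    have := hsep.squarefree _ h2
    exact Polynomial.not_isUnit_X_sub_C p this
  have hS : octicS k a b c d p ≠ 0 := by
    intro hS
    exact key ((pow_dvd_pow_of_dvd (Polynomial.dvd_iff_isRoot.mpr (eS.trans hS)) 2).mul_right _)
  have hWW : octicW k a b p ≠ 0 ∨ octicW k c d p ≠ 0 := by
    by_contra! hW
    refine key (Dvd.dvd.mul_left ?_ _)
    rw [sq]
    exact mul_dvd_mul (Polynomial.dvd_iff_isRoot.mpr (eWu.trans hW.1))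
      (Polynomial.dvd_iff_isRoot.mpr (eWv.trans hW.2))
  have hW0 : octicW k a b p * octicW k c d p = 0 := by
    refine (mul_eq_zero.mp (?_ : 4 * p * octicS k a b c d p ^ 2 * _ = 0)).resolve_left
      (mul_ne_zero (mul_ne_zero (by norm_num) h0) (pow_ne_zero 2 hS))
    linear_combination -hid
  rcases mul_eq_zero.mp hW0 with hW | hW
  · have hU := octicW_octicU_ne_zero hA hB hk1 hG hW
    have hW' := hWW.resolve_left (not_not.mpr hW)
    refine mul_ne_zero (mul_ne_zero h0 (mul_ne_zero hU hAB)) hW' ?_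
    rw [octicW] at hW ⊢
    linear_combination -hid2 - (1 - p) * (1 - k ^ 2 * p) * (c ^ 2 * (1 - k ^ 2 * p) ^ 2 +
      k * d ^ 2 * (1 - p) ^ 2 - (1 - p) ^ 2 * (1 - k ^ 2 * p) ^ 2) * hW
  · have hU := octicW_octicU_ne_zero hA hB hk1 hG' hW
    have hW' := hWW.resolve_right (not_not.mpr hW)
    refine mul_ne_zero (mul_ne_zero h0 (mul_ne_zero hU hAB)) hW' ?_
    rw [octicW] at hW ⊢
    linear_combination -hid2 - (1 - p) * (1 - k ^ 2 * p) * (a ^ 2 * (1 - k ^ 2 * p) ^ 2 +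
      k * b ^ 2 * (1 - p) ^ 2 - (1 - p) ^ 2 * (1 - k ^ 2 * p) ^ 2) * hW

/-- The generic octic. -/
def octicPoly (k : ℝ) : Polynomial (MvPolynomial (Fin 2 ⊕ Fin 2) ℂ) :=
  octicFamily (C (k : ℂ)) (uM 0) (uM 1) (vM 0) (vM 1)

theorem polyAt_octicPoly (k : ℝ) (u v : Fin 2 → ℂ) :
    polyAt (octicPoly k) u v = octicFamily (k : ℂ) (u 0) (u 1) (v 0) (v 1) := by
  rw [polyAt, octicPoly, map_octicFamily]
  simp only [eval_C, eval_uM, eval_vM]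

/-- On the ellipse the gradient (z₁, k z₂) pairs with z to 1, so the multiplier of x is its pairing
with z. -/
theorem conicNormal_ellipseMat {k : ℝ} {z x : Fin 2 → ℂ} : ConicNormal (ellipseMat k) z x ↔
    z 0 ^ 2 + k * z 1 ^ 2 = 1 ∧ x 0 = (z 0 * x 0 + z 1 * x 1) * z 0 ∧
      x 1 = (z 0 * x 0 + z 1 * x 1) * (k * z 1) := by
  rw [ConicNormal, conicVal_ellipseMat, conicGrad_ellipseMat_zero, conicGrad_ellipseMat_one,
    sub_eq_zero]
  refine and_congr_right fun h => ⟨fun h2 => ⟨?_, ?_⟩, fun ⟨h2, h3⟩ => ?_⟩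
  · linear_combination -x 0 * h - z 1 * h2
  · linear_combination -x 1 * h + z 0 * h2
  · linear_combination z 0 * h3 - k * z 1 * h2

theorem mem_virtSet_ellipseMat {k : ℝ} {z w u v : Fin 2 → ℂ} :
    (z, w) ∈ virtSet (ellipseMat k) u v ↔
      EllipseSolution k (u 0) (u 1) (v 0) (v 1) (z 0) (z 1) (w 0) (w 1)
        (z 0 * (v 0 - w 0) + z 1 * (v 1 - w 1)) (w 0 * (u 0 - z 0) + w 1 * (u 1 - z 1)) := by
  have hr : ∀ i j, star (ellipseMat k i j) = ellipseMat k i j :=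
    star_symMat (by simp) (by simp) (by simp) (by simp) (by simp) (by simp)
  rw [mem_virtSet_iff hr, conicNormal_ellipseMat, conicNormal_ellipseMat]
  exact ⟨fun ⟨⟨a, b, c⟩, d, e, f⟩ => ⟨a, d, b, c, e, f⟩,
    fun ⟨a, d, b, c, e, f⟩ => ⟨⟨a, b, c⟩, d, e, f⟩⟩

theorem EllipseSolution.multiplier_eq {z₀ z₁ w₀ w₁ l m : ℂ}
    (h : EllipseSolution k a b c d z₀ z₁ w₀ w₁ l m) : z₀ * (c - w₀) + z₁ * (d - w₁) = l := by
  linear_combination z₀ * h.h0 + z₁ * h.h1 + l * h.hz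

/-- Generically, the octic has eight simple roots, and none of them is exceptional. -/
theorem generic_octic {k : ℝ} (hk : 1 < k) : Generic fun u v =>
    ((polyAt (octicPoly k) u v).Separable ∧ (polyAt (octicPoly k) u v).natDegree = 8) ∧
      (u 0 ^ 2 + k * u 1 ^ 2 - 1) * (v 0 ^ 2 + k * v 1 ^ 2 - 1) ≠ 0 ∧
      ∀ p, octic (k : ℂ) (u 0) (u 1) (v 0) (v 1) p = 0 → p ≠ 0 ∧ p ≠ 1 ∧ (k : ℂ) ^ 2 * p ≠ 1 ∧
        octicD (k : ℂ) (u 0) (u 1) (v 0) (v 1) p ≠ 0 := by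
  have hk0 : (k : ℂ) ≠ 0 := by exact_mod_cast (by linarith : k ≠ 0)
  have hk1 : (k : ℂ) ^ 2 ≠ 1 := by exact_mod_cast (by nlinarith : k ^ 2 ≠ 1)
  have hk3 : 3 * (k : ℂ) ^ 2 + 1 ≠ 0 := by exact_mod_cast (by positivity : 3 * k ^ 2 + 1 ≠ 0)
  have hn : (1 - (k : ℂ) ^ 2) ≠ 0 := sub_ne_zero.mpr hk1.symm
  have hn' : ((k : ℂ) ^ 2 - 1) ≠ 0 := sub_ne_zero.mpr hk1
  obtain ⟨K, hK⟩ : ∃ K : MvPolynomial (Fin 2 ⊕ Fin 2) ℂ, ∀ x, eval x K = k := ⟨C (k : ℂ), by simp⟩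
  have hsep : Generic fun u v => (polyAt (octicPoly k) u v).Separable ∧
      (polyAt (octicPoly k) u v).natDegree = 8 := by
    obtain ⟨a, b, c, h⟩ := exists_separable_octicFamily hk0 hk1 hk3
    refine generic_separable_polyAt (by norm_num) (natDegree_octicFamily _ _ _ _ _)
      ![a, b] ![c, 0] ?_ ?_
    · rw [octicPoly, coeff_octicFamily]
      simpa using hk0
    · simpa [polyAt_octicPoly] using h
  have g1 : Generic fun u v => (u 0 ^ 2 + (k : ℂ) * u 1 ^ 2 - 1) * (v 0 ^ 2 + (k : ℂ) * v 1 ^ 2 - 1) ≠ 0 := by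
    refine Generic.of_eval ((uM 0 ^ 2 + K * uM 1 ^ 2 - 1) * (vM 0 ^ 2 + K * vM 1 ^ 2 - 1)) ![0, 0] ![0, 0] ?_ fun u v h => ?_
    · simp only [map_add, map_sub, map_mul, map_pow, map_one, eval_uM, eval_vM, hK,
        Matrix.cons_val_zero, Matrix.cons_val_one]
      norm_num
    · simpa only [map_add, map_sub, map_mul, map_pow, map_one, map_ofNat, eval_uM, eval_vM, hK] using h
  have g4 : Generic fun u v => ((k : ℂ) ^ 2 - 1 + (k : ℂ) ^ 2 * u 0 ^ 2 + (k : ℂ) * u 1 ^ 2) ^ 2 - 4 * (k : ℂ) ^ 2 * ((k : ℂ) ^ 2 - 1) * u 0 ^ 2 ≠ 0 := by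
    refine Generic.of_eval ((K ^ 2 - 1 + K ^ 2 * uM 0 ^ 2 + K * uM 1 ^ 2) ^ 2 - 4 * K ^ 2 * (K ^ 2 - 1) * uM 0 ^ 2) ![0, 0] ![0, 0] ?_ fun u v h => ?_
    · simp only [map_add, map_sub, map_mul, map_pow, map_one, map_ofNat, eval_uM, hK,
        Matrix.cons_val_zero, Matrix.cons_val_one]
      simpa using hn'
    · simpa only [map_add, map_sub, map_mul, map_pow, map_one, map_ofNat, eval_uM, eval_vM, hK] using h
  have g5 : Generic fun u v => ((k : ℂ) ^ 2 - 1 + (k : ℂ) ^ 2 * v 0 ^ 2 + (k : ℂ) * v 1 ^ 2) ^ 2 - 4 * (k : ℂ) ^ 2 * ((k : ℂ) ^ 2 - 1) * v 0 ^ 2 ≠ 0 := by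
    refine Generic.of_eval ((K ^ 2 - 1 + K ^ 2 * vM 0 ^ 2 + K * vM 1 ^ 2) ^ 2 - 4 * K ^ 2 * (K ^ 2 - 1) * vM 0 ^ 2) ![0, 0] ![0, 0] ?_ fun u v h => ?_
    · simp only [map_add, map_sub, map_mul, map_pow, map_one, map_ofNat, eval_vM, hK,
        Matrix.cons_val_zero, Matrix.cons_val_one]
      simpa using hn'
    · simpa only [map_add, map_sub, map_mul, map_pow, map_one, map_ofNat, eval_uM, eval_vM, hK] using h
  have g6 : Generic fun u v => octic (k : ℂ) (u 0) (u 1) (v 0) (v 1) 1 ≠ 0 := by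
    refine Generic.of_eval (octic K (uM 0) (uM 1) (vM 0) (vM 1) 1) ![1, 0] ![0, 0] ?_ fun u v h => ?_
    · simp only [map_octic, map_one, eval_uM, eval_vM, hK, Matrix.cons_val_zero, Matrix.cons_val_one]
      simpa [octic, octicLow, octicE, octicW] using hn
    · simpa only [map_octic, map_one, eval_uM, eval_vM, hK] using h
  have g7 : Generic fun u v => octic (k : ℂ) (u 0) (u 1) (v 0) (v 1) ((k : ℂ) ^ 2)⁻¹ ≠ 0 := by
    have hC : ∀ x, eval x (C (((k : ℂ) ^ 2)⁻¹) : MvPolynomial (Fin 2 ⊕ Fin 2) ℂ) = ((k : ℂ) ^ 2)⁻¹ := by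
      simp
    refine Generic.of_eval (octic K (uM 0) (uM 1) (vM 0) (vM 1) (C (((k : ℂ) ^ 2)⁻¹)))
      ![0, 1] ![0, 0] ?_ fun u v h => ?_
    · simp only [map_octic, eval_uM, eval_vM, hK, hC, Matrix.cons_val_zero, Matrix.cons_val_one]
      have h1 : (k : ℂ) ^ 2 * ((k : ℂ) ^ 2)⁻¹ = 1 := mul_inv_cancel₀ (pow_ne_zero 2 hk0)
      have h2 : 1 - ((k : ℂ) ^ 2)⁻¹ ≠ 0 := by
        intro h
        rw [sub_eq_zero] at h
        rw [← h, mul_one] at h1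
        exact hk1 h1
      simp [octic, octicLow, octicE, octicW, hk0, h2]
    · simpa only [map_octic, eval_uM, eval_vM, hK, hC] using h
  refine (hsep.and (g1.and (g4.and (g5.and (g6.and g7))))).mono
    fun u v ⟨h1, c1, c4, c5, c6, c7⟩ => ⟨h1, c1, ?_⟩
  have hsep := h1.1
  rw [polyAt_octicPoly] at hsep
  have hA : ∀ p, octic (k : ℂ) (u 0) (u 1) (v 0) (v 1) p = 0 → p ≠ 1 := by
    rintro p hp rfl
    exact c6 hp
  have hB : ∀ p, octic (k : ℂ) (u 0) (u 1) (v 0) (v 1) p = 0 → (k : ℂ) ^ 2 * p ≠ 1 := by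
    intro p hp h
    rw [← eq_inv_of_mul_eq_one_right h] at c7
    exact c7 hp
  have h0 : ∀ p, octic (k : ℂ) (u 0) (u 1) (v 0) (v 1) p = 0 → p ≠ 0 := by
    rintro p hp rfl
    -- At p = 0 the octic equals -D², and D is the product of the conic's values at u and v, which
    -- is generically nonzero.
    have e1 := octic_identity (k : ℂ) (u 0) (u 1) (v 0) (v 1) 0
    have e2 := octicD_identity (k : ℂ) (u 0) (u 1) (v 0) (v 1) 0
    rw [hp] at e1
    have e3 : octicD (k : ℂ) (u 0) (u 1) (v 0) (v 1) 0 = 0 :=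
      pow_eq_zero_iff two_ne_zero |>.mp (by linear_combination e1)
    rw [e3] at e2
    exact c1 (by linear_combination -e2)
  exact fun p hp => ⟨h0 p hp, hA p hp, hB p hp,
    octicD_ne_zero hsep hp (h0 p hp) (hA p hp) (hB p hp) hk1 c4 c5⟩

/-- Where D ≠ 0, the product of the multipliers determines each of them, and they determine z and w
linearly. Conversely each nonexceptional root produces a solution. -/
theorem rootCount_ellipseMat {k : ℝ} (hk : 1 < k) :
    RootCount (ellipseMat k) (octicPoly k) 8 fun x u v =>
      (x.1 0 * (v 0 - x.2 0) + x.1 1 * (v 1 - x.2 1)) *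
        (x.2 0 * (u 0 - x.1 0) + x.2 1 * (u 1 - x.1 1)) := by
  have hk0 : (k : ℂ) ≠ 0 := by exact_mod_cast (by linarith : k ≠ 0)
  have hk1 : (k : ℂ) ^ 2 ≠ 1 := by exact_mod_cast (by nlinarith : k ^ 2 ≠ 1)
  have hn : (1 - (k : ℂ) ^ 2) ≠ 0 := sub_ne_zero.mpr hk1.symm
  have hn' : ((k : ℂ) ^ 2 - 1) ≠ 0 := sub_ne_zero.mpr hk1
  obtain ⟨K, hK⟩ : ∃ K : MvPolynomial (Fin 2 ⊕ Fin 2) ℂ, ∀ x, eval x K = k := ⟨C (k : ℂ), by simp⟩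
  have g2 : Generic fun u v => ((1 - (k : ℂ) ^ 2) ^ 2 * (u 0 * v 0) ^ 2 + ((1 - (k : ℂ) ^ 2) ^ 2 * v 0 ^ 2 - (k : ℂ) * (u 1 * v 0 - (k : ℂ) * u 0 * v 1) ^ 2) - ((1 - (k : ℂ) ^ 2) ^ 2 * u 0 ^ 2 - (k : ℂ) * (u 0 * v 1 - (k : ℂ) * u 1 * v 0) ^ 2)) ^ 2 - 4 * (u 0 * v 0) ^ 2 * (1 - (k : ℂ) ^ 2) ^ 2 * ((1 - (k : ℂ) ^ 2) ^ 2 * v 0 ^ 2 - (k : ℂ) * (u 1 * v 0 - (k : ℂ) * u 0 * v 1) ^ 2) ≠ 0 := by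
    refine Generic.of_eval (((1 - K ^ 2) ^ 2 * (uM 0 * vM 0) ^ 2 + ((1 - K ^ 2) ^ 2 * vM 0 ^ 2 - K * (uM 1 * vM 0 - K * uM 0 * vM 1) ^ 2) - ((1 - K ^ 2) ^ 2 * uM 0 ^ 2 - K * (uM 0 * vM 1 - K * uM 1 * vM 0) ^ 2)) ^ 2 - 4 * (uM 0 * vM 0) ^ 2 * (1 - K ^ 2) ^ 2 * ((1 - K ^ 2) ^ 2 * vM 0 ^ 2 - K * (uM 1 * vM 0 - K * uM 0 * vM 1) ^ 2)) ![1, 0] ![0, 0] ?_ fun u v h => ?_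
    · simp only [map_add, map_sub, map_mul, map_pow, map_one, map_ofNat, eval_uM, eval_vM, hK,
        Matrix.cons_val_zero, Matrix.cons_val_one]
      simpa using hn
    · simpa only [map_add, map_sub, map_mul, map_pow, map_one, map_ofNat, eval_uM, eval_vM, hK] using h
  have g3 : Generic fun u v => (((k : ℂ) ^ 2 - 1) ^ 2 * (k : ℂ) * (u 1 * v 1) ^ 2 + (((k : ℂ) ^ 2 - 1) ^ 2 * v 1 ^ 2 - ((k : ℂ) ^ 2 * (u 0 * v 1) - (k : ℂ) * (u 1 * v 0)) ^ 2) - (((k : ℂ) ^ 2 - 1) ^ 2 * u 1 ^ 2 - ((k : ℂ) ^ 2 * (u 1 * v 0) - (k : ℂ) * (u 0 * v 1)) ^ 2)) ^ 2 - 4 * ((k : ℂ) ^ 2 - 1) ^ 2 * (k : ℂ) * (u 1 * v 1) ^ 2 * (((k : ℂ) ^ 2 - 1) ^ 2 * v 1 ^ 2 - ((k : ℂ) ^ 2 * (u 0 * v 1) - (k : ℂ) * (u 1 * v 0)) ^ 2) ≠ 0 := by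
    refine Generic.of_eval (((K ^ 2 - 1) ^ 2 * K * (uM 1 * vM 1) ^ 2 + ((K ^ 2 - 1) ^ 2 * vM 1 ^ 2 - (K ^ 2 * (uM 0 * vM 1) - K * (uM 1 * vM 0)) ^ 2) - ((K ^ 2 - 1) ^ 2 * uM 1 ^ 2 - (K ^ 2 * (uM 1 * vM 0) - K * (uM 0 * vM 1)) ^ 2)) ^ 2 - 4 * (K ^ 2 - 1) ^ 2 * K * (uM 1 * vM 1) ^ 2 * ((K ^ 2 - 1) ^ 2 * vM 1 ^ 2 - (K ^ 2 * (uM 0 * vM 1) - K * (uM 1 * vM 0)) ^ 2)) ![0, 1] ![0, 0] ?_ fun u v h => ?_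
    · simp only [map_add, map_sub, map_mul, map_pow, map_one, map_ofNat, eval_uM, eval_vM, hK,
        Matrix.cons_val_zero, Matrix.cons_val_one]
      simpa using hn'
    · simpa only [map_add, map_sub, map_mul, map_pow, map_one, map_ofNat, eval_uM, eval_vM, hK] using h
  refine ((generic_octic hk).and (g2.and g3)).mono fun u v ⟨⟨h1, c1, hp⟩, c2, c3⟩ => ⟨h1, ?_⟩
  simp only [polyAt_octicPoly, eval_octicFamily]
  have hroot : ∀ {z₀ z₁ w₀ w₁ l m : ℂ}, EllipseSolution (k : ℂ) (u 0) (u 1) (v 0) (v 1) z₀ z₁ w₀ w₁ l m →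
      octic (k : ℂ) (u 0) (u 1) (v 0) (v 1) (l * m) = 0 := fun h =>
    h.octic_eq_zero (h.lm_ne_one c2) (h.lm_ne_inv c3) (h.lm_ne_zero c1)
  refine ⟨fun x hx => hroot (mem_virtSet_ellipseMat.mp hx), ?_, ?_⟩
  · rintro ⟨z, w⟩ h ⟨z', w'⟩ h' heq
    dsimp only at heq
    have s := mem_virtSet_ellipseMat.mp h
    have s' := mem_virtSet_ellipseMat.mp h'
    generalize z 0 * (v 0 - w 0) + z 1 * (v 1 - w 1) = l at heq s
    generalize w 0 * (u 0 - z 0) + w 1 * (u 1 - z 1) = m at heq s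
    generalize z' 0 * (v 0 - w' 0) + z' 1 * (v 1 - w' 1) = l' at heq s'
    generalize w' 0 * (u 0 - z' 0) + w' 1 * (u 1 - z' 1) = m' at heq s'
    have r := hroot s
    have e1 := s.octicD_mul (hp _ r).2.1 (hp _ r).2.2.1
    have e2 := s.octicD_mul' (hp _ r).2.1 (hp _ r).2.2.1
    have e1' := s'.octicD_mul (hp _ (hroot s')).2.1 (hp _ (hroot s')).2.2.1
    have e2' := s'.octicD_mul' (hp _ (hroot s')).2.1 (hp _ (hroot s')).2.2.1
    rw [← heq] at e1' e2'
    obtain rfl := mul_left_cancel₀ (hp _ r).2.2.2 (e1.trans e1'.symm)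
    obtain rfl := mul_left_cancel₀ (hp _ r).2.2.2 (e2.trans e2'.symm)
    obtain ⟨f0, f1, f2, f3⟩ := s.ext_of_multipliers s' (hp _ r).2.1 (hp _ r).2.2.1
    rw [Prod.mk.injEq]
    constructor <;> funext j <;> fin_cases j <;> assumption
  · intro p hr
    obtain ⟨f0, f1, f2, f3⟩ := hp p hr
    obtain ⟨z₀, z₁, w₀, w₁, l, m, s, rfl⟩ := exists_ellipseSolution hr f0 f1 f2 f3
    have e1 := s.multiplier_eq
    have e2 := s.symm.multiplier_eq
    refine ⟨(![z₀, z₁], ![w₀, w₁]), mem_virtSet_ellipseMat.mpr ?_, ?_⟩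
    · simp only [Matrix.cons_val_zero, Matrix.cons_val_one]
      rwa [e1, e2]
    · simp only [Matrix.cons_val_zero, Matrix.cons_val_one, e1, e2]

theorem genericCount_ellipseMat {k : ℝ} (hk : 1 < k) : GenericCount (ellipseMat k) 8 :=
  (rootCount_ellipseMat hk).genericCount

end HermitianDistance
end

noncomputable section
namespace HermitianDistance

/-! ### A bound for the number of critical points of an ellipse -/

/-- If the product of two continuous functions is positive with the exception of one point, the
sign of the first one does not change. -/
theorem nonpos_of_mul_pos {F H : ℝ → ℝ} (hF : Continuous F) (hH : Continuous H) {c : ℝ}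
    (h0 : F 0 < 0) (hFH : ∀ t, 0 < t → t ≤ 1 → t ≠ c → 0 < F t * H t) (hc : F c = 0 → 0 < H c) :
    F 1 ≤ 0 := by
  by_contra! h1
  have hzero : ∀ s, 0 < s → s ≤ 1 → 0 < F s → 0 < c ∧ c < s ∧ F c = 0 := by
    intro s hs hs1 hFs
    obtain ⟨t, ⟨ht0, ht1⟩, ht⟩ := intermediate_value_Ioo hs.le hF.continuousOn ⟨h0, hFs⟩
    by_cases htc : t = c
    · subst htc
      exact ⟨ht0, ht1, ht⟩
    · have := hFH t ht0 (by linarith) htc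
      rw [ht, zero_mul] at this
      exact absurd this (lt_irrefl 0)
  -- F can change sign only at c, so it is negative at c/2, and hence so is H. But H(c) > 0, so H
  -- has a zero strictly before c, where the product cannot vanish.
  obtain ⟨c0, c1, hFc⟩ := hzero 1 one_pos le_rfl h1
  have hHc := hc hFc
  have h2 := hFH (c / 2) (by linarith) (by linarith) (by linarith)
  have hF2 : F (c / 2) < 0 := by
    by_contra! h
    have h3 : 0 < F (c / 2) := lt_of_le_of_ne h fun h => by rw [← h, zero_mul] at h2; exact lt_irrefl 0 h2
    obtain ⟨-, h4, -⟩ := hzero (c / 2) (by linarith) (by linarith) h3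
    linarith
  have hH2 : H (c / 2) < 0 := by
    by_contra! h
    nlinarith
  obtain ⟨t, ⟨ht0, ht1⟩, ht⟩ := intermediate_value_Ioo (by linarith) hH.continuousOn ⟨hH2, hHc⟩
  have := hFH t (by linarith) (by linarith) ht1.ne
  rw [ht, mul_zero] at this
  exact lt_irrefl 0 this

/-- The data of the dual problem: level `y` is attained at parameter `x` if
`(A B y + Z) ^ 2 = x ω ^ 2` where `A = 1 - x` and `B = 1 - k ^ 2 x`. -/
structure DualData (k : ℝ) (ω Z : ℝ → ℝ) : Prop where
  one_lt : 1 < k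
  continuous_ω : Continuous ω
  ω_nonneg : ∀ x, 0 ≤ ω x
  continuous_Z : Continuous Z
  Z_zero : Z 0 = 0
  Z_one : Z 1 < 0
  Z_inv : 0 < Z (1 / k ^ 2)

/-- A critical point with parameter `p` and level `p * n`. -/
structure DualCritical (k : ℝ) (ω Z : ℝ → ℝ) (p n : ℝ) : Prop where
  p_pos : 0 < p
  n_pos : 0 < n
  p_ne_one : p ≠ 1
  kp_ne_one : k ^ 2 * p ≠ 1
  ω_pos : 0 < ω p
  level : ∀ x, 0 ≤ x → ((1 - x) * (1 - k ^ 2 * x) * (p * n) + Z x) ^ 2 - x * ω x ^ 2 =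
    -((1 - x) * (1 - k ^ 2 * x)) * ((x - p) ^ 2 * (k ^ 2 * x - n ^ 2))

/-- The lower factor of the equation of level `y`. -/
def lowerFactor (k : ℝ) (ω Z : ℝ → ℝ) (y x : ℝ) : ℝ :=
  (1 - x) * (1 - k ^ 2 * x) * y + Z x - √x * ω x

/-- The upper factor of the equation of level `y`. -/
def upperFactor (k : ℝ) (ω Z : ℝ → ℝ) (y x : ℝ) : ℝ :=
  (1 - x) * (1 - k ^ 2 * x) * y + Z x + √x * ω x

variable {k : ℝ} {ω Z : ℝ → ℝ} {p n p' n' x y y' : ℝ}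

theorem upperFactor_eq : upperFactor k ω Z y x = lowerFactor k ω Z y x + 2 * (√x * ω x) := by
  rw [upperFactor, lowerFactor]
  ring

theorem DualData.continuous_lowerFactor (h : DualData k ω Z) (y : ℝ) :
    Continuous (lowerFactor k ω Z y) := by
  have h1 := h.continuous_ω
  have h2 := h.continuous_Z
  unfold lowerFactor
  fun_prop

theorem DualData.continuous_upperFactor (h : DualData k ω Z) (y : ℝ) :
    Continuous (upperFactor k ω Z y) := by
  have h1 := h.continuous_ω
  have h2 := h.continuous_Z
  unfold upperFactor
  fun_prop

theorem DualData.lowerFactor_le (h : DualData k ω Z) :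
    lowerFactor k ω Z y x ≤ upperFactor k ω Z y x := by
  rw [upperFactor_eq]
  have := mul_nonneg (Real.sqrt_nonneg x) (h.ω_nonneg x)
  linarith

namespace DualCritical

theorem factor_mul (c : DualCritical k ω Z p n) (hx : 0 ≤ x) :
    lowerFactor k ω Z (p * n) x * upperFactor k ω Z (p * n) x =
      -((1 - x) * (1 - k ^ 2 * x)) * ((x - p) ^ 2 * (k ^ 2 * x - n ^ 2)) := by
  rw [← c.level x hx, lowerFactor, upperFactor]
  have := Real.sq_sqrt hx
  linear_combination -ω x ^ 2 * this

theorem upperFactor_pos (c : DualCritical k ω Z p n) (h : lowerFactor k ω Z (p * n) p = 0) :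
    0 < upperFactor k ω Z (p * n) p := by
  rw [upperFactor_eq, h]
  have := mul_pos (Real.sqrt_pos.mpr c.p_pos) c.ω_pos
  linarith

theorem factor_eq_zero (c : DualCritical k ω Z p n) :
    lowerFactor k ω Z (p * n) p = 0 ∨ upperFactor k ω Z (p * n) p = 0 := by
  rw [← mul_eq_zero, c.factor_mul c.p_pos.le]
  ring

/-- The lower factor is negative at 1. If it were positive at x, the product of the factors would be
positive at x, and the sign of k²x - n² then keeps it positive on the segment from x to 1, except at
1 and possibly at p. There `nonpos_of_mul_pos` forbids a sign change, because the upper factor is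
positive at p whenever the lower one vanishes. -/
theorem lowerFactor_nonpos (d : DualData k ω Z) (c : DualCritical k ω Z p n)
    (hx : 1 < k ^ 2 * x) : lowerFactor k ω Z (p * n) x ≤ 0 := by
  have hk : 1 < k ^ 2 := by nlinarith [d.one_lt]
  have hx0 : 0 < x := pos_of_mul_pos_right (by linarith) (by linarith : 0 ≤ k ^ 2)
  have h1 : lowerFactor k ω Z (p * n) 1 < 0 := by
    have h2 := d.Z_one
    have h3 := d.ω_nonneg 1
    rw [lowerFactor, Real.sqrt_one]
    linarith
  by_contra! hf
  have hprod := c.factor_mul hx0.le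
  have hpos := mul_pos hf (hf.trans_le d.lowerFactor_le)
  rw [hprod] at hpos
  have hx1 : x ≠ 1 := by
    rintro rfl
    linarith
  have hsq := sq_nonneg (x - p)
  have key : ∀ t, 0 < t → t ≤ 1 →
      0 < -((1 - (1 + t * (x - 1))) * (1 - k ^ 2 * (1 + t * (x - 1)))) *
        (k ^ 2 * (1 + t * (x - 1)) - n ^ 2) := by
    intro t ht ht1
    rcases lt_or_gt_of_ne hx1 with h | h
    · have hn : 0 < k ^ 2 * x - n ^ 2 := by
        by_contra! hn
        have : 0 < (1 - x) * (k ^ 2 * x - 1) := mul_pos (by linarith) (by linarith)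
        nlinarith [mul_nonneg this.le (mul_nonneg hsq (neg_nonneg.mpr hn))]
      have e : k ^ 2 * x ≤ k ^ 2 * (1 + t * (x - 1)) := by
        refine mul_le_mul_of_nonneg_left ?_ (by linarith)
        nlinarith
      have : 0 < t * (1 - x) * (k ^ 2 * (1 + t * (x - 1)) - 1) :=
        mul_pos (mul_pos ht (by linarith)) (by linarith)
      have := mul_pos this (by linarith : 0 < k ^ 2 * (1 + t * (x - 1)) - n ^ 2)
      linarith
    · have hn : k ^ 2 * x - n ^ 2 < 0 := by
        by_contra! hn
        have : 0 < (x - 1) * (k ^ 2 * x - 1) := mul_pos (by linarith) (by linarith)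
        nlinarith [mul_nonneg this.le (mul_nonneg hsq hn)]
      have e : k ^ 2 * (1 + t * (x - 1)) ≤ k ^ 2 * x := by
        refine mul_le_mul_of_nonneg_left ?_ (by linarith)
        nlinarith
      have e2 : 0 < k ^ 2 * (1 + t * (x - 1)) - 1 := by
        have : 0 < t * (x - 1) := mul_pos ht (by linarith)
        nlinarith
      have : 0 < t * (x - 1) * (k ^ 2 * (1 + t * (x - 1)) - 1) :=
        mul_pos (mul_pos ht (by linarith)) e2
      have := mul_pos this (by linarith : 0 < n ^ 2 - k ^ 2 * (1 + t * (x - 1)))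
      linarith
  have hseg : ∀ t, 0 < t → t ≤ 1 → 0 ≤ 1 + t * (x - 1) := by
    intro t ht ht1
    nlinarith
  have hx' : x - 1 ≠ 0 := sub_ne_zero.mpr hx1
  have hcp : 1 + (p - 1) / (x - 1) * (x - 1) = p := by
    field_simp
    ring
  have := nonpos_of_mul_pos (F := fun t => lowerFactor k ω Z (p * n) (1 + t * (x - 1)))
    (H := fun t => upperFactor k ω Z (p * n) (1 + t * (x - 1))) (c := (p - 1) / (x - 1))
    ((d.continuous_lowerFactor _).comp (by fun_prop))
    ((d.continuous_upperFactor _).comp (by fun_prop)) (by simpa using h1) ?_ ?_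
  · simp only [one_mul, add_sub_cancel] at this
    linarith
  · intro t ht ht1 htc
    rw [c.factor_mul (hseg t ht ht1)]
    have h3 : 1 + t * (x - 1) - p ≠ 0 := by
      intro h
      apply htc
      rw [eq_div_iff hx']
      linear_combination h
    have := mul_pos (key t ht ht1) (pow_pos (abs_pos.mpr h3) 2)
    rw [sq_abs] at this
    linarith
  · rw [hcp]
    exact c.upperFactor_pos

/-- Just to the right of 1/k² the upper factor is positive and the lower one is not, so their
product is at most 0. If n² ≤ 1, the level identity would make it positive. -/
theorem one_lt_n_sq (d : DualData k ω Z) (c : DualCritical k ω Z p n) : 1 < n ^ 2 := by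
  have hk : 1 < k ^ 2 := by nlinarith [d.one_lt]
  by_contra! hn
  have h0 : 0 < upperFactor k ω Z (p * n) (1 / k ^ 2) := by
    have h2 := d.Z_inv
    have h3 := mul_nonneg (Real.sqrt_nonneg (1 / k ^ 2)) (d.ω_nonneg (1 / k ^ 2))
    have h4 : k ^ 2 * (1 / k ^ 2) = 1 := mul_one_div_cancel (by linarith)
    rw [upperFactor, h4]
    linarith
  have ev1 : ∀ᶠ x in nhdsWithin (1 / k ^ 2) (Set.Ioi (1 / k ^ 2)),
      0 < upperFactor k ω Z (p * n) x :=
    nhdsWithin_le_nhds ((d.continuous_upperFactor _).continuousAt.eventually (lt_mem_nhds h0))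
  have ev2 : ∀ᶠ x in nhdsWithin (1 / k ^ 2) (Set.Ioi (1 / k ^ 2)), x < 1 :=
    nhdsWithin_le_nhds (gt_mem_nhds (by rw [div_lt_one (by linarith)]; exact hk))
  have ev3 : ∀ᶠ x in nhdsWithin (1 / k ^ 2) (Set.Ioi (1 / k ^ 2)), x ≠ p := by
    refine nhdsWithin_le_nhds (isOpen_ne.mem_nhds ?_)
    intro h
    apply c.kp_ne_one
    rw [← h]
    exact mul_one_div_cancel (by linarith)
  obtain ⟨x, hx1, hx2, hx3, hx4⟩ := (ev1.and (ev2.and (ev3.and self_mem_nhdsWithin))).exists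
  rw [div_lt_iff₀ (by linarith), mul_comm] at hx4
  have hx0 : 0 < x := pos_of_mul_pos_right (by linarith) (by linarith : 0 ≤ k ^ 2)
  have h5 := c.lowerFactor_nonpos d hx4
  have h6 := c.factor_mul hx0.le
  have h7 : 0 < (1 - x) * (k ^ 2 * x - 1) := mul_pos (by linarith) (by linarith)
  have h8 : 0 < (x - p) ^ 2 * (k ^ 2 * x - n ^ 2) :=
    mul_pos (pow_pos (abs_pos.mpr (sub_ne_zero.mpr hx3)) 2 |>.trans_eq (sq_abs _)) (by linarith)
  nlinarith [mul_pos h7 h8, mul_nonneg (neg_nonneg.mpr h5) hx1.le]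

/-- Both factors start at the positive value p n at x = 0, and since n² > 1 their product stays
positive except possibly at p. If the lower factor became negative, both would have to vanish at p,
which ω(p) > 0 prevents. -/
theorem lowerFactor_nonneg (d : DualData k ω Z) (c : DualCritical k ω Z p n) (hx0 : 0 < x)
    (hx : k ^ 2 * x < 1) : 0 ≤ lowerFactor k ω Z (p * n) x := by
  have hk : 1 < k ^ 2 := by nlinarith [d.one_lt]
  have hn := c.one_lt_n_sq d
  by_contra! hf
  have hy := mul_pos c.p_pos c.n_pos
  have h0 : lowerFactor k ω Z (p * n) 0 = p * n := by simp [lowerFactor, d.Z_zero]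
  have h0' : upperFactor k ω Z (p * n) 0 = p * n := by simp [upperFactor, d.Z_zero]
  have hpos : ∀ t, 0 < t → t ≤ x → t ≠ p →
      0 < lowerFactor k ω Z (p * n) t * upperFactor k ω Z (p * n) t := by
    intro t ht htx htp
    rw [c.factor_mul ht.le]
    have h1 : k ^ 2 * t ≤ k ^ 2 * x := mul_le_mul_of_nonneg_left htx (by linarith)
    have h2 : 0 < (t - p) ^ 2 := (pow_pos (abs_pos.mpr (sub_ne_zero.mpr htp)) 2).trans_eq (sq_abs _)
    have h3 : 0 < (1 - t) * (1 - k ^ 2 * t) := mul_pos (by nlinarith) (by linarith)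
    have := mul_pos h3 (mul_pos h2 (by linarith : 0 < n ^ 2 - k ^ 2 * t))
    linarith
  obtain ⟨t, ⟨ht0, ht1⟩, ht⟩ := intermediate_value_Ioo' hx0.le
    (d.continuous_lowerFactor (p * n)).continuousOn ⟨hf, by rw [h0]; exact hy⟩
  have htp : t = p := by
    by_contra htp
    have := hpos t ht0 ht1.le htp
    rw [ht, zero_mul] at this
    exact lt_irrefl 0 this
  subst htp
  have hu : upperFactor k ω Z (t * n) x < 0 := by
    have := hpos x hx0 le_rfl ht1.ne'
    nlinarith
  obtain ⟨s, ⟨hs0, hs1⟩, hs⟩ := intermediate_value_Ioo' hx0.le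
    (d.continuous_upperFactor (t * n)).continuousOn ⟨hu, by rw [h0']; exact hy⟩
  have hst : s = t := by
    by_contra hst
    have := hpos s hs0 hs1.le hst
    rw [hs, mul_zero] at this
    exact lt_irrefl 0 this
  subst hst
  exact (c.upperFactor_pos ht).ne' hs

/-- Distinct critical points have distinct levels. -/
theorem eq_of_level_eq (c : DualCritical k ω Z p n) (c' : DualCritical k ω Z p' n')
    (h : p * n = p' * n') : p = p' := by
  by_contra hne
  -- Equal levels give the same equation, so the double root p' of one must be the remaining root
  -- n²/k² of the other.
  have key : ∀ {p n p' n'}, DualCritical k ω Z p n → DualCritical k ω Z p' n' →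
      p * n = p' * n' → p ≠ p' → k ^ 2 * p' = n ^ 2 := by
    intro p n p' n' c c' h hne
    have h1 := c.level p' c'.p_pos.le
    rw [h, c'.level p' c'.p_pos.le] at h1
    have h2 : ((1 - p') * (1 - k ^ 2 * p') * (p' - p) ^ 2) * (k ^ 2 * p' - n ^ 2) = 0 := by
      linear_combination h1
    have h3 := (mul_eq_zero.mp h2).resolve_left (mul_ne_zero (mul_ne_zero
      (sub_ne_zero.mpr c'.p_ne_one.symm) (sub_ne_zero.mpr c'.kp_ne_one.symm))
      (pow_ne_zero 2 (sub_ne_zero.mpr hne.symm)))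
    linarith
  have h1 := key c c' h hne
  have h2 := key c' c h.symm (Ne.symm hne)
  have h3 : p * p' * k ^ 2 * (p - p') = 0 := by
    have : (p * n) ^ 2 = (p' * n') ^ 2 := by rw [h]
    linear_combination this + p ^ 2 * h1 - p' ^ 2 * h2
  have hk : k ^ 2 ≠ 0 := by
    intro hk
    rw [hk, zero_mul] at h1
    exact (pow_pos c.n_pos 2).ne h1
  exact mul_ne_zero (mul_ne_zero (mul_ne_zero c.p_pos.ne' c'.p_pos.ne') hk)
    (sub_ne_zero.mpr hne) h3

theorem lowerFactor_of_eq_zero (h : lowerFactor k ω Z y' x = 0) :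
    lowerFactor k ω Z y x = (1 - x) * (1 - k ^ 2 * x) * (y - y') := by
  rw [lowerFactor] at h ⊢
  linear_combination h

/-- In this range each parameter is a zero of its own lower factor, where the lower factor of the
other level is nonnegative. Each level is thus at least the other. The two lemmas after it use the
same comparison with `lowerFactor_nonpos`. -/
theorem eq_of_kp_lt (d : DualData k ω Z) (c : DualCritical k ω Z p n)
    (c' : DualCritical k ω Z p' n') (h : k ^ 2 * p < 1) (h' : k ^ 2 * p' < 1) : p = p' := by
  have key : ∀ {p n p' n'}, DualCritical k ω Z p n → DualCritical k ω Z p' n' →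
      k ^ 2 * p' < 1 → p' * n' ≤ p * n := by
    intro p n p' n' c c' h'
    have h0 : lowerFactor k ω Z (p' * n') p' = 0 := by
      refine c'.factor_eq_zero.resolve_right fun h => ?_
      have h1 := c'.lowerFactor_nonneg d c'.p_pos h'
      have h2 := mul_pos (Real.sqrt_pos.mpr c'.p_pos) c'.ω_pos
      rw [upperFactor_eq] at h
      linarith
    have h1 := c.lowerFactor_nonneg d c'.p_pos h'
    rw [lowerFactor_of_eq_zero h0] at h1
    have h2 : p' < 1 := by nlinarith [d.one_lt, c'.p_pos]
    have := nonneg_of_mul_nonneg_right h1 (mul_pos (by linarith) (by linarith))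
    linarith
  exact c.eq_of_level_eq c' (le_antisymm (key c' c h) (key c c' h'))

theorem eq_of_lt_one (d : DualData k ω Z) (c : DualCritical k ω Z p n)
    (c' : DualCritical k ω Z p' n') (h : 1 < k ^ 2 * p) (h' : 1 < k ^ 2 * p') (h1 : p < 1)
    (h1' : p' < 1) (hf : lowerFactor k ω Z (p * n) p = 0)
    (hf' : lowerFactor k ω Z (p' * n') p' = 0) : p = p' := by
  have key : ∀ {p n p' n'}, DualCritical k ω Z p n → 1 < k ^ 2 * p' → p' < 1 →
      lowerFactor k ω Z (p' * n') p' = 0 → p' * n' ≤ p * n := by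
    intro p n p' n' c h' h1' hf'
    have h2 := c.lowerFactor_nonpos d h'
    rw [lowerFactor_of_eq_zero hf'] at h2
    have := mul_pos (by linarith : 0 < 1 - p') (by linarith : 0 < k ^ 2 * p' - 1)
    by_contra! hlt
    nlinarith [mul_pos this (by linarith : 0 < p' * n' - p * n)]
  exact c.eq_of_level_eq c' (le_antisymm (key c' h h1 hf) (key c h' h1' hf'))

theorem eq_of_one_lt (d : DualData k ω Z) (c : DualCritical k ω Z p n)
    (c' : DualCritical k ω Z p' n') (h : 1 < k ^ 2 * p) (h' : 1 < k ^ 2 * p') (h1 : 1 < p)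
    (h1' : 1 < p') (hf : lowerFactor k ω Z (p * n) p = 0)
    (hf' : lowerFactor k ω Z (p' * n') p' = 0) : p = p' := by
  have key : ∀ {p n p' n'}, DualCritical k ω Z p n → 1 < k ^ 2 * p' → 1 < p' →
      lowerFactor k ω Z (p' * n') p' = 0 → p * n ≤ p' * n' := by
    intro p n p' n' c h' h1' hf'
    have h2 := c.lowerFactor_nonpos d h'
    rw [lowerFactor_of_eq_zero hf'] at h2
    have := mul_pos (by linarith : 0 < p' - 1) (by linarith : 0 < k ^ 2 * p' - 1)
    by_contra! hlt
    nlinarith [mul_pos this (by linarith : 0 < p * n - p' * n')]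
  exact c.eq_of_level_eq c' (le_antisymm (key c h' h1' hf') (key c' h h1 hf))

/-- At a zero of the upper factor of one level, the upper factor of the other is a multiple of the
level difference. The product formula then gives the sign of k²p' - n² from that of a lower factor,
and likewise with the roles exchanged. -/
theorem level_lt_cases (d : DualData k ω Z) (c : DualCritical k ω Z p n)
    (c' : DualCritical k ω Z p' n') (h : 1 < k ^ 2 * p) (h' : 1 < k ^ 2 * p')
    (hf : upperFactor k ω Z (p * n) p = 0) (hf' : upperFactor k ω Z (p' * n') p' = 0)
    (hy : p' * n' < p * n) : n ^ 2 ≤ k ^ 2 * p' ∧ k ^ 2 * p ≤ n' ^ 2 := by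
  have hne : p ≠ p' := by
    rintro rfl
    rw [upperFactor] at hf hf'
    have h3 : (1 - p) * (1 - k ^ 2 * p) * (p * n - p * n') = 0 := by linear_combination hf - hf'
    exact mul_ne_zero (mul_ne_zero (sub_ne_zero.mpr c.p_ne_one.symm)
      (sub_ne_zero.mpr c.kp_ne_one.symm)) (by linarith) h3
  have key : ∀ {p n p' n'}, DualCritical k ω Z p n → DualCritical k ω Z p' n' →
      upperFactor k ω Z (p' * n') p' = 0 →
      lowerFactor k ω Z (p * n) p' * (p * n - p' * n') =
        -((p' - p) ^ 2 * (k ^ 2 * p' - n ^ 2)) := by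
    intro p n p' n' c c' hf'
    have h1 := c.factor_mul c'.p_pos.le
    have h2 : upperFactor k ω Z (p * n) p' =
        (1 - p') * (1 - k ^ 2 * p') * (p * n - p' * n') := by
      rw [upperFactor] at hf' ⊢
      linear_combination hf'
    rw [h2] at h1
    refine mul_left_cancel₀ (mul_ne_zero (sub_ne_zero.mpr c'.p_ne_one.symm)
      (sub_ne_zero.mpr c'.kp_ne_one.symm)) ?_
    linear_combination h1
  have h1 := key c c' hf'
  have h2 := key c' c hf
  have h3 := c.lowerFactor_nonpos d h'
  have h4 := c'.lowerFactor_nonpos d h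
  have h5 : 0 < (p - p') ^ 2 := (pow_pos (abs_pos.mpr (sub_ne_zero.mpr hne)) 2).trans_eq (sq_abs _)
  constructor
  · by_contra! hlt
    nlinarith [mul_pos h5 (by linarith : 0 < n ^ 2 - k ^ 2 * p')]
  · by_contra! hlt
    nlinarith [mul_pos h5 (by linarith : 0 < k ^ 2 * p - n' ^ 2)]

/-- If p'n' < pn, the previous inequalities interlace k²p, n², k²p', n'². When both points lie on
the same side of k²p = n², this forces p ≤ p' and n ≤ n', a contradiction. -/
theorem eq_of_upperFactor (d : DualData k ω Z) (c : DualCritical k ω Z p n)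
    (c' : DualCritical k ω Z p' n') (h : 1 < k ^ 2 * p) (h' : 1 < k ^ 2 * p')
    (hf : upperFactor k ω Z (p * n) p = 0) (hf' : upperFactor k ω Z (p' * n') p' = 0)
    (ht : k ^ 2 * p ≤ n ^ 2 ↔ k ^ 2 * p' ≤ n' ^ 2) : p = p' := by
  have hk : 0 < k ^ 2 := by nlinarith [d.one_lt]
  have key : ∀ {p n p' n'}, DualCritical k ω Z p n → DualCritical k ω Z p' n' →
      1 < k ^ 2 * p → 1 < k ^ 2 * p' → upperFactor k ω Z (p * n) p = 0 →
      upperFactor k ω Z (p' * n') p' = 0 → (k ^ 2 * p ≤ n ^ 2 ↔ k ^ 2 * p' ≤ n' ^ 2) →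
      ¬ p' * n' < p * n := by
    intro p n p' n' c c' h h' hf hf' ht hy
    obtain ⟨h1, h2⟩ := level_lt_cases d c c' h h' hf hf' hy
    have hp := c.p_pos
    have hp' := c'.p_pos
    have hn := c.n_pos
    have hn' := c'.n_pos
    by_cases hl : k ^ 2 * p ≤ n ^ 2
    · have hl' := ht.mp hl
      have e1 : n ≤ n' := pow_le_pow_iff_left₀ hn.le hn'.le two_ne_zero |>.mp (h1.trans hl')
      have e2 : p ≤ p' := le_of_mul_le_mul_left (hl.trans h1) hk
      exact absurd hy (not_lt.mpr (mul_le_mul e2 e1 hn.le hp'.le))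
    · have hl' := mt ht.mpr hl
      push Not at hl hl'
      have e1 : n ≤ n' := pow_le_pow_iff_left₀ hn.le hn'.le two_ne_zero |>.mp (hl.le.trans h2)
      have e2 : p ≤ p' := le_of_mul_le_mul_left (h2.trans hl'.le) hk
      exact absurd hy (not_lt.mpr (mul_le_mul e2 e1 hn.le hp'.le))
  exact c.eq_of_level_eq c' (le_antisymm (not_lt.mp (key c c' h h' hf hf' ht))
    (not_lt.mp (key c' c h' h hf' hf ht.symm)))

end DualCritical

/-- There are at most five critical points. -/
theorem DualData.card_le (d : DualData k ω Z) {s : Finset ℝ}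
    (hs : ∀ p ∈ s, ∃ n, DualCritical k ω Z p n) : s.card ≤ 5 := by
  classical
  choose! n hn using hs
  -- Each class contains at most one point: p below 1/k², zeros of the lower factor on either side
  -- of 1, and zeros of the upper factor on either side of k²p = n².
  let g : ℝ → Fin 5 := fun p =>
    if k ^ 2 * p < 1 then 0
    else if lowerFactor k ω Z (p * n p) p = 0 then (if p < 1 then 1 else 2)
    else if k ^ 2 * p ≤ n p ^ 2 then 3 else 4
  have := Finset.card_le_card_of_injOn (t := Finset.univ) g (fun _ _ => Finset.mem_univ _) (s := s) ?_
  · simpa using this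
  · intro p hp q hq hpq
    have cp := hn p hp
    have cq := hn q hq
    have ep := cp.kp_ne_one
    have eq := cq.kp_ne_one
    have ep1 := cp.p_ne_one
    have eq1 := cq.p_ne_one
    have fp := cp.factor_eq_zero
    have fq := cq.factor_eq_zero
    simp only [g] at hpq
    have lp : ¬ k ^ 2 * p < 1 → 1 < k ^ 2 * p := fun h => lt_of_le_of_ne (not_lt.mp h) ep.symm
    have lq : ¬ k ^ 2 * q < 1 → 1 < k ^ 2 * q := fun h => lt_of_le_of_ne (not_lt.mp h) eq.symm
    have lp1 : ¬ p < 1 → 1 < p := fun h => lt_of_le_of_ne (not_lt.mp h) ep1.symm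
    have lq1 : ¬ q < 1 → 1 < q := fun h => lt_of_le_of_ne (not_lt.mp h) eq1.symm
    split_ifs at hpq
    all_goals first
      | exact absurd hpq (by decide)
      | exact cp.eq_of_kp_lt d cq ‹k ^ 2 * p < 1› ‹k ^ 2 * q < 1›
      | exact cp.eq_of_lt_one d cq (lp ‹_›) (lq ‹_›) ‹p < 1› ‹q < 1›
          ‹lowerFactor k ω Z (p * n p) p = 0› ‹lowerFactor k ω Z (q * n q) q = 0›
      | exact cp.eq_of_one_lt d cq (lp ‹_›) (lq ‹_›) (lp1 ‹_›) (lq1 ‹_›)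
          ‹lowerFactor k ω Z (p * n p) p = 0› ‹lowerFactor k ω Z (q * n q) q = 0›
      | exact cp.eq_of_upperFactor d cq (lp ‹_›) (lq ‹_›)
          (fp.resolve_left ‹_›) (fq.resolve_left ‹_›) (by tauto)

end HermitianDistance
end

noncomputable section
namespace HermitianDistance

/-! ### The ellipse has at most five critical points when all its virtual critical points are
critical. -/

section

variable {k a b c d z₀ z₁ w₀ w₁ l m : ℂ}

/-- Expressing a, b, c, d by the solution makes this an identity modulo the two conic equations. The
level lm (z₀w₀ + k²z₁w₁) is the one for which the equation in x acquires a double root at x = lm. -/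
theorem EllipseSolution.level (h : EllipseSolution k a b c d z₀ z₁ w₀ w₁ l m) (x : ℂ) :
    ((1 - x) * (1 - k ^ 2 * x) * (l * m * (z₀ * w₀ + k ^ 2 * (z₁ * w₁))) +
      x * (a * c * (1 - k ^ 2 * x) + k ^ 2 * (b * d) * (1 - x))) ^ 2 -
      x * (octicW k a b x * octicW k c d x) =
    -((1 - x) * (1 - k ^ 2 * x)) * ((x - l * m) ^ 2 *
      (k ^ 2 * x - (z₀ * w₀ + k ^ 2 * (z₁ * w₁)) ^ 2)) := by
  obtain ⟨hz, hw, h0, h1, h2, h3⟩ := h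
  obtain rfl : c = w₀ + l * z₀ := by linear_combination h0
  obtain rfl : d = w₁ + l * (k * z₁) := by linear_combination h1
  obtain rfl : a = z₀ + m * w₀ := by linear_combination h2
  obtain rfl : b = z₁ + m * (k * w₁) := by linear_combination h3
  simp only [octicW]
  linear_combination (-(1 - x) * (1 - k ^ 2 * x) * x * (((w₀ + l * z₀) ^ 2 * (1 - k ^ 2 * x) +
      k * (w₁ + l * (k * z₁)) ^ 2 * (1 - x) - (1 - x) * (1 - k ^ 2 * x)) +
      k ^ 2 * (x - l * m) ^ 2)) * hz -
    (1 - x) * (1 - k ^ 2 * x) * x * (((z₀ + m * w₀) ^ 2 * (1 - k ^ 2 * x) +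
      k * (z₁ + m * (k * w₁)) ^ 2 * (1 - x) - (1 - x) * (1 - k ^ 2 * x) *
        (z₀ ^ 2 + k * z₁ ^ 2)) + k ^ 2 * (x - l * m) ^ 2 * (z₀ ^ 2 + k * z₁ ^ 2)) * hw

end

theorem dualData_ellipse {k : ℝ} (hk : 1 < k) {u : Fin 2 → ℂ} (h0 : u 0 ≠ 0) (h1 : u 1 ≠ 0) :
    DualData k (fun x => ‖octicW (k : ℂ) (u 0) (u 1) x‖)
      (fun x => x * (‖u 0‖ ^ 2 * (1 - k ^ 2 * x) + k ^ 2 * ‖u 1‖ ^ 2 * (1 - x))) := by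
  have hk2 : 1 < k ^ 2 := by nlinarith
  have hu0 : 0 < ‖u 0‖ ^ 2 := by positivity
  have hu1 : 0 < ‖u 1‖ ^ 2 := by positivity
  refine ⟨hk, ?_, fun _ => norm_nonneg _, by fun_prop, by simp, ?_, ?_⟩
  · unfold octicW
    fun_prop
  · nlinarith
  · have e : k ^ 2 * (1 / k ^ 2) = 1 := mul_one_div_cancel (by linarith)
    have e2 : 0 < 1 / k ^ 2 := by positivity
    have e3 : 1 / k ^ 2 < 1 := by rw [div_lt_one (by linarith)]; exact hk2
    rw [e, sub_self, mul_zero, zero_add]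
    exact mul_pos e2 (mul_pos (by positivity) (by linarith))

theorem mul_star_eq (z : ℂ) : z * star z = ((‖z‖ ^ 2 : ℝ) : ℂ) := by
  rw [Complex.star_def, Complex.mul_conj, Complex.normSq_eq_norm_sq]

/-- At a genuine critical point m = l̄, so p = |l|² and n = |z₁|² + k²|z₂|² are positive, and the
level identity becomes real. The number ω(p) is positive because D m = 2p S W with D and m nonzero.
-/
theorem dualCritical_ellipse {k : ℝ} {u z : Fin 2 → ℂ} {l m : ℂ}
    (h : EllipseSolution (k : ℂ) (u 0) (u 1) (star u 0) (star u 1) (z 0) (z 1) (star z 0) (star z 1)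
      l m) (hr : l * m ≠ 0 ∧ l * m ≠ 1 ∧ (k : ℂ) ^ 2 * (l * m) ≠ 1 ∧
        octicD (k : ℂ) (u 0) (u 1) (star u 0) (star u 1) (l * m) ≠ 0) :
    ∃ p n, l * m = (p : ℝ) ∧ DualCritical k (fun x => ‖octicW (k : ℂ) (u 0) (u 1) x‖)
      (fun x => x * (‖u 0‖ ^ 2 * (1 - k ^ 2 * x) + k ^ 2 * ‖u 1‖ ^ 2 * (1 - x))) p n := by
  obtain ⟨h0, hA, hB, hD⟩ := hr
  have hm : m = star l := by
    rw [← h.multiplier_eq, ← h.symm.multiplier_eq]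
    simp only [Pi.star_apply, star_add, star_mul', star_sub, star_star]
  have hp : l * m = ((‖l‖ ^ 2 : ℝ) : ℂ) := by rw [hm, mul_star_eq]
  have hW := h.octicD_mul' hA hB
  have hl := h.level
  rw [hp] at h0 hA hB hD hW hl
  have hl0 : l ≠ 0 := by
    rintro rfl
    simp at h0
  refine ⟨‖l‖ ^ 2, ‖z 0‖ ^ 2 + k ^ 2 * ‖z 1‖ ^ 2, hp, by positivity, ?_, ?_, ?_, ?_, ?_⟩
  · by_cases hz : z 0 = 0
    · have h1 := h.hz
      have hk : k ≠ 0 := by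
        rintro rfl
        simp [hz] at h1
      have hz1 : z 1 ≠ 0 := by
        intro hz1
        simp [hz, hz1] at h1
      positivity
    · positivity
  · exact_mod_cast hA
  · exact_mod_cast hB
  · refine norm_pos_iff.mpr fun hw => ?_
    rw [hw, mul_zero] at hW
    refine mul_ne_zero hD ?_ hW
    rw [hm]
    exact star_ne_zero.mpr hl0
  · intro x hx
    have hx' := hl x
    have hstar : octicW (k : ℂ) (star u 0) (star u 1) x = star (octicW (k : ℂ) (u 0) (u 1) x) := by
      simp [octicW]
    rw [hstar, mul_star_eq] at hx'
    simp only [Pi.star_apply, mul_star_eq] at hx'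
    exact_mod_cast (by
      push_cast at hx' ⊢
      linear_combination hx' : (((((1 - x) * (1 - k ^ 2 * x) * (‖l‖ ^ 2 * (‖z 0‖ ^ 2 + k ^ 2 * ‖z 1‖ ^ 2)) +
      x * (‖u 0‖ ^ 2 * (1 - k ^ 2 * x) + k ^ 2 * ‖u 1‖ ^ 2 * (1 - x))) ^ 2 -
        x * ‖octicW (k : ℂ) (u 0) (u 1) x‖ ^ 2 : ℝ)) : ℂ) =
    ((-((1 - x) * (1 - k ^ 2 * x)) * ((x - ‖l‖ ^ 2) ^ 2 * (k ^ 2 * x - (‖z 0‖ ^ 2 + k ^ 2 * ‖z 1‖ ^ 2) ^ 2)) : ℝ) : ℂ))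

/-- All eight simple roots of the octic would be real parameters of dual critical points, and there
are at most five of those. -/
theorem eight_notMem_openCounts_ellipseMat {k : ℝ} (hk : 1 < k) :
    8 ∉ openCounts (ellipseMat k) := by
  intro h8
  have gu : Generic fun u _ => u 0 ≠ 0 ∧ u 1 ≠ 0 := by
    refine Generic.of_eval (uM 0 * uM 1) ![1, 1] ![0, 0] (by simp) fun u v h => ?_
    simpa using h
  obtain ⟨u, ⟨hgen, hu⟩, hdeg, hsep, -, hroots⟩ :=
    (rootCount_ellipseMat hk).all_roots h8 ((generic_octic hk).and gu)
  have hd := dualData_ellipse hk hu.1 hu.2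
  have hreal : ∀ q : ℂ, (polyAt (octicPoly k) u (star u)).eval q = 0 →
      ∃ p n, q = (p : ℝ) ∧ DualCritical k (fun x => ‖octicW (k : ℂ) (u 0) (u 1) x‖)
        (fun x => x * (‖u 0‖ ^ 2 * (1 - k ^ 2 * x) + k ^ 2 * ‖u 1‖ ^ 2 * (1 - x))) p n := by
    intro q hq
    obtain ⟨z, hz, rfl⟩ := hroots q hq
    have hmem : (z, star z) ∈ virtSet (ellipseMat k) u (star u) := by
      simp only [virtSet, Set.mem_ofPred_eq, star_star, ← star_sub]
      exact ⟨hz, hz⟩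
    rw [polyAt_octicPoly, eval_octicFamily] at hq
    exact dualCritical_ellipse (mem_virtSet_ellipseMat.mp hmem) (hgen.2.2 _ hq)
  have hcard := encard_roots_of_separable hsep
  rw [hdeg] at hcard
  let s : Finset ℝ := (polyAt (octicPoly k) u (star u)).roots.toFinset.image Complex.re
  have hs : s.card ≤ 5 := by
    refine hd.card_le fun p hp => ?_
    obtain ⟨q, hq, rfl⟩ := Finset.mem_image.mp hp
    obtain ⟨p, n, rfl, hc⟩ := hreal q (Polynomial.isRoot_of_mem_roots (Multiset.mem_toFinset.mp hq))
    exact ⟨n, hc⟩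
  have hs8 : s.card = 8 := by
    rw [Finset.card_image_of_injOn, Multiset.toFinset_card_of_nodup (Polynomial.nodup_roots hsep),
      ← (IsAlgClosed.splits _).natDegree_eq_card_roots, hdeg]
    intro q hq q' hq' h
    obtain ⟨p, n, rfl, -⟩ := hreal q (Polynomial.isRoot_of_mem_roots (Multiset.mem_toFinset.mp hq))
    obtain ⟨p', n', rfl, -⟩ := hreal q' (Polynomial.isRoot_of_mem_roots (Multiset.mem_toFinset.mp hq'))
    rw [Complex.ofReal_re, Complex.ofReal_re] at h
    rw [h]
  omega

end HermitianDistance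
end

open MvPolynomial
noncomputable section
namespace HermitianDistance

theorem openCounts_ellipseMat_subset {k : ℝ} (hk : 1 < k) :
    openCounts (ellipseMat k) ⊆ {2, 4, 6} := by
  intro n hn
  obtain ⟨h1, h2⟩ := (genericCount_ellipseMat hk).mod_two hn
  have h3 : n ≠ 8 := by
    rintro rfl
    exact eight_notMem_openCounts_ellipseMat hk hn
  have h4 : n ≠ 0 := by
    rintro rfl
    obtain ⟨U, -, ⟨u, hu⟩, h⟩ := hn
    have := exists_mem_critSet (isSymm_ellipseMat k) (det_ellipseMat (by linarith))
      (z₀ := ![1, 0]) (by rw [conicVal_ellipseMat]; simp) u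
    rw [← Set.encard_pos, h u hu] at this
    simp at this
  simp only [Set.mem_insert_iff, Set.mem_singleton_iff]
  omega

/-! ### The degrees of a smooth conic -/

section Degrees

variable {A : Matrix (Fin 3) (Fin 3) ℂ}

theorem isVHD_of_genericCount (hA : A.IsSymm) (hd : A.det ≠ 0) (hA1 : leadingBlock A ≠ 0) {d : ℕ}
    (h : GenericCount A d) : IsVHD (affineConic A) d := by
  obtain ⟨g, hg, h⟩ := h
  refine ⟨g, hg, fun u v huv => ?_⟩
  rw [virtualCriticalPoints_affineConic hA hd hA1]
  exact h u v huv

theorem HD_affineConic (hA : A.IsSymm) (hd : A.det ≠ 0) (hA1 : leadingBlock A ≠ 0) :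
    HD (affineConic A) = openCounts A := by
  simp only [HD, openCounts, criticalPoints_affineConic hA hd hA1]

end Degrees

end HermitianDistance
end

theorem mainTheorem6 (A : Matrix (Fin 3) (Fin 3) ℂ) (hA : A.IsSymm)
    (hdeg : HermitianDistance.leadingBlock A ≠ 0) :
    (A.det = 0 →
      (A.rank = 1 →
        HermitianDistance.IsVHD (HermitianDistance.affineConic A) 1 ∧
        HermitianDistance.HD (HermitianDistance.affineConic A) = {1}) ∧
      (A.rank = 2 →
        HermitianDistance.IsVHD (HermitianDistance.affineConic A) 2 ∧
        HermitianDistance.HD (HermitianDistance.affineConic A) = {2})) ∧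
    (A.det ≠ 0 →
      ((HermitianDistance.leadingBlock A).det = 0 →
        HermitianDistance.IsVHD (HermitianDistance.affineConic A) 5 ∧
        HermitianDistance.HD (HermitianDistance.affineConic A) = {1, 3}) ∧
      ((HermitianDistance.leadingBlock A).det ≠ 0 →
        HermitianDistance.singularValue (HermitianDistance.leadingBlock A) 0 =
          HermitianDistance.singularValue (HermitianDistance.leadingBlock A) 1 →
        HermitianDistance.IsVHD (HermitianDistance.affineConic A) 6 ∧
        HermitianDistance.HD (HermitianDistance.affineConic A) = {2, 4}) ∧
      ((HermitianDistance.leadingBlock A).det ≠ 0 →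
        HermitianDistance.singularValue (HermitianDistance.leadingBlock A) 0 ≠
          HermitianDistance.singularValue (HermitianDistance.leadingBlock A) 1 →
        HermitianDistance.IsVHD (HermitianDistance.affineConic A) 8 ∧
        {2, 4} ⊆ HermitianDistance.HD (HermitianDistance.affineConic A) ∧
        HermitianDistance.HD (HermitianDistance.affineConic A) ⊆ {2, 4, 6})) := by
  refine ⟨fun hd => ⟨HermitianDistance.conic_rank_one hA hdeg hd, HermitianDistance.conic_rank_two hA hdeg hd⟩, fun hd => ?_⟩
  rw [HermitianDistance.HD_affineConic hA hd hdeg]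
  have hV := fun n => HermitianDistance.isVHD_of_genericCount (d := n) hA hd hdeg
  obtain ⟨h1, h2, h3⟩ := HermitianDistance.sameCounts_cases hA hd
  refine ⟨fun h => ?_, fun h hs => ?_, fun h hs => ?_⟩
  · exact ⟨hV 5 ((h1 h).1 5 HermitianDistance.rootCount_parabolaMat.genericCount),
      (h1 h).2.trans HermitianDistance.openCounts_parabolaMat⟩
  · exact ⟨hV 6 ((h2 h hs).1 6 HermitianDistance.rootCount_circleMat.genericCount),
      (h2 h hs).2.trans HermitianDistance.openCounts_circleMat⟩
  · obtain ⟨k, hk, hA'⟩ := h3 h hs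
    rw [hA'.2]
    refine ⟨hV 8 (hA'.1 8 (HermitianDistance.genericCount_ellipseMat hk)), ?_, HermitianDistance.openCounts_ellipseMat_subset hk⟩
    rintro n (rfl | rfl)
    · exact HermitianDistance.two_mem_openCounts_ellipseMat hk.le
    · exact HermitianDistance.four_mem_openCounts_ellipseMat hk
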